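/- Let $m_1,m_2>0$ and consider the gravitational two-body problem on hyperbolic 3-space $H^3$, with phase space $T^*H^3\times T^*H^3$ (collisions removed) and Hamiltonian $$H=\frac{|p_1|^2}{2m_1}+\frac{|p_2|^2}{2m_2}-m_1m_2\coth\psi ,$$ where $\psi>0$, the \emph{separation}, is the hyperbolic distance between the particles. Identify $H^3$ with the Hermitian $2\times 2$ matrices $Q$ with $\det Q=1$ and $\operatorname{tr}Q>0$, on which $SL_2(\mathbb C)$ acts by $g\cdot Q=gQg^\dagger$, and covectors $p$ at $q$ with Hermitian matrices orthogonal to $q$ for the bilinear form $\langle\cdot,\cdot\rangle$ polarising $\det$, so that $|p|^2=-\det p$. Let $C_{tot}=p_1q_1^{-1}+p_2q_2^{-1}$ be the total momentum; its determinant $\|C_{tot}\|^2\in\mathbb C$ is a Casimir of the reduced space $(T^*H^3\times T^*H^3)/SL_2(\mathbb C)$. A \emph{relative equilibrium} (RE) is a solution which is the orbit of a one-parameter subgroup $t\mapsto\exp(t\xi)$, $\xi\in\mathfrak{sl}_2(\mathbb C)$. It has \emph{phase} $\theta$ (modulo $\pi$) if $\xi$ is conjugate to $\operatorname{diag}(\eta,-\eta)$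 with $\eta\neq 0$ and $\arg\eta=\theta$. An RE is \emph{degenerate} if zero is an eigenvalue of the linearisation, at the corresponding fixed point, of the reduced flow restricted to the symplectic leaf (the level set of $\|C_{tot}\|^2$). Put $$Z=\sqrt{(m_1+m_2e^{2\psi})(m_2+m_1e^{2\psi})},$$ $$\Gamma(\theta,\psi)=(m_1+m_2)Z\cos2\theta+\left(\frac{1+\tanh\psi}{2\cosh\psi}\right)(m_1+m_2\cosh2\psi)(m_2+m_1\cosh2\psi).$$ For every $\theta\in\mathbb R$ and $\psi>0$ there is an RE with phase $\theta$ and separation $\psi$, and the value $D(\theta,\psi)=(H,\|C_{tot}\|^2)\in\mathbb R\times\mathbb C$ is the same for all such RE; the resulting map $D$, a parametrisation of the energy-Casimir diagram, is smooth on $\mathbb R\times(0,\infty)$. Moreover: (i) an RE with separation $\psi$ and phase $\theta$ is degenerate if and only if $\Gamma(\theta,\psi)=0$; (ii) these RE correspond to the singular points of the energy-Casimir diagram: $D$ fails to be an immersion at $(\theta,\psi)$ if and only if $\Gamma(\theta,\psi)=0$, and these singular points are cusps: at each of them there are a direction $k\in\mathbb R^2$, $k\neq0$, and linearly independent $A,B\in\mathbb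 R\times\mathbb C\cong\mathbb R^3$ with $D((\theta,\psi)+tk)=D(\theta,\psi)+t^2A+t^3B+o(t^3)$ as $t\to0$. -/

import Mathlib

open scoped Matrix.Norms.Operator ContDiff Topology

noncomputable section

namespace HypTwoBody

/-! ### Biquaternions and the phase space -/

/-- Biquaternions, identified with complex `2 × 2` matrices; the quadratic form is `det`. -/
abbrev Biquat : Type := Matrix (Fin 2) (Fin 2) ℂ

/-- The complex bilinear form polarising `det`: one has `bil a a = det a`. -/
def bil (a b : Biquat) : ℂ := (a.trace * b.trace - (a * b).trace) / 2

/-- Ambient space of the two-body phase space; a state is `(q₁, p₁, q₂, p₂)`. -/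
abbrev State : Type := Biquat × Biquat × Biquat × Biquat

abbrev State.q₁ (x : State) : Biquat := x.1
abbrev State.p₁ (x : State) : Biquat := x.2.1
abbrev State.q₂ (x : State) : Biquat := x.2.2.1
abbrev State.p₂ (x : State) : Biquat := x.2.2.2

/-- Hyperbolic 3-space: Hermitian matrices of determinant one in the sheet `t ≥ 1`
(`trace = 2 t`). -/
def hyp3 : Set Biquat := {q | q.IsHermitian ∧ q.det = 1 ∧ 0 < q.trace.re}

/-- `T*H³ × T*H³` with the collision set removed. Covectors at `q` are identified, through `bil`,
with the Hermitian matrices that are `bil`-orthogonal to `q`. -/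
def phaseSpace : Set State :=
  {x | x.q₁ ∈ hyp3 ∧ x.p₁.IsHermitian ∧ bil x.q₁ x.p₁ = 0 ∧
       x.q₂ ∈ hyp3 ∧ x.p₂.IsHermitian ∧ bil x.q₂ x.p₂ = 0 ∧ x.q₁ ≠ x.q₂}

/-- The tangent space of the phase space at `x`. -/
def phaseTangent (x : State) : Set State :=
  {v | v.q₁.IsHermitian ∧ v.p₁.IsHermitian ∧ v.q₂.IsHermitian ∧ v.p₂.IsHermitian ∧
       bil x.q₁ v.q₁ = 0 ∧ bil v.q₁ x.p₁ + bil x.q₁ v.p₁ = 0 ∧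
       bil x.q₂ v.q₂ = 0 ∧ bil v.q₂ x.p₂ + bil x.q₂ v.p₂ = 0}

/-- The canonical symplectic form on the phase space. -/
def symplecticForm (u v : State) : ℝ :=
  (bil u.q₁ v.p₁ - bil v.q₁ u.p₁ + bil u.q₂ v.p₂ - bil v.q₂ u.p₂).re

/-! ### The gravitational two-body problem -/

/-- `z = ⟨q₁, q₂⟩`, the hyperbolic cosine of the distance between the particles. -/
def coshSep (x : State) : ℝ := (bil x.q₁ x.q₂).re

/-- The gravitational potential `-m₁ m₂ coth ψ` as a function of `z = cosh ψ`. -/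
def potential (m₁ m₂ z : ℝ) : ℝ := -(m₁ * m₂) * (z / √(z ^ 2 - 1))

/-- `f = dV / dz`. -/
def force (m₁ m₂ z : ℝ) : ℝ := deriv (potential m₁ m₂) z

/-- The Hamiltonian. The hyperbolic metric is minus the restriction of the ambient form, so both
kinetic terms are non-negative on the phase space. -/
def hamiltonian (m₁ m₂ : ℝ) (x : State) : ℝ :=
  -(x.p₁.det.re / (2 * m₁)) - x.p₂.det.re / (2 * m₂) + potential m₁ m₂ (coshSep x)

/-- The Hamiltonian vector field of `hamiltonian` on the phase space, written in the ambient
coordinates; see `hamiltonianField_mem_phaseTangent` and `hamiltonianField_spec`. -/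
def hamiltonianField (m₁ m₂ : ℝ) (x : State) : State :=
  (-(1 / m₁) • x.p₁,
   -(force m₁ m₂ (coshSep x)) • (x.q₂ - coshSep x • x.q₁) + (x.p₁.det.re / m₁) • x.q₁,
   -(1 / m₂) • x.p₂,
   -(force m₁ m₂ (coshSep x)) • (x.q₁ - coshSep x • x.q₂) + (x.p₂.det.re / m₂) • x.q₂)

theorem bil_eq (a b : Biquat) :
    bil a b = (a 0 0 * b 1 1 + a 1 1 * b 0 0 - a 0 1 * b 1 0 - a 1 0 * b 0 1) / 2 := by
  simp only [bil, Matrix.trace_fin_two, Matrix.mul_apply, Fin.sum_univ_two]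
  ring

theorem det_re_eq {a : Biquat} (ha : a.IsHermitian) : ((a.det.re : ℝ) : ℂ) = a.det := by
  have h : star a.det = a.det := by rw [← Matrix.det_conjTranspose, ha.eq]
  exact Complex.conj_eq_iff_re.mp h

theorem bil_re_eq {a b : Biquat} (ha : a.IsHermitian) (hb : b.IsHermitian) :
    (((bil a b).re : ℝ) : ℂ) = bil a b := by
  have h : star (bil a b) = bil a b := by
    rw [bil_eq]
    have e := fun i j => ha.apply i j
    have e' := fun i j => hb.apply i j
    simp only [star_div₀, star_sub, star_add, star_mul', e, e']
    simp
    ring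
  exact Complex.conj_eq_iff_re.mp h

theorem isHermitian_smul {a : Biquat} (ha : a.IsHermitian) (c : ℝ) : (c • a).IsHermitian := by
  unfold Matrix.IsHermitian
  rw [Matrix.conjTranspose_smul, ha.eq]; simp

/-- The field is tangent to the phase space. -/
theorem hamiltonianField_mem_phaseTangent (m₁ m₂ : ℝ) {x : State} (hx : x ∈ phaseSpace) :
    hamiltonianField m₁ m₂ x ∈ phaseTangent x := by
  obtain ⟨⟨h1, d1, -⟩, hp1, o1, ⟨h2, d2, -⟩, hp2, o2, -⟩ := hx
  have z := bil_re_eq h1 h2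
  have e1 := det_re_eq hp1
  have e2 := det_re_eq hp2
  refine ⟨isHermitian_smul hp1 _, (isHermitian_smul (h2.sub (isHermitian_smul h1 _)) _).add
    (isHermitian_smul h1 _), isHermitian_smul hp2 _,
    (isHermitian_smul (h1.sub (isHermitian_smul h2 _)) _).add (isHermitian_smul h2 _), ?_, ?_, ?_, ?_⟩
  all_goals
    rw [Matrix.det_fin_two] at d1 d2
    rw [Matrix.det_fin_two (State.p₁ x)] at e1
    rw [Matrix.det_fin_two (State.p₂ x)] at e2
    rw [bil_eq] at o1 o2 z
    simp only [bil_eq, hamiltonianField, State.q₁, State.p₁, State.q₂, State.p₂, coshSep,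
      Matrix.smul_apply, Matrix.add_apply, Matrix.sub_apply, Complex.real_smul,
      Complex.ofReal_neg, Complex.ofReal_div, Complex.ofReal_one, Matrix.det_fin_two] at *
    try rw [z]
    try rw [e1]
    try rw [e2]
    try generalize (force m₁ m₂ _ : ℂ) = F
  · linear_combination (-1 / (m₁ : ℂ)) * o1
  · linear_combination (F * ((x.1 0 0 * x.2.2.1 1 1 + x.1 1 1 * x.2.2.1 0 0 - x.1 0 1 * x.2.2.1 1 0 - x.1 1 0 * x.2.2.1 0 1) / 2) +
      (x.2.1 0 0 * x.2.1 1 1 - x.2.1 0 1 * x.2.1 1 0) / (m₁ : ℂ)) * d1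
  · linear_combination (-1 / (m₂ : ℂ)) * o2
  · linear_combination (F * ((x.1 0 0 * x.2.2.1 1 1 + x.1 1 1 * x.2.2.1 0 0 - x.1 0 1 * x.2.2.1 1 0 - x.1 1 0 * x.2.2.1 0 1) / 2) +
      (x.2.2.2 0 0 * x.2.2.2 1 1 - x.2.2.2 0 1 * x.2.2.2 1 0) / (m₂ : ℂ)) * d2

/-- Hamilton's equations: off the collision set (where `coshSep` exceeds one), the field is the
symplectic gradient of the Hamiltonian. -/
theorem hamiltonianField_spec (m₁ m₂ : ℝ) {x : State} (hx : x ∈ phaseSpace)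
    (hz : 1 < coshSep x) {v : State} (hv : v ∈ phaseTangent x) :
    fderiv ℝ (hamiltonian m₁ m₂) x v = symplecticForm (hamiltonianField m₁ m₂ x) v := by
  obtain ⟨⟨h1, d1, -⟩, hp1, o1, ⟨h2, d2, -⟩, hp2, o2, -⟩ := hx
  obtain ⟨v1, w1, v2, w2, a1, b1, a2, b2⟩ := hv
  have hpot : HasDerivAt (potential m₁ m₂) (force m₁ m₂ (coshSep x)) (coshSep x) := by
    refine DifferentiableAt.hasDerivAt ?_
    have h0 : (coshSep x) ^ 2 - 1 ≠ 0 := by nlinarith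
    have h0' : √((coshSep x) ^ 2 - 1) ≠ 0 := (Real.sqrt_pos.mpr (by nlinarith)).ne'
    unfold potential
    fun_prop (disch := assumption)
  have hbil : ∀ t : ℝ, coshSep (x + t • v) = coshSep x + t * (bil x.q₁ v.q₂ + bil v.q₁ x.q₂).re
      + t ^ 2 * (bil v.q₁ v.q₂).re := by
    intro t
    have : bil (x + t • v).q₁ (x + t • v).q₂ = bil x.q₁ x.q₂ +
        (t : ℂ) * (bil x.q₁ v.q₂ + bil v.q₁ x.q₂) + ((t ^ 2 : ℝ) : ℂ) * (bil v.q₁ v.q₂) := by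
      simp [bil_eq, State.q₁, State.q₂]; ring
    simp only [coshSep, this, Complex.add_re, Complex.re_ofReal_mul]
  have hdet : ∀ (a b : Biquat) (t : ℝ), (a + t • b).det.re =
      a.det.re + t * (2 * (bil a b).re) + t ^ 2 * b.det.re := by
    intro a b t
    have : (a + t • b).det = a.det + (t : ℂ) * ((2 : ℝ) * bil a b) + ((t ^ 2 : ℝ) : ℂ) * b.det := by
      simp [bil_eq, Matrix.det_fin_two]; ring
    simp only [this, Complex.add_re, Complex.re_ofReal_mul]
  have hquad : ∀ a b c : ℝ, HasDerivAt (fun t : ℝ => a + t * b + t ^ 2 * c) b 0 := by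
    intro a b c
    have := (((hasDerivAt_id (0 : ℝ)).mul_const b).const_add a).add
      (((hasDerivAt_id (0 : ℝ)).pow 2).mul_const c)
    exact this.congr_deriv (by simp)
  have hline : HasDerivAt (fun t : ℝ => hamiltonian m₁ m₂ (x + t • v))
      (-((2 * (bil x.p₁ v.p₁).re) / (2 * m₁)) - (2 * (bil x.p₂ v.p₂).re) / (2 * m₂) +
        force m₁ m₂ (coshSep x) * (bil x.q₁ v.q₂ + bil v.q₁ x.q₂).re) 0 := by
    have e1 := hquad x.p₁.det.re (2 * (bil x.p₁ v.p₁).re) v.p₁.det.re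
    have e2 := hquad x.p₂.det.re (2 * (bil x.p₂ v.p₂).re) v.p₂.det.re
    have e3 := hquad (coshSep x) (bil x.q₁ v.q₂ + bil v.q₁ x.q₂).re (bil v.q₁ v.q₂).re
    have hpot' : HasDerivAt (potential m₁ m₂) (force m₁ m₂ (coshSep x))
        ((fun t : ℝ => coshSep x + t * (bil x.q₁ v.q₂ + bil v.q₁ x.q₂).re
          + t ^ 2 * (bil v.q₁ v.q₂).re) 0) := by simpa using hpot
    have := (((e1.div_const (2 * m₁)).neg).sub (e2.div_const (2 * m₂))).add (hpot'.comp (0 : ℝ) e3)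
    refine this.congr_of_eventuallyEq (Filter.Eventually.of_forall fun t => ?_)
    simp only [hamiltonian, hbil]
    have q1 := hdet x.p₁ v.p₁ t
    have q2 := hdet x.p₂ v.p₂ t
    simp only [Pi.add_apply, Pi.sub_apply, Pi.neg_apply, Function.comp_apply]
    rw [← q1, ← q2]
    rfl
  have hdiff : DifferentiableAt ℝ (hamiltonian m₁ m₂) x := by
    have htr : Differentiable ℝ (fun a : Biquat => a.trace) :=
      (Matrix.traceLinearMap (Fin 2) ℝ ℂ).toContinuousLinearMap.differentiable
    have hb : ∀ f g : State → Biquat, Differentiable ℝ f → Differentiable ℝ g →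
        Differentiable ℝ (fun y => (bil (f y) (g y)).re) := by
      intro f g hf hg
      have t1 : Differentiable ℝ (fun y => (f y).trace) := htr.comp hf
      have t2 : Differentiable ℝ (fun y => (g y).trace) := htr.comp hg
      have t3 : Differentiable ℝ (fun y => (f y * g y).trace) := htr.comp (hf.mul hg)
      have t4 : Differentiable ℝ (fun y => bil (f y) (g y)) := by
        simp only [bil, div_eq_mul_inv]
        fun_prop
      exact Complex.reCLM.differentiable.comp t4
    have hd : ∀ a : Biquat, a.det.re = (bil a a).re := by
      intro a
      rw [bil_eq, Matrix.det_fin_two]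
      congr 1
      ring
    have d1 := (hb (fun y => y.p₁) (fun y => y.p₁) (by fun_prop) (by fun_prop)) x
    have d2 := (hb (fun y => y.p₂) (fun y => y.p₂) (by fun_prop) (by fun_prop)) x
    have d3 : DifferentiableAt ℝ coshSep x :=
      (hb (fun y => y.q₁) (fun y => y.q₂) (by fun_prop) (by fun_prop)) x
    have d4 : DifferentiableAt ℝ (fun y => potential m₁ m₂ (coshSep y)) x :=
      hpot.differentiableAt.comp x d3
    have hH : hamiltonian m₁ m₂ = fun y => -((bil y.p₁ y.p₁).re / (2 * m₁)) -
        (bil y.p₂ y.p₂).re / (2 * m₂) + potential m₁ m₂ (coshSep y) := by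
      funext y
      simp only [hamiltonian, hd]
    rw [hH]
    simp only [div_eq_mul_inv]
    fun_prop
  have hcomp : HasDerivAt (fun t : ℝ => hamiltonian m₁ m₂ (x + t • v))
      (fderiv ℝ (hamiltonian m₁ m₂) x v) 0 := hdiff.hasFDerivAt.hasLineDerivAt v
  rw [hcomp.unique hline]
  have hsymm : ∀ a b : Biquat, bil a b = bil b a := fun a b => by
    rw [bil_eq, bil_eq]; ring
  have hl : ∀ (c : ℝ) (a b : Biquat), bil (c • a) b = c * bil a b := fun c a b => by
    simp [bil_eq]; ring
  have hr : ∀ (c d e : ℝ) (a b b' : Biquat),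
      bil a (c • (b' - d • b) + e • b) = c * (bil a b' - d * bil a b) + e * bil a b :=
    fun c d e a b b' => by simp [bil_eq]; ring
  rw [hsymm] at a1 a2
  simp only [symplecticForm, hamiltonianField, hl, hr, a1, a2, mul_zero, sub_zero, add_zero,
    Complex.add_re, Complex.sub_re, Complex.re_ofReal_mul, hsymm x.q₁ v.q₂]
  ring

/-! ### Symmetry and momentum -/

/-- The action of `g ∈ SL₂(ℂ)` on the phase space: `Q ↦ g Q g†` on positions and momenta. -/
def act (g : Biquat) (x : State) : State :=
  (g * x.q₁ * g.conjTranspose, g * x.p₁ * g.conjTranspose,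
   g * x.q₂ * g.conjTranspose, g * x.p₂ * g.conjTranspose)

/-- The infinitesimal generator of the action of `t ↦ exp (t ξ)`. -/
def infAct (ξ : Biquat) (x : State) : State :=
  (ξ * x.q₁ + x.q₁ * ξ.conjTranspose, ξ * x.p₁ + x.p₁ * ξ.conjTranspose,
   ξ * x.q₂ + x.q₂ * ξ.conjTranspose, ξ * x.p₂ + x.p₂ * ξ.conjTranspose)

/-- The tangent space at `x` of the `SL₂(ℂ)`-orbit through `x`. -/
def orbitTangent (x : State) : Set State := {v | ∃ ζ : Biquat, ζ.trace = 0 ∧ v = infAct ζ x}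

/-- The total momentum `C_tot = L_tot = p₁ q₁⁻¹ + p₂ q₂⁻¹` (the adjugate is the inverse, as the
positions have determinant one). -/
def totalMomentum (x : State) : Biquat := x.p₁ * x.q₁.adjugate + x.p₂ * x.q₂.adjugate

/-- The Casimir `‖C_tot‖²`. -/
def casimir (x : State) : ℂ := (totalMomentum x).det

/-- The energy-Casimir map `(H, ‖C_tot‖²)`. -/
def energyCasimir (m₁ m₂ : ℝ) (x : State) : ℝ × ℂ := (hamiltonian m₁ m₂ x, casimir x)

/-! ### Relative equilibria -/

/-- `x` is a relative equilibrium with generator `ξ ∈ sl₂(ℂ)`: the orbit of `x` under the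
one-parameter subgroup `exp (t ξ)` is a solution. -/
def IsRelEquilibrium (m₁ m₂ : ℝ) (x : State) (ξ : Biquat) : Prop :=
  x ∈ phaseSpace ∧ ξ.trace = 0 ∧
    ∀ t : ℝ, HasDerivAt (fun s : ℝ => act (NormedSpace.exp (s • ξ)) x)
      (hamiltonianField m₁ m₂ (act (NormedSpace.exp (t • ξ)) x)) t

/-- The phase of the generator `ξ` is `θ` (modulo `π`): `ξ` is conjugate in `SL₂(ℂ)` to
`diag (η, -η)` with `η = r exp (i θ)`, `r > 0`. -/
def HasPhase (ξ : Biquat) (θ : ℝ) : Prop :=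
  ∃ r : ℝ, 0 < r ∧ ∃ g : Biquat, g.det = 1 ∧
    ξ = g * !![(r : ℂ) * Complex.exp (θ * Complex.I), 0;
               0, -((r : ℂ) * Complex.exp (θ * Complex.I))] * g⁻¹

/-- `x` is a relative equilibrium with generator `ξ`, phase `θ` and separation `ψ`. -/
def IsRelEquilibriumWith (m₁ m₂ : ℝ) (x : State) (ξ : Biquat) (θ ψ : ℝ) : Prop :=
  IsRelEquilibrium m₁ m₂ x ξ ∧ HasPhase ξ θ ∧ 0 < ψ ∧ bil x.q₁ x.q₂ = (Real.cosh ψ : ℂ)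

/-- The vectors at `x` whose image in the reduced space `phaseSpace / SL₂(ℂ)` is tangent to the
symplectic leaf, that is, to the level set of the Casimir. The tangent space of the leaf is the
quotient of this space by `orbitTangent x`. -/
def leafTangent (x : State) : Set State :=
  {v | v ∈ phaseTangent x ∧ fderiv ℝ casimir x v = 0}

/-- Linearisation at the relative equilibrium `x` of the field `X_H - ξ_P`, which vanishes at `x`
and induces the same vector field as `X_H` on the reduced space. -/
def linearisation (m₁ m₂ : ℝ) (x : State) (ξ : Biquat) : State →L[ℝ] State :=
  fderiv ℝ (fun y => hamiltonianField m₁ m₂ y - infAct ξ y) x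

/-- The relative equilibrium is degenerate: the linearisation of the reduced flow on the symplectic
leaf, an endomorphism of `leafTangent x / orbitTangent x`, has the eigenvalue zero. -/
def IsDegenerate (m₁ m₂ : ℝ) (x : State) (ξ : Biquat) : Prop :=
  ∃ v ∈ leafTangent x, v ∉ orbitTangent x ∧ linearisation m₁ m₂ x ξ v ∈ orbitTangent x

/-! ### The function `Γ` and singularities of surfaces -/

/-- `Z = √((m₁ + m₂ e^{2ψ}) (m₂ + m₁ e^{2ψ}))`. -/
def Zfun (m₁ m₂ ψ : ℝ) : ℝ :=
  √((m₁ + m₂ * Real.exp (2 * ψ)) * (m₂ + m₁ * Real.exp (2 * ψ)))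

/-- The function `Γ (θ, ψ)`. -/
def Gam (m₁ m₂ θ ψ : ℝ) : ℝ :=
  (m₁ + m₂) * Zfun m₁ m₂ ψ * Real.cos (2 * θ) +
    ((1 + Real.tanh ψ) / (2 * Real.cosh ψ)) *
      (m₁ + m₂ * Real.cosh (2 * ψ)) * (m₂ + m₁ * Real.cosh (2 * ψ))

/-- The parametrised surface `F` is singular at `a`: it is not an immersion there. -/
def IsSingularAt (F : ℝ × ℝ → ℝ × ℂ) (a : ℝ × ℝ) : Prop :=
  ¬ Function.Injective (fderiv ℝ F a)

/-- The parametrised surface `F` has a cusp at `a`: along some line through `a` it traces a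
semicubical cusp `F a + t² A + t³ B + o(t³)` with `A`, `B` linearly independent. -/
def HasCuspAt (F : ℝ × ℝ → ℝ × ℂ) (a : ℝ × ℝ) : Prop :=
  ∃ k : ℝ × ℝ, k ≠ 0 ∧ ∃ A B : ℝ × ℂ, LinearIndependent ℝ ![A, B] ∧
    (fun t : ℝ => F (a + t • k) - F a - t ^ 2 • A - t ^ 3 • B) =o[𝓝 0] (fun t : ℝ => t ^ 3)

end HypTwoBody

end

noncomputable section

namespace HypTwoBody

/-! ### Algebra of the bilinear form -/

/-! Everything is equivariant under `SL₂(ℂ)`, so by `isRelEquilibrium_iff` a relative equilibrium is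
a zero of `X_H - ξ_P`, and its generator may be taken to be `diag(η, -η)`, whose axis consists of
the diagonal matrices of `H³`. The momentum equations then involve `η` only through `|η|²`
(`momentum_equation_iff`), so the phase is a free parameter. They force both particles off the axis
(`offAxis`), on opposite sides of it along one geodesic, at distances `ρ₁ + ρ₂ = ψ` with `m₁ sinh
2ρ₁ = m₂ sinh 2ρ₂`. The separation thus determines the distances and `R = |η|²` (`axisDist_unique`),
and `exists_act_relEq` conjugates every relative equilibrium to the explicit family `relEq`.

With `M = m₁ + m₂`, `N = m₁ cosh 2ρ₁ + m₂ cosh 2ρ₂` and `w = M e^{iθ} + N e^{-iθ}`, the diagram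
along the family is the energy `R (N + M cos 2θ) - m₁ m₂ coth ψ` and the Casimir `-R w²`. If `v`
denotes the variation of `√R w` divided by `√R`, the Casimir varies by `-2 R w v` and the energy by
`2 R Re(e^{iθ} v)`. Hence `dE = Re(ν dC)` with `ν = -e^{iθ}/w`, and the diagram is singular exactly
where the real-linear map `(a, b) ↦ v` is. Up to a nonzero factor its determinant is `J = (logSum -
logDiff cos 2θ)/2`, and `Γ` is a nonvanishing multiple of `J` (`Gam_eq`).

Degeneracy has the same criterion because the family accounts for the kernel of the linearisation
modulo the group orbit. Velocities of the family solve the linearised equations modulo the orbit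
(`linearisation_of_hasDerivAt`). Conversely, after subtracting a velocity that matches the change of
separation, only a rotation of the phase remains (`linearised_solution`). So a null vector that is
tangent to the leaf and not to the orbit is a nonzero direction `(a, b)` with `dC = 0`, that is `v =
0`.

At a singular point the curve along the kernel direction has zero velocity, and `dE - Re(ν dC)`
annihilates its second derivative. It does not annihilate the third if `Re(ν' C'') ≠ 0`, which makes
the two independent (`exists_cusp_of_tangent`). That number is a nonzero multiple of the derivative
of `J` along the kernel direction, which is negative because `logSum / logDiff` decreases
(`wronskian_neg`). -/

theorem bil_eq_det (a b : Biquat) : bil a b = ((a + b).det - a.det - b.det) / 2 := by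
  rw [bil_eq, Matrix.det_fin_two, Matrix.det_fin_two, Matrix.det_fin_two]
  simp only [Matrix.add_apply]
  ring

theorem bil_comm (a b : Biquat) : bil a b = bil b a := by
  rw [bil_eq, bil_eq]; ring

theorem bil_self (a : Biquat) : bil a a = a.det := by
  rw [bil_eq, Matrix.det_fin_two]; ring

theorem bil_sub_left (a b c : Biquat) : bil (a - b) c = bil a c - bil b c := by
  simp only [bil_eq, Matrix.sub_apply]; ring

theorem bil_sub_right (a b c : Biquat) : bil a (b - c) = bil a b - bil a c := by
  simp only [bil_eq, Matrix.sub_apply]; ring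

theorem bil_smul_right (c : ℝ) (a b : Biquat) : bil a (c • b) = c * bil a b := by
  simp only [bil_eq, Matrix.smul_apply, Complex.real_smul]; ring

/-- The action of `g` on a single matrix. -/
def conj (g a : Biquat) : Biquat := g * a * g.conjTranspose

theorem det_conj {g : Biquat} (hg : g.det = 1) (a : Biquat) : (conj g a).det = a.det := by
  simp [conj, Matrix.det_mul, Matrix.det_conjTranspose, hg]

theorem conj_add (g a b : Biquat) : conj g (a + b) = conj g a + conj g b := by
  simp [conj, mul_add, add_mul]

theorem conj_sub (g a b : Biquat) : conj g (a - b) = conj g a - conj g b := by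
  simp [conj, mul_sub, sub_mul]

theorem conj_smul (g : Biquat) (c : ℝ) (a : Biquat) : conj g (c • a) = c • conj g a := by
  simp [conj]

theorem conj_conj (g h a : Biquat) : conj g (conj h a) = conj (g * h) a := by
  simp [conj, mul_assoc]

theorem conj_one (a : Biquat) : conj 1 a = a := by simp [conj]

theorem bil_conj {g : Biquat} (hg : g.det = 1) (a b : Biquat) :
    bil (conj g a) (conj g b) = bil a b := by
  simp only [bil_eq_det, ← conj_add, det_conj hg]

theorem isHermitian_conj (g : Biquat) {a : Biquat} (ha : a.IsHermitian) :
    (conj g a).IsHermitian := Matrix.isHermitian_mul_mul_conjTranspose g ha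

/-- The infinitesimal action of `ξ` on a single matrix. -/
def infConj (ξ a : Biquat) : Biquat := ξ * a + a * ξ.conjTranspose

theorem infConj_conj {g h : Biquat} (hg : h * g = 1) (ξ a : Biquat) :
    infConj (g * ξ * h) (conj g a) = conj g (infConj ξ a) := by
  have h' : g.conjTranspose * h.conjTranspose = 1 := by
    rw [← Matrix.conjTranspose_mul, hg, Matrix.conjTranspose_one]
  calc infConj (g * ξ * h) (conj g a)
      = g * ξ * (h * g) * a * g.conjTranspose +
        g * a * (g.conjTranspose * h.conjTranspose) * (ξ.conjTranspose * g.conjTranspose) := by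
        simp only [infConj, conj, Matrix.conjTranspose_mul, mul_assoc]
    _ = conj g (infConj ξ a) := by
        rw [hg, h']; simp only [infConj, conj, mul_add, add_mul, mul_assoc, mul_one]

theorem isHermitian_infConj (ξ : Biquat) {a : Biquat} (ha : a.IsHermitian) :
    (infConj ξ a).IsHermitian := by
  unfold Matrix.IsHermitian infConj
  rw [Matrix.conjTranspose_add, Matrix.conjTranspose_mul, Matrix.conjTranspose_mul, ha.eq,
    Matrix.conjTranspose_conjTranspose, add_comm]

theorem infConj_add_gen (ξ χ a : Biquat) : infConj (ξ + χ) a = infConj ξ a + infConj χ a := by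
  simp only [infConj, Matrix.conjTranspose_add, mul_add, add_mul]; abel

theorem infConj_sub_gen (ξ χ a : Biquat) : infConj (ξ - χ) a = infConj ξ a - infConj χ a := by
  simp only [infConj, Matrix.conjTranspose_sub, mul_sub, sub_mul]; abel

/-- Infinitesimal transformations compose as the Lie algebra acts. This is what lets a gauge change
`χ` alter the right-hand side of the linearised equations by a commutator. -/
theorem infConj_commutator (ξ χ a : Biquat) :
    infConj χ (infConj ξ a) - infConj ξ (infConj χ a) = infConj (χ * ξ - ξ * χ) a := by
  simp only [infConj, Matrix.conjTranspose_sub, Matrix.conjTranspose_mul]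
  noncomm_ring

/-! ### Equivariance -/

theorem act_eq (g : Biquat) (x : State) :
    act g x = (conj g x.q₁, conj g x.p₁, conj g x.q₂, conj g x.p₂) := rfl

theorem infAct_eq (ξ : Biquat) (x : State) :
    infAct ξ x = (infConj ξ x.q₁, infConj ξ x.p₁, infConj ξ x.q₂, infConj ξ x.p₂) := rfl

theorem act_act (g h : Biquat) (x : State) : act g (act h x) = act (g * h) x := by
  simp [act_eq, conj_conj, State.q₁, State.p₁, State.q₂, State.p₂]

theorem act_one (x : State) : act 1 x = x := by
  simp [act_eq, conj_one, State.q₁, State.p₁, State.q₂, State.p₂]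

theorem act_sub (g : Biquat) (x y : State) : act g (x - y) = act g x - act g y := by
  simp [act_eq, conj_sub, State.q₁, State.p₁, State.q₂, State.p₂]

theorem infAct_add_gen (ξ χ : Biquat) (x : State) :
    infAct (ξ + χ) x = infAct ξ x + infAct χ x := by
  simp [infAct_eq, infConj_add_gen, State.q₁, State.p₁, State.q₂, State.p₂]

theorem infAct_sub_gen (ξ χ : Biquat) (x : State) :
    infAct (ξ - χ) x = infAct ξ x - infAct χ x := by
  simp [infAct_eq, infConj_sub_gen, State.q₁, State.p₁, State.q₂, State.p₂]

theorem infAct_commutator (ξ χ : Biquat) (x : State) :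
    infAct χ (infAct ξ x) - infAct ξ (infAct χ x) = infAct (χ * ξ - ξ * χ) x := by
  simp [infAct_eq, infConj_commutator, State.q₁, State.p₁, State.q₂, State.p₂]

theorem infAct_act {g h : Biquat} (hg : h * g = 1) (ξ : Biquat) (x : State) :
    infAct (g * ξ * h) (act g x) = act g (infAct ξ x) := by
  simp [infAct_eq, act_eq, infConj_conj hg, State.q₁, State.p₁, State.q₂, State.p₂]

theorem coshSep_act {g : Biquat} (hg : g.det = 1) (x : State) :
    coshSep (act g x) = coshSep x := by
  simp only [coshSep, act_eq, bil_conj hg]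

theorem hamiltonianField_act (m₁ m₂ : ℝ) {g : Biquat} (hg : g.det = 1) (x : State) :
    hamiltonianField m₁ m₂ (act g x) = act g (hamiltonianField m₁ m₂ x) := by
  simp only [hamiltonianField, coshSep_act hg]
  simp only [act_eq, State.q₁, State.p₁, State.q₂, State.p₂, conj_add, conj_smul, conj_sub,
    det_conj hg]

theorem hamiltonian_act (m₁ m₂ : ℝ) {g : Biquat} (hg : g.det = 1) (x : State) :
    hamiltonian m₁ m₂ (act g x) = hamiltonian m₁ m₂ x := by
  simp only [hamiltonian, coshSep_act hg]
  simp only [act_eq, State.p₁, State.p₂, det_conj hg]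

/-- The factors `g†` cancel between `p` and `q⁻¹`, so `p q⁻¹` transforms by ordinary conjugation and
its determinant is invariant. -/
theorem conj_mul_adjugate_conj {g : Biquat} (hg : g.det = 1) (p q : Biquat) :
    conj g p * (conj g q).adjugate = g * (p * q.adjugate) * g.adjugate := by
  have h : g.conjTranspose * (g.conjTranspose).adjugate = 1 := by
    rw [Matrix.mul_adjugate, Matrix.det_conjTranspose, hg]; simp
  calc conj g p * (conj g q).adjugate
      = g * p * (g.conjTranspose * (g.conjTranspose).adjugate) * q.adjugate * g.adjugate := by
        simp only [conj, Matrix.adjugate_mul_distrib, mul_assoc]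
    _ = _ := by rw [h]; simp only [mul_assoc, one_mul]

theorem casimir_act {g : Biquat} (hg : g.det = 1) (x : State) : casimir (act g x) = casimir x := by
  have : totalMomentum (act g x) = g * totalMomentum x * g.adjugate := by
    simp only [totalMomentum, act_eq, State.q₁, State.p₁, State.q₂, State.p₂,
      conj_mul_adjugate_conj hg, mul_add, add_mul]
  rw [casimir, this, casimir, Matrix.det_mul, Matrix.det_mul, Matrix.det_adjugate, hg]
  simp

theorem energyCasimir_act (m₁ m₂ : ℝ) {g : Biquat} (hg : g.det = 1) (x : State) :
    energyCasimir m₁ m₂ (act g x) = energyCasimir m₁ m₂ x := by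
  simp only [energyCasimir, hamiltonian_act m₁ m₂ hg, casimir_act hg]

/-- The product of the diagonal entries is `1 + |q₁₀|² > 0`, so they have a common sign. -/
theorem trace_pos_of_isHermitian {q : Biquat} (hq : q.IsHermitian) (hd : q.det = 1) :
    0 < q.trace.re ↔ 0 < (q 0 0).re := by
  have h0 := hq.apply 0 0
  have h1 := hq.apply 1 1
  have h2 := hq.apply 0 1
  rw [Matrix.det_fin_two, ← h2] at hd
  have i0 : (q 0 0).im = 0 := Complex.conj_eq_iff_im.mp h0
  have i1 : (q 1 1).im = 0 := Complex.conj_eq_iff_im.mp h1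
  have hd' := congrArg Complex.re hd
  simp [i0, i1] at hd'
  rw [Matrix.trace_fin_two, Complex.add_re]
  constructor <;> intro h <;> by_contra hc <;> push Not at hc <;>
    nlinarith [sq_nonneg (q 1 0).re, sq_nonneg (q 1 0).im]

theorem conj_mem_hyp3 {g : Biquat} (hg : g.det = 1) {q : Biquat} (hq : q ∈ hyp3) :
    conj g q ∈ hyp3 := by
  obtain ⟨hh, hd, ht⟩ := hq
  have hd' : (conj g q).det = 1 := by rw [det_conj hg, hd]
  refine ⟨isHermitian_conj g hh, hd', ?_⟩
  have h0 := (trace_pos_of_isHermitian hh hd).mp ht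
  rw [trace_pos_of_isHermitian (isHermitian_conj g hh) hd']
  have i0 : (q 0 0).im = 0 := Complex.conj_eq_iff_im.mp (hh.apply 0 0)
  have h2 := hh.apply 0 1
  have i1 : (q 1 1).im = 0 := Complex.conj_eq_iff_im.mp (hh.apply 1 1)
  have hdr := congrArg Complex.re hd
  rw [Matrix.det_fin_two, ← h2] at hdr
  simp [i0, i1] at hdr
  have hgd := hg
  rw [Matrix.det_fin_two] at hgd
  -- Completing the square in the Hermitian form of `q` on the first row of `g`, with `det q = 1`.
  -- That row cannot vanish since `det g = 1`, so the sum is positive.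
  have key : (q 0 0).re * ((conj g q) 0 0).re =
      Complex.normSq (q 0 0 * g 0 0 + q 1 0 * g 0 1) + Complex.normSq (g 0 1) := by
    simp only [conj, Matrix.mul_apply, Fin.sum_univ_two, Matrix.conjTranspose_apply, ← h2]
    simp [Complex.normSq_apply, i0, i1]
    linear_combination ((g 0 1).re ^ 2 + (g 0 1).im ^ 2) * hdr
  have pos : 0 < Complex.normSq (q 0 0 * g 0 0 + q 1 0 * g 0 1) + Complex.normSq (g 0 1) := by
    rcases eq_or_ne (g 0 1) 0 with h | h
    · have hg0 : g 0 0 ≠ 0 := by rintro h'; simp [h, h'] at hgd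
      have hq0 : q 0 0 ≠ 0 := by rintro h'; simp [h'] at h0
      rw [h]
      simpa using Complex.normSq_pos.mpr (mul_ne_zero hq0 hg0)
    · have := Complex.normSq_pos.mpr h
      have := Complex.normSq_nonneg (q 0 0 * g 0 0 + q 1 0 * g 0 1)
      linarith
  rw [← key] at pos
  exact pos_of_mul_pos_right pos h0.le

theorem conj_injective {g : Biquat} (hg : g.det = 1) : Function.Injective (conj g) := by
  intro a b h
  have : g.adjugate * g = 1 := by rw [Matrix.adjugate_mul, hg, one_smul]
  rw [← conj_one a, ← conj_one b, ← this, ← conj_conj, ← conj_conj, h]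

theorem act_mem_phaseSpace {g : Biquat} (hg : g.det = 1) {x : State} (hx : x ∈ phaseSpace) :
    act g x ∈ phaseSpace := by
  obtain ⟨h1, h2, h3, h4, h5, h6, h7⟩ := hx
  refine ⟨conj_mem_hyp3 hg h1, isHermitian_conj g h2, ?_, conj_mem_hyp3 hg h4,
    isHermitian_conj g h5, ?_, fun h => h7 (conj_injective hg h)⟩
  · exact (bil_conj hg _ _).trans h3
  · exact (bil_conj hg _ _).trans h6

/-! ### Calculus along curves -/

theorem hasDerivAt_trace {f : ℝ → Biquat} {f' : Biquat} {t : ℝ} (hf : HasDerivAt f f' t) :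
    HasDerivAt (fun s => (f s).trace) f'.trace t :=
  (Matrix.traceLinearMap (Fin 2) ℝ ℂ).toContinuousLinearMap.hasFDerivAt.comp_hasDerivAt t hf

theorem hasDerivAt_bil {f g : ℝ → Biquat} {f' g' : Biquat} {t : ℝ} (hf : HasDerivAt f f' t)
    (hg : HasDerivAt g g' t) :
    HasDerivAt (fun s => bil (f s) (g s)) (bil f' (g t) + bil (f t) g') t := by
  have h := (((hasDerivAt_trace hf).mul (hasDerivAt_trace hg)).sub
    (hasDerivAt_trace (hf.mul hg))).div_const (2 : ℂ)
  refine h.congr_deriv ?_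
  simp only [bil, Matrix.trace_add]
  ring

theorem hasDerivAt_det {f : ℝ → Biquat} {f' : Biquat} {t : ℝ} (hf : HasDerivAt f f' t) :
    HasDerivAt (fun s => (f s).det) (2 * bil (f t) f') t := by
  have h := hasDerivAt_bil hf hf
  simp only [bil_self] at h
  refine h.congr_deriv ?_
  rw [bil_comm f']; ring

theorem hasDerivAt_re {f : ℝ → ℂ} {f' : ℂ} {t : ℝ} (hf : HasDerivAt f f' t) :
    HasDerivAt (fun s => (f s).re) f'.re t :=
  Complex.reCLM.hasFDerivAt.comp_hasDerivAt t hf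

theorem hasDerivAt_conjTranspose {f : ℝ → Biquat} {f' : Biquat} {t : ℝ}
    (hf : HasDerivAt f f' t) :
    HasDerivAt (fun s => (f s).conjTranspose) f'.conjTranspose t :=
  (Matrix.conjTransposeLinearEquiv (Fin 2) (Fin 2) ℝ ℂ).toLinearMap.toContinuousLinearMap.hasFDerivAt.comp_hasDerivAt
    t hf

theorem hasDerivAt_exp_smul (ξ : Biquat) (t : ℝ) :
    HasDerivAt (fun s : ℝ => NormedSpace.exp (s • ξ)) (NormedSpace.exp (t • ξ) * ξ) t :=
  hasDerivAt_exp_smul_const (𝕂 := ℝ) ξ t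

theorem hasDerivAt_fst {E F : Type*} [NormedAddCommGroup E] [NormedSpace ℝ E]
    [NormedAddCommGroup F] [NormedSpace ℝ F] {γ : ℝ → E × F} {v : E × F} {t : ℝ}
    (hγ : HasDerivAt γ v t) : HasDerivAt (fun s => (γ s).1) v.1 t :=
  (ContinuousLinearMap.fst ℝ E F).hasFDerivAt.comp_hasDerivAt t hγ

theorem hasDerivAt_snd {E F : Type*} [NormedAddCommGroup E] [NormedSpace ℝ E]
    [NormedAddCommGroup F] [NormedSpace ℝ F] {γ : ℝ → E × F} {v : E × F} {t : ℝ}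
    (hγ : HasDerivAt γ v t) : HasDerivAt (fun s => (γ s).2) v.2 t :=
  (ContinuousLinearMap.snd ℝ E F).hasFDerivAt.comp_hasDerivAt t hγ

theorem hasDerivAt_q₁ {γ : ℝ → State} {v : State} {t : ℝ} (hγ : HasDerivAt γ v t) :
    HasDerivAt (fun s => (γ s).q₁) v.q₁ t := hasDerivAt_fst hγ

theorem hasDerivAt_p₁ {γ : ℝ → State} {v : State} {t : ℝ} (hγ : HasDerivAt γ v t) :
    HasDerivAt (fun s => (γ s).p₁) v.p₁ t := hasDerivAt_fst (hasDerivAt_snd hγ)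

theorem hasDerivAt_q₂ {γ : ℝ → State} {v : State} {t : ℝ} (hγ : HasDerivAt γ v t) :
    HasDerivAt (fun s => (γ s).q₂) v.q₂ t := hasDerivAt_fst (hasDerivAt_snd (hasDerivAt_snd hγ))

theorem hasDerivAt_p₂ {γ : ℝ → State} {v : State} {t : ℝ} (hγ : HasDerivAt γ v t) :
    HasDerivAt (fun s => (γ s).p₂) v.p₂ t := hasDerivAt_snd (hasDerivAt_snd (hasDerivAt_snd hγ))

theorem hasDerivAt_conj_exp (ξ a : Biquat) (t : ℝ) :
    HasDerivAt (fun s : ℝ => conj (NormedSpace.exp (s • ξ)) a)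
      (conj (NormedSpace.exp (t • ξ)) (infConj ξ a)) t := by
  have h := hasDerivAt_exp_smul ξ t
  refine ((h.mul_const a).mul (hasDerivAt_conjTranspose h)).congr_deriv ?_
  simp only [conj, infConj, Matrix.conjTranspose_mul, mul_add, add_mul, mul_assoc]

theorem hasDerivAt_act_exp (ξ : Biquat) (x : State) (t : ℝ) :
    HasDerivAt (fun s : ℝ => act (NormedSpace.exp (s • ξ)) x)
      (act (NormedSpace.exp (t • ξ)) (infAct ξ x)) t :=
  (hasDerivAt_conj_exp ξ _ t).prodMk <| (hasDerivAt_conj_exp ξ _ t).prodMk <|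
    (hasDerivAt_conj_exp ξ _ t).prodMk (hasDerivAt_conj_exp ξ _ t)

/-- Jacobi's formula: the logarithmic derivative of the determinant along `exp (s ξ)` is the trace
of `ξ`. -/
theorem det_exp_of_trace_eq_zero {ξ : Biquat} (hξ : ξ.trace = 0) :
    (NormedSpace.exp ξ).det = 1 := by
  have h : ∀ t : ℝ, HasDerivAt (fun s : ℝ => (NormedSpace.exp (s • ξ)).det) 0 t := by
    intro t
    refine (hasDerivAt_det (hasDerivAt_exp_smul ξ t)).congr_deriv ?_
    generalize NormedSpace.exp (t • ξ) = g
    rw [Matrix.trace_fin_two] at hξ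
    simp only [bil_eq, Matrix.mul_apply, Fin.sum_univ_two]
    linear_combination (g 0 0 * g 1 1 - g 0 1 * g 1 0) * hξ
  have hc := is_const_of_deriv_eq_zero (fun t => (h t).differentiableAt) (fun t => (h t).deriv) 1 0
  simpa using hc

theorem det_exp_smul {ξ : Biquat} (hξ : ξ.trace = 0) (t : ℝ) :
    (NormedSpace.exp (t • ξ)).det = 1 :=
  det_exp_of_trace_eq_zero (by rw [Matrix.trace_smul, hξ, smul_zero])

/-! ### Tangent vectors as velocities of curves in the phase space. -/

theorem isHermitian_of_hasDerivAt {f : ℝ → Biquat} {f' : Biquat} {t : ℝ}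
    (hf : HasDerivAt f f' t) (h : ∀ᶠ s in 𝓝 t, (f s).IsHermitian) : f'.IsHermitian :=
  HasDerivAt.unique ((hasDerivAt_conjTranspose hf).congr_of_eventuallyEq
    (h.mono fun _ h => h.eq.symm)) hf

theorem bil_eq_zero_of_hasDerivAt {q p : ℝ → Biquat} {q' p' : Biquat} {t : ℝ}
    (hq : HasDerivAt q q' t) (hp : HasDerivAt p p' t) (h : ∀ᶠ s in 𝓝 t, bil (q s) (p s) = 0) :
    bil q' (p t) + bil (q t) p' = 0 :=
  (hasDerivAt_bil hq hp).unique ((hasDerivAt_const t (0 : ℂ)).congr_of_eventuallyEq h)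

theorem bil_eq_zero_of_det_eq_one {q : ℝ → Biquat} {q' : Biquat} {t : ℝ}
    (hq : HasDerivAt q q' t) (h : ∀ᶠ s in 𝓝 t, (q s).det = 1) : bil (q t) q' = 0 := by
  have h1 := (hasDerivAt_det hq).unique ((hasDerivAt_const t (1 : ℂ)).congr_of_eventuallyEq h)
  simpa using h1

theorem mem_phaseSpace_iff {x : State} : x ∈ phaseSpace ↔
    (x.q₁.IsHermitian ∧ x.q₁.det = 1 ∧ 0 < x.q₁.trace.re) ∧ x.p₁.IsHermitian ∧
    bil x.q₁ x.p₁ = 0 ∧ (x.q₂.IsHermitian ∧ x.q₂.det = 1 ∧ 0 < x.q₂.trace.re) ∧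
    x.p₂.IsHermitian ∧ bil x.q₂ x.p₂ = 0 ∧ x.q₁ ≠ x.q₂ := Iff.rfl

theorem mem_phaseTangent_iff {x v : State} : v ∈ phaseTangent x ↔
    v.q₁.IsHermitian ∧ v.p₁.IsHermitian ∧ v.q₂.IsHermitian ∧ v.p₂.IsHermitian ∧
    bil x.q₁ v.q₁ = 0 ∧ bil v.q₁ x.p₁ + bil x.q₁ v.p₁ = 0 ∧
    bil x.q₂ v.q₂ = 0 ∧ bil v.q₂ x.p₂ + bil x.q₂ v.p₂ = 0 := Iff.rfl

/-- Velocities of curves in the phase space are tangent to it. -/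
theorem mem_phaseTangent_of_hasDerivAt {γ : ℝ → State} {v : State} {t : ℝ}
    (hγ : HasDerivAt γ v t) (h : ∀ᶠ s in 𝓝 t, γ s ∈ phaseSpace) : v ∈ phaseTangent (γ t) := by
  have c1 := hasDerivAt_q₁ hγ
  have c2 := hasDerivAt_p₁ hγ
  have c3 := hasDerivAt_q₂ hγ
  have c4 := hasDerivAt_p₂ hγ
  simp only [mem_phaseSpace_iff, Filter.eventually_and] at h
  obtain ⟨⟨h1, h2, -⟩, h3, h4, ⟨h5, h6, -⟩, h7, h8, -⟩ := h
  have a1 := isHermitian_of_hasDerivAt c1 h1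
  have a2 := isHermitian_of_hasDerivAt c2 h3
  have a3 := isHermitian_of_hasDerivAt c3 h5
  have a4 := isHermitian_of_hasDerivAt c4 h7
  have a5 := bil_eq_zero_of_det_eq_one c1 h2
  have a6 := bil_eq_zero_of_hasDerivAt c1 c2 h4
  have a7 := bil_eq_zero_of_det_eq_one c3 h6
  have a8 := bil_eq_zero_of_hasDerivAt c3 c4 h8
  exact mem_phaseTangent_iff.mpr ⟨a1, a2, a3, a4, a5, a6, a7, a8⟩

theorem sub_mem_phaseTangent {x v w : State} (hv : v ∈ phaseTangent x)
    (hw : w ∈ phaseTangent x) : v - w ∈ phaseTangent x := by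
  obtain ⟨a1, a2, a3, a4, a5, a6, a7, a8⟩ := hv
  obtain ⟨b1, b2, b3, b4, b5, b6, b7, b8⟩ := hw
  refine ⟨a1.sub b1, a2.sub b2, a3.sub b3, a4.sub b4, ?_, ?_, ?_, ?_⟩
  · exact (bil_sub_right _ _ _).trans (by rw [a5, b5, sub_zero])
  · refine (congrArg₂ (· + ·) (bil_sub_left _ _ _) (bil_sub_right _ _ _)).trans ?_
    linear_combination a6 - b6
  · exact (bil_sub_right _ _ _).trans (by rw [a7, b7, sub_zero])
  · refine (congrArg₂ (· + ·) (bil_sub_left _ _ _) (bil_sub_right _ _ _)).trans ?_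
    linear_combination a8 - b8

theorem infAct_mem_phaseTangent {ξ : Biquat} (hξ : ξ.trace = 0) {x : State}
    (hx : x ∈ phaseSpace) : infAct ξ x ∈ phaseTangent x := by
  have h := hasDerivAt_act_exp ξ x 0
  simp only [zero_smul, NormedSpace.exp_zero, act_one] at h
  simpa [act_one] using mem_phaseTangent_of_hasDerivAt h
    (Filter.Eventually.of_forall fun s => act_mem_phaseSpace (det_exp_smul hξ s) hx)

/-! ### The force and the Hamiltonian field -/

theorem hasDerivAt_sqrt_sq_sub_one {z : ℝ} (hz : 1 < z) :
    HasDerivAt (fun s : ℝ => √(s ^ 2 - 1)) (z / √(z ^ 2 - 1)) z := by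
  have h : HasDerivAt (fun s : ℝ => s ^ 2 - 1) (2 * z) z := by
    simpa using (hasDerivAt_pow 2 z).sub_const 1
  refine (h.sqrt (by nlinarith)).congr_deriv ?_
  rw [mul_div_mul_left _ _ two_ne_zero]

theorem force_eq (m₁ m₂ : ℝ) {z : ℝ} (hz : 1 < z) :
    force m₁ m₂ z = m₁ * m₂ / √(z ^ 2 - 1) ^ 3 := by
  have h0 : 0 < √(z ^ 2 - 1) := Real.sqrt_pos.mpr (by nlinarith)
  have hs : √(z ^ 2 - 1) ^ 2 = z ^ 2 - 1 := Real.sq_sqrt (by nlinarith)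
  have h : HasDerivAt (potential m₁ m₂) (m₁ * m₂ / √(z ^ 2 - 1) ^ 3) z := by
    refine (((hasDerivAt_id z).div (hasDerivAt_sqrt_sq_sub_one hz) h0.ne').const_mul
      (-(m₁ * m₂))).congr_deriv ?_
    simp only [id]
    field_simp
    linear_combination (-m₁ * m₂) * hs
  exact h.deriv

theorem differentiableAt_force (m₁ m₂ : ℝ) {z : ℝ} (hz : 1 < z) :
    DifferentiableAt ℝ (force m₁ m₂) z := by
  have h0 : √(z ^ 2 - 1) ≠ 0 := (Real.sqrt_pos.mpr (by nlinarith)).ne'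
  -- `force` is defined as a derivative, so it is replaced near `z` by its closed form before being
  -- differentiated again.
  have h : (force m₁ m₂) =ᶠ[𝓝 z] fun s => m₁ * m₂ / √(s ^ 2 - 1) ^ 3 :=
    (lt_mem_nhds hz).mono fun s hs => force_eq m₁ m₂ hs
  refine DifferentiableAt.congr_of_eventuallyEq ?_ h
  exact (differentiableAt_const _).div ((hasDerivAt_sqrt_sq_sub_one hz).differentiableAt.pow 3)
    (pow_ne_zero 3 h0)

/-- Force on `q` due to `q'` and centripetal term, differentiated along `(dq, dp, dq')`. -/
def momentumFieldDeriv (m f f' : ℝ) (z dz : ℝ) (q p q' dq dp dq' : Biquat) : Biquat :=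
  -(f' * dz) • (q' - z • q) - f • (dq' - dz • q - z • dq) +
    ((2 * (bil p dp).re) / m) • q + (p.det.re / m) • dq

/-- Derivative of `coshSep` at `x` along `v`. -/
def coshSepDeriv (x v : State) : ℝ := (bil v.q₁ x.q₂ + bil x.q₁ v.q₂).re

theorem hasDerivAt_coshSep {γ : ℝ → State} {v : State} {t : ℝ} (hγ : HasDerivAt γ v t) :
    HasDerivAt (fun s => coshSep (γ s)) (coshSepDeriv (γ t) v) t :=
  hasDerivAt_re (hasDerivAt_bil (hasDerivAt_q₁ hγ) (hasDerivAt_q₂ hγ))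

/-- Derivative of the Hamiltonian field at `x` along `v`. -/
def hamiltonianFieldDeriv (m₁ m₂ : ℝ) (x v : State) : State :=
  (-(1 / m₁) • v.p₁,
   momentumFieldDeriv m₁ (force m₁ m₂ (coshSep x)) (deriv (force m₁ m₂) (coshSep x)) (coshSep x)
     (coshSepDeriv x v) x.q₁ x.p₁ x.q₂ v.q₁ v.p₁ v.q₂,
   -(1 / m₂) • v.p₂,
   momentumFieldDeriv m₂ (force m₁ m₂ (coshSep x)) (deriv (force m₁ m₂) (coshSep x)) (coshSep x)
     (coshSepDeriv x v) x.q₂ x.p₂ x.q₁ v.q₂ v.p₂ v.q₁)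

theorem hasDerivAt_momentumField {m f' z' t : ℝ} {f z : ℝ → ℝ} {q p r : ℝ → Biquat}
    {q' p' r' : Biquat} (hz : HasDerivAt z z' t) (hf : HasDerivAt f (f' * z') t)
    (hq : HasDerivAt q q' t) (hp : HasDerivAt p p' t) (hr : HasDerivAt r r' t) :
    HasDerivAt (fun s => -(f s) • (r s - z s • q s) + ((p s).det.re / m) • q s)
      (momentumFieldDeriv m (f t) f' (z t) z' (q t) (p t) (r t) q' p' r') t := by
  have h := (hf.neg.smul (hr.sub (hz.smul hq))).add
    (((hasDerivAt_re (hasDerivAt_det hp)).div_const m).smul hq)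
  refine h.congr_deriv ?_
  simp only [momentumFieldDeriv, Complex.mul_re, Complex.re_ofNat, Complex.im_ofNat, zero_mul,
    sub_zero, Pi.sub_apply, Pi.neg_apply, Pi.smul_apply']
  module

theorem hasDerivAt_hamiltonianField (m₁ m₂ : ℝ) {γ : ℝ → State} {v : State} {t : ℝ}
    (hγ : HasDerivAt γ v t) (hz : 1 < coshSep (γ t)) :
    HasDerivAt (fun s => hamiltonianField m₁ m₂ (γ s)) (hamiltonianFieldDeriv m₁ m₂ (γ t) v) t := by
  have hc := hasDerivAt_coshSep hγ
  have hf : HasDerivAt (fun s => force m₁ m₂ (coshSep (γ s)))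
      (deriv (force m₁ m₂) (coshSep (γ t)) * coshSepDeriv (γ t) v) t :=
    (differentiableAt_force m₁ m₂ hz).hasDerivAt.comp t hc
  exact ((hasDerivAt_p₁ hγ).const_smul (-(1 / m₁))).prodMk <|
    (hasDerivAt_momentumField hc hf (hasDerivAt_q₁ hγ) (hasDerivAt_p₁ hγ) (hasDerivAt_q₂ hγ)).prodMk <|
    ((hasDerivAt_p₂ hγ).const_smul (-(1 / m₂))).prodMk
    (hasDerivAt_momentumField hc hf (hasDerivAt_q₂ hγ) (hasDerivAt_p₂ hγ) (hasDerivAt_q₁ hγ))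

theorem differentiable_bil {E : Type*} [NormedAddCommGroup E] [NormedSpace ℝ E]
    {f g : E → Biquat} (hf : Differentiable ℝ f) (hg : Differentiable ℝ g) :
    Differentiable ℝ fun y => bil (f y) (g y) := by
  have htr : Differentiable ℝ (fun a : Biquat => a.trace) :=
    (Matrix.traceLinearMap (Fin 2) ℝ ℂ).toContinuousLinearMap.differentiable
  have t1 : Differentiable ℝ (fun y => (f y).trace) := htr.comp hf
  have t2 : Differentiable ℝ (fun y => (g y).trace) := htr.comp hg
  have t3 : Differentiable ℝ (fun y => (f y * g y).trace) := htr.comp (hf.mul hg)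
  simp only [bil, div_eq_mul_inv]
  fun_prop

theorem differentiable_det {E : Type*} [NormedAddCommGroup E] [NormedSpace ℝ E]
    {f : E → Biquat} (hf : Differentiable ℝ f) : Differentiable ℝ fun y => (f y).det := by
  simpa only [bil_self] using differentiable_bil hf hf

theorem differentiableAt_hamiltonianField (m₁ m₂ : ℝ) {x : State} (hz : 1 < coshSep x) :
    DifferentiableAt ℝ (hamiltonianField m₁ m₂) x := by
  have d1 : DifferentiableAt ℝ (fun y : State => y.p₁.det.re) x :=
    (Complex.reCLM.differentiable.comp (differentiable_det (by fun_prop))) x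
  have d2 : DifferentiableAt ℝ (fun y : State => y.p₂.det.re) x :=
    (Complex.reCLM.differentiable.comp (differentiable_det (by fun_prop))) x
  have d3 : DifferentiableAt ℝ coshSep x :=
    (Complex.reCLM.differentiable.comp (differentiable_bil (by fun_prop) (by fun_prop))) x
  have d4 : DifferentiableAt ℝ (fun y => force m₁ m₂ (coshSep y)) x :=
    (differentiableAt_force m₁ m₂ hz).comp x d3
  unfold hamiltonianField
  simp only [div_eq_mul_inv]
  fun_prop

theorem infConj_differentiable (ξ : Biquat) : Differentiable ℝ (infConj ξ) := by
  unfold infConj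
  exact ((differentiable_const _).mul differentiable_id).add
    (differentiable_id.mul (differentiable_const _))

theorem differentiable_infAct (ξ : Biquat) : Differentiable ℝ (infAct ξ) := by
  have h := infConj_differentiable ξ
  exact (h.comp differentiable_fst).prodMk <| (h.comp (by fun_prop)).prodMk <|
    (h.comp (by fun_prop)).prodMk (h.comp (by fun_prop))

theorem hasDerivAt_infConj {χ f : ℝ → Biquat} {χ' f' : Biquat} {t : ℝ}
    (hχ : HasDerivAt χ χ' t) (hf : HasDerivAt f f' t) :
    HasDerivAt (fun s => infConj (χ s) (f s)) (infConj χ' (f t) + infConj (χ t) f') t := by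
  refine ((hχ.mul hf).add (hf.mul (hasDerivAt_conjTranspose hχ))).congr_deriv ?_
  simp only [infConj]
  abel

theorem hasDerivAt_infAct {χ : ℝ → Biquat} {γ : ℝ → State} {χ' : Biquat} {v : State} {t : ℝ}
    (hχ : HasDerivAt χ χ' t) (hγ : HasDerivAt γ v t) :
    HasDerivAt (fun s => infAct (χ s) (γ s)) (infAct χ' (γ t) + infAct (χ t) v) t :=
  (hasDerivAt_infConj hχ (hasDerivAt_q₁ hγ)).prodMk <| (hasDerivAt_infConj hχ (hasDerivAt_p₁ hγ)).prodMk <|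
    (hasDerivAt_infConj hχ (hasDerivAt_q₂ hγ)).prodMk (hasDerivAt_infConj hχ (hasDerivAt_p₂ hγ))

theorem linearisation_apply (m₁ m₂ : ℝ) {x : State} (hz : 1 < coshSep x) (ξ : Biquat) (v : State) :
    linearisation m₁ m₂ x ξ v = hamiltonianFieldDeriv m₁ m₂ x v - infAct ξ v := by
  have hd : DifferentiableAt ℝ (fun y => hamiltonianField m₁ m₂ y - infAct ξ y) x :=
    (differentiableAt_hamiltonianField m₁ m₂ hz).sub (differentiable_infAct ξ x)
  have hl : HasDerivAt (fun t : ℝ => x + t • v) v 0 := by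
    have h := ((hasDerivAt_id (0 : ℝ)).smul_const v).const_add x
    rwa [one_smul] at h
  have h1 : HasDerivAt (fun t : ℝ => hamiltonianField m₁ m₂ (x + t • v) - infAct ξ (x + t • v))
      (linearisation m₁ m₂ x ξ v) 0 := hd.hasFDerivAt.hasLineDerivAt v
  have h2 := (hasDerivAt_hamiltonianField m₁ m₂ hl (by simpa using hz)).sub
    (hasDerivAt_infAct (hasDerivAt_const (0 : ℝ) ξ) hl)
  have h3 := h1.unique h2
  simpa [infAct, State.q₁, State.p₁, State.q₂, State.p₂] using h3

theorem differentiable_casimir : Differentiable ℝ casimir := by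
  have hadj : Differentiable ℝ (fun a : Biquat => a.adjugate) := by
    let l : Biquat →ₗ[ℝ] Biquat :=
      { toFun := fun a => a.adjugate
        map_add' := fun a b => by
          simp only [Matrix.adjugate_fin_two]
          ext i j; fin_cases i <;> fin_cases j <;> simp [add_comm]
        map_smul' := fun c a => by
          simp only [Matrix.adjugate_fin_two]
          ext i j; fin_cases i <;> fin_cases j <;> simp }
    exact l.toContinuousLinearMap.differentiable
  exact differentiable_det (((show Differentiable ℝ fun x : State => x.p₁ by fun_prop).mul
    (hadj.comp (by fun_prop))).add ((show Differentiable ℝ fun x : State => x.p₂ by fun_prop).mul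
    (hadj.comp (by fun_prop))))

/-! ### Relative equilibria -/

/-- By equivariance of the field, the equation of motion at time `t` is the one at time `0` moved by
`exp (t ξ)`. -/
theorem isRelEquilibrium_iff (m₁ m₂ : ℝ) (x : State) (ξ : Biquat) :
    IsRelEquilibrium m₁ m₂ x ξ ↔
      x ∈ phaseSpace ∧ ξ.trace = 0 ∧ hamiltonianField m₁ m₂ x = infAct ξ x := by
  refine and_congr_right fun _ => and_congr_right fun hξ => ⟨fun h => ?_, fun h t => ?_⟩
  · have h0 := (h 0).unique (hasDerivAt_act_exp ξ x 0)
    simpa [act_one] using h0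
  · rw [hamiltonianField_act m₁ m₂ (det_exp_smul hξ t), h]
    exact hasDerivAt_act_exp ξ x t

/-- The infinitesimal form of equivariance at a relative equilibrium. -/
theorem linearisation_infAct (m₁ m₂ : ℝ) {x : State} (hz : 1 < coshSep x) {ξ χ : Biquat}
    (hx : hamiltonianField m₁ m₂ x = infAct ξ x) (hχ : χ.trace = 0) :
    linearisation m₁ m₂ x ξ (infAct χ x) = infAct (χ * ξ - ξ * χ) x := by
  have h := hasDerivAt_act_exp χ x 0
  simp only [zero_smul, NormedSpace.exp_zero, act_one] at h
  have h1 := hasDerivAt_hamiltonianField m₁ m₂ h (by simpa [act_one] using hz)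
  simp only [fun s => hamiltonianField_act m₁ m₂ (det_exp_smul hχ s), zero_smul,
    NormedSpace.exp_zero, act_one, hx] at h1
  have h2 := hasDerivAt_act_exp χ (infAct ξ x) 0
  simp only [zero_smul, NormedSpace.exp_zero, act_one] at h2
  rw [linearisation_apply m₁ m₂ hz, h1.unique h2, infAct_commutator]

/-- The separation is constant on orbits. A vector that changes it is therefore not tangent to the
orbit, which is how null vectors are recognised as genuine. -/
theorem coshSepDeriv_infAct {χ : Biquat} (hχ : χ.trace = 0) (x : State) :
    coshSepDeriv x (infAct χ x) = 0 := by
  have h := hasDerivAt_act_exp χ x 0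
  simp only [zero_smul, NormedSpace.exp_zero, act_one] at h
  have h1 := hasDerivAt_coshSep h
  simp only [fun s => coshSep_act (det_exp_smul hχ s), zero_smul, NormedSpace.exp_zero,
    act_one] at h1
  exact h1.unique (hasDerivAt_const _ _)

theorem fderiv_casimir_infAct {χ : Biquat} (hχ : χ.trace = 0) (x : State) :
    fderiv ℝ casimir x (infAct χ x) = 0 := by
  have h := hasDerivAt_act_exp χ x 0
  simp only [zero_smul, NormedSpace.exp_zero, act_one] at h
  have h1 := (differentiable_casimir _).hasFDerivAt.comp_hasDerivAt (0 : ℝ) h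
  simp only [Function.comp_def, fun s => casimir_act (det_exp_smul hχ s), zero_smul,
    NormedSpace.exp_zero, act_one] at h1
  exact h1.unique (hasDerivAt_const _ _)

/-! ### Semicubical cusps of curves -/

/-- Third order Taylor expansion with Peano remainder. -/
theorem taylor_three_isLittleO {E : Type*} [NormedAddCommGroup E] [NormedSpace ℝ E]
    {f f₁ f₂ : ℝ → E} {f₃ : E} (h₁ : ∀ᶠ t in 𝓝 0, HasDerivAt f (f₁ t) t)
    (h₂ : ∀ᶠ t in 𝓝 0, HasDerivAt f₁ (f₂ t) t) (h₃ : HasDerivAt f₂ f₃ 0) :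
    (fun t : ℝ => f t - f 0 - t • f₁ 0 - (t ^ 2 / 2) • f₂ 0 - (t ^ 3 / 6) • f₃)
      =o[𝓝 0] (fun t : ℝ => t ^ 3) := by
  -- Integrating a bound `o(tⁿ)` on the derivative of a function vanishing at `0` gains one order;
  -- the expansion follows by applying this twice.
  have step : ∀ (g g' : ℝ → E) (n : ℕ), (∀ᶠ t in 𝓝 0, HasDerivAt g (g' t) t) → g 0 = 0 →
      g' =o[𝓝 0] (fun t : ℝ => t ^ n) → g =o[𝓝 0] (fun t : ℝ => t ^ (n + 1)) := by
    intro g g' n hg hg0 ho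
    obtain ⟨ε, hε, hb⟩ := Metric.eventually_nhds_iff_ball.mp hg
    have hw : 𝓝[Metric.ball (0 : ℝ) ε] 0 = 𝓝 0 :=
      (Metric.isOpen_ball).nhdsWithin_eq (Metric.mem_ball_self hε)
    have := Convex.isLittleO_pow_succ_real (x₀ := (0 : ℝ)) (f := g) (f' := g') (n := n)
      (convex_ball (0 : ℝ) ε) (Metric.mem_ball_self hε)
      (fun x hx => (hb x hx).hasDerivWithinAt) (by simpa [hw] using ho)
    simpa [hw, hg0] using this
  have s3 : (fun t : ℝ => f₂ t - f₂ 0 - t • f₃) =o[𝓝 0] (fun t : ℝ => t ^ 1) := by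
    have := hasDerivAt_iff_isLittleO.mp h₃
    simpa using this
  have s2 : (fun t : ℝ => f₁ t - f₁ 0 - t • f₂ 0 - (t ^ 2 / 2) • f₃)
      =o[𝓝 0] (fun t : ℝ => t ^ 2) := by
    refine step _ _ 1 (h₂.mono fun t ht => ?_) (by simp) s3
    refine (((ht.sub_const (f₁ 0)).sub ((hasDerivAt_id t).smul_const (f₂ 0))).sub
      (((hasDerivAt_pow 2 t).div_const 2).smul_const f₃)).congr_deriv ?_
    norm_num
  refine step _ _ 2 (h₁.mono fun t ht => ?_) (by simp) s2
  refine ((((ht.sub_const (f 0)).sub ((hasDerivAt_id t).smul_const (f₁ 0))).sub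
    (((hasDerivAt_pow 2 t).div_const 2).smul_const (f₂ 0))).sub
    (((hasDerivAt_pow 3 t).div_const 6).smul_const f₃)).congr_deriv ?_
  norm_num
  module

theorem contDiffAt_deriv {E : Type*} [NormedAddCommGroup E] [NormedSpace ℝ E] {f : ℝ → E}
    {t : ℝ} {m n : WithTop ℕ∞} (hf : ContDiffAt ℝ n f t) (hmn : m + 1 ≤ n) :
    ContDiffAt ℝ m (deriv f) t :=
  (hf.fderiv_right hmn).clm_apply contDiffAt_const

theorem eventually_hasDerivAt {E : Type*} [NormedAddCommGroup E] [NormedSpace ℝ E] {f : ℝ → E}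
    {t : ℝ} (hf : ContDiffAt ℝ 1 f t) : ∀ᶠ s in 𝓝 t, HasDerivAt f (deriv f s) s :=
  (hf.eventually (by simp)).mono fun _ hs => (hs.differentiableAt (by simp)).hasDerivAt

/-- A singular point of a curve in `ℝ × ℂ` tangent to the kernel of `dx - Re (ν dz)` is a
semicubical cusp, provided the form `ν` moves transversally. -/
theorem exists_cusp_of_tangent {f : ℝ → ℝ × ℂ} {ν : ℝ → ℂ} (hf : ContDiffAt ℝ 3 f 0)
    (hν : ContDiffAt ℝ 2 ν 0) (hfν : ∀ᶠ t in 𝓝 0, (deriv f t).1 = (ν t * (deriv f t).2).re)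
    (h0 : deriv f 0 = 0) (htr : (deriv ν 0 * (deriv (deriv f) 0).2).re ≠ 0) :
    ∃ A B : ℝ × ℂ, LinearIndependent ℝ ![A, B] ∧
      (fun t : ℝ => f t - f 0 - t ^ 2 • A - t ^ 3 • B) =o[𝓝 0] (fun t : ℝ => t ^ 3) := by
  have c1 : ContDiffAt ℝ 2 (deriv f) 0 := contDiffAt_deriv hf (by norm_num)
  have c2 : ContDiffAt ℝ 1 (deriv (deriv f)) 0 := contDiffAt_deriv c1 (by norm_num)
  have n1 : ContDiffAt ℝ 1 (deriv ν) 0 := contDiffAt_deriv hν (by norm_num)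
  have e0 := eventually_hasDerivAt (hf.of_le (by norm_num))
  have e1 := eventually_hasDerivAt (c1.of_le (by norm_num))
  have e2 := (c2.differentiableAt (by simp)).hasDerivAt
  have en := eventually_hasDerivAt (hν.of_le (by norm_num))
  have en1 := (n1.differentiableAt (by simp)).hasDerivAt
  have r2 : ∀ᶠ t in 𝓝 0, (deriv (deriv f) t).1 =
      (deriv ν t * (deriv f t).2 + ν t * (deriv (deriv f) t).2).re := by
    filter_upwards [e1, en, hfν.eventually_nhds] with t h1 hn he
    exact (hasDerivAt_fst h1).unique
      ((hasDerivAt_re (hn.mul (hasDerivAt_snd h1))).congr_of_eventuallyEq he)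
  -- Since `f'(0) = 0`, differentiating the tangency relation twice leaves `Re(2 ν' f₂'' + ν f₂''')`
  -- in the first component of the third derivative.
  have r3 := (hasDerivAt_fst e2).unique ((hasDerivAt_re ((en1.mul (hasDerivAt_snd
    e1.self_of_nhds)).add (en.self_of_nhds.mul (hasDerivAt_snd e2)))).congr_of_eventuallyEq r2)
  have r20 := r2.self_of_nhds
  simp only [h0, Prod.snd_zero, mul_zero, zero_add] at r3 r20
  refine ⟨(1 / 2 : ℝ) • deriv (deriv f) 0, (1 / 6 : ℝ) • deriv (deriv (deriv f)) 0, ?_, ?_⟩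
  · rw [LinearIndependent.pair_iff]
    intro s t hst
    have s1 := congrArg Prod.fst hst
    have s2 := congrArg Prod.snd hst
    have s2r := congrArg Complex.re s2
    have s2i := congrArg Complex.im s2
    simp [r3, r20] at s1 s2r s2i
    simp only [Complex.mul_re] at htr
    -- The functional `dx - Re(ν dz)` kills `A` and takes the value `Re(ν' f₂'')/3` on `B`.
    have ht : t = 0 := by
      have : t * ((deriv ν 0).re * (deriv (deriv f) 0).2.re -
          (deriv ν 0).im * (deriv (deriv f) 0).2.im) = 0 := by
        linear_combination 3 * s1 - 3 * (ν 0).re * s2r + 3 * (ν 0).im * s2i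
      exact (mul_eq_zero.mp this).resolve_right htr
    refine ⟨?_, ht⟩
    simp only [ht, zero_mul, add_zero, mul_eq_zero, inv_eq_zero, OfNat.ofNat_ne_zero,
      false_or] at s2r s2i
    by_contra hs
    rw [s2r.resolve_left hs, s2i.resolve_left hs] at htr
    simp at htr
  · have h := taylor_three_isLittleO e0 e1 e2
    rw [h0] at h
    refine h.congr_left fun t => ?_
    rw [smul_zero, sub_zero, smul_smul, smul_smul]
    ring_nf

/-! ### The energy-Casimir parametrisation -/

/-- `√(m₁² + m₂² + 2 m₁ m₂ cosh 2ψ)`, the hyperbolic sum of the masses; `Z = e^ψ N`. -/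
def massSum (m₁ m₂ ψ : ℝ) : ℝ := √(m₁ ^ 2 + m₂ ^ 2 + 2 * m₁ * m₂ * Real.cosh (2 * ψ))

/-- The squared modulus of the eigenvalue of the generator at separation `ψ`. -/
def sqSpeed (m₁ m₂ ψ : ℝ) : ℝ := massSum m₁ m₂ ψ / (4 * Real.cosh ψ * Real.sinh ψ ^ 3)

/-- `(m₁ + m₂) e^{iθ} + N e^{-iθ}`. -/
def momentum (m₁ m₂ θ ψ : ℝ) : ℂ :=
  ⟨(m₁ + m₂ + massSum m₁ m₂ ψ) * Real.cos θ, (m₁ + m₂ - massSum m₁ m₂ ψ) * Real.sin θ⟩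

/-- The energy-Casimir map as a function of the phase and the separation. -/
def diagram (m₁ m₂ : ℝ) (a : ℝ × ℝ) : ℝ × ℂ :=
  (sqSpeed m₁ m₂ a.2 * (massSum m₁ m₂ a.2 + (m₁ + m₂) * Real.cos (2 * a.1)) -
      m₁ * m₂ * (Real.cosh a.2 / Real.sinh a.2),
    -(sqSpeed m₁ m₂ a.2 * momentum m₁ m₂ a.1 a.2 ^ 2))

/-- Logarithmic derivative of `sqSpeed * (massSum ^ 2 - (m₁ + m₂) ^ 2)`. -/
def logSum (m₁ m₂ ψ : ℝ) : ℝ :=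
  4 * m₁ * m₂ * (Real.sinh ψ * Real.cosh ψ) / massSum m₁ m₂ ψ ^ 2 -
    Real.cosh ψ / Real.sinh ψ - Real.sinh ψ / Real.cosh ψ

/-- Logarithmic derivative of `(massSum - (m₁ + m₂)) / (massSum + (m₁ + m₂))`. -/
def logDiff (m₁ m₂ ψ : ℝ) : ℝ :=
  2 * (m₁ + m₂) * (Real.cosh ψ / Real.sinh ψ) / massSum m₁ m₂ ψ

/-- The logarithmic derivative of `√sqSpeed * momentum` in the direction `(a, b)`. -/
def velocity (m₁ m₂ θ ψ a b : ℝ) : ℂ :=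
  ⟨(m₁ + m₂ + massSum m₁ m₂ ψ) *
      (b * ((logSum m₁ m₂ ψ - logDiff m₁ m₂ ψ) / 2) * Real.cos θ - a * Real.sin θ),
    (m₁ + m₂ - massSum m₁ m₂ ψ) *
      (b * ((logSum m₁ m₂ ψ + logDiff m₁ m₂ ψ) / 2) * Real.sin θ + a * Real.cos θ)⟩

/-- The derivative of `diagram` in the direction `(a, b)`. -/
def diagramDeriv (m₁ m₂ θ ψ a b : ℝ) : ℝ × ℂ :=
  (2 * sqSpeed m₁ m₂ ψ * (Real.cos θ * (velocity m₁ m₂ θ ψ a b).re -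
      Real.sin θ * (velocity m₁ m₂ θ ψ a b).im),
    -(2 * sqSpeed m₁ m₂ ψ * momentum m₁ m₂ θ ψ * velocity m₁ m₂ θ ψ a b))

variable {m₁ m₂ : ℝ}

/-- This form exhibits `N > m₁ + m₂` for `ψ > 0`, so neither of the factors `m₁ + m₂ ± N` vanishes.
-/
theorem sq_massSum (hm₁ : 0 < m₁) (hm₂ : 0 < m₂) (ψ : ℝ) :
    massSum m₁ m₂ ψ ^ 2 = (m₁ + m₂) ^ 2 + 4 * m₁ * m₂ * Real.sinh ψ ^ 2 := by
  have h := Real.cosh_pos (2 * ψ)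
  have hk := mul_pos hm₁ hm₂
  rw [massSum, Real.sq_sqrt (by nlinarith [sq_nonneg m₁, sq_nonneg m₂, mul_pos hk h]),
    Real.cosh_two_mul, Real.cosh_sq]
  ring

theorem massSum_pos (hm₁ : 0 < m₁) (hm₂ : 0 < m₂) (ψ : ℝ) : 0 < massSum m₁ m₂ ψ := by
  have h := Real.cosh_pos (2 * ψ)
  have hk := mul_pos hm₁ hm₂
  exact Real.sqrt_pos.mpr (by nlinarith [sq_nonneg m₁, sq_nonneg m₂, mul_pos hk h])

theorem lt_massSum (hm₁ : 0 < m₁) (hm₂ : 0 < m₂) {ψ : ℝ} (hψ : 0 < ψ) :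
    m₁ + m₂ < massSum m₁ m₂ ψ := by
  refine lt_of_pow_lt_pow_left₀ 2 (massSum_pos hm₁ hm₂ ψ).le ?_
  rw [sq_massSum hm₁ hm₂]
  have := Real.sinh_pos_iff.mpr hψ
  have hk := mul_pos hm₁ hm₂
  nlinarith [mul_pos hk (pow_pos this 2)]

theorem sqSpeed_pos (hm₁ : 0 < m₁) (hm₂ : 0 < m₂) {ψ : ℝ} (hψ : 0 < ψ) :
    0 < sqSpeed m₁ m₂ ψ := by
  have h1 := massSum_pos hm₁ hm₂ ψ
  have h2 := Real.sinh_pos_iff.mpr hψ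
  have h3 := Real.cosh_pos ψ
  unfold sqSpeed
  positivity

theorem logDiff_pos (hm₁ : 0 < m₁) (hm₂ : 0 < m₂) {ψ : ℝ} (hψ : 0 < ψ) :
    0 < logDiff m₁ m₂ ψ := by
  have h1 := massSum_pos hm₁ hm₂ ψ
  have h2 := Real.sinh_pos_iff.mpr hψ
  have h3 := Real.cosh_pos ψ
  unfold logDiff
  positivity

theorem momentum_ne_zero (hm₁ : 0 < m₁) (hm₂ : 0 < m₂) (θ : ℝ) {ψ : ℝ} (hψ : 0 < ψ) :
    momentum m₁ m₂ θ ψ ≠ 0 := by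
  intro h
  have h1 := congrArg Complex.re h
  have h2 := congrArg Complex.im h
  have hN := lt_massSum hm₁ hm₂ hψ
  simp only [momentum, Complex.zero_re, Complex.zero_im, mul_eq_zero] at h1 h2
  have c := h1.resolve_left (by linarith)
  have s := h2.resolve_left (by linarith)
  have := Real.sin_sq_add_cos_sq θ
  simp [c, s] at this

/-! #### Derivatives -/

theorem hasDerivAt_massSum (hm₁ : 0 < m₁) (hm₂ : 0 < m₂) (ψ : ℝ) :
    HasDerivAt (massSum m₁ m₂)
      (4 * m₁ * m₂ * (Real.sinh ψ * Real.cosh ψ) / massSum m₁ m₂ ψ) ψ := by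
  have hN := massSum_pos hm₁ hm₂ ψ
  have h : HasDerivAt (fun s => m₁ ^ 2 + m₂ ^ 2 + 2 * m₁ * m₂ * Real.cosh (2 * s))
      (2 * m₁ * m₂ * (Real.sinh (2 * ψ) * 2)) ψ := by
    have h1 : HasDerivAt (fun s : ℝ => 2 * s) 2 ψ := by
      simpa using (hasDerivAt_id ψ).const_mul (2 : ℝ)
    exact (h1.cosh.const_mul _).const_add _
  refine (h.sqrt (Real.sqrt_pos.mp hN).ne').congr_deriv ?_
  change _ / (2 * massSum m₁ m₂ ψ) = _
  rw [Real.sinh_two_mul]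
  field_simp
  ring

theorem hasDerivAt_coth {ψ : ℝ} (hψ : 0 < ψ) :
    HasDerivAt (fun s => Real.cosh s / Real.sinh s) (-(1 / Real.sinh ψ ^ 2)) ψ := by
  have h2 := Real.sinh_pos_iff.mpr hψ
  refine ((Real.hasDerivAt_cosh ψ).div (Real.hasDerivAt_sinh ψ) h2.ne').congr_deriv ?_
  have := Real.cosh_sq ψ
  field_simp
  linear_combination -this

theorem hasDerivAt_sinh_div_cosh (ψ : ℝ) :
    HasDerivAt (fun s => Real.sinh s / Real.cosh s) (1 / Real.cosh ψ ^ 2) ψ := by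
  have h2 := Real.cosh_pos ψ
  refine ((Real.hasDerivAt_sinh ψ).div (Real.hasDerivAt_cosh ψ) h2.ne').congr_deriv ?_
  have := Real.cosh_sq ψ
  field_simp
  linear_combination this

theorem hasDerivAt_sqSpeed (hm₁ : 0 < m₁) (hm₂ : 0 < m₂) {ψ : ℝ} (hψ : 0 < ψ) :
    HasDerivAt (sqSpeed m₁ m₂)
      (sqSpeed m₁ m₂ ψ * (4 * m₁ * m₂ * (Real.sinh ψ * Real.cosh ψ) / massSum m₁ m₂ ψ ^ 2 -
        Real.sinh ψ / Real.cosh ψ - 3 * (Real.cosh ψ / Real.sinh ψ))) ψ := by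
  have hN := massSum_pos hm₁ hm₂ ψ
  have h2 := Real.sinh_pos_iff.mpr hψ
  have h3 := Real.cosh_pos ψ
  have h := (hasDerivAt_massSum hm₁ hm₂ ψ).div
    (((Real.hasDerivAt_cosh ψ).const_mul 4).mul ((Real.hasDerivAt_sinh ψ).pow 3))
    (show (4 * Real.cosh ψ) * Real.sinh ψ ^ 3 ≠ 0 by positivity)
  refine h.congr_deriv ?_
  simp only [sqSpeed, Pi.mul_apply, Pi.pow_apply]
  field_simp
  ring

/-- The derivative of `√sqSpeed * (massSum + ε (m₁ + m₂))` for `ε = ± 1`. -/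
theorem logDeriv_identity (hm₁ : 0 < m₁) (hm₂ : 0 < m₂) {ψ ε : ℝ} (hψ : 0 < ψ)
    (hε : ε ^ 2 = 1) :
    (4 * m₁ * m₂ * (Real.sinh ψ * Real.cosh ψ) / massSum m₁ m₂ ψ ^ 2 -
        Real.sinh ψ / Real.cosh ψ - 3 * (Real.cosh ψ / Real.sinh ψ)) *
          (massSum m₁ m₂ ψ + ε * (m₁ + m₂)) +
      2 * (4 * m₁ * m₂ * (Real.sinh ψ * Real.cosh ψ) / massSum m₁ m₂ ψ) =
    (logSum m₁ m₂ ψ - ε * logDiff m₁ m₂ ψ) * (massSum m₁ m₂ ψ + ε * (m₁ + m₂)) := by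
  have hN := massSum_pos hm₁ hm₂ ψ
  have h2 := Real.sinh_pos_iff.mpr hψ
  have h3 := Real.cosh_pos ψ
  have hN2 := sq_massSum hm₁ hm₂ ψ
  unfold logSum logDiff
  field_simp
  linear_combination (-2 * massSum m₁ m₂ ψ * Real.cosh ψ ^ 2) * hN2 +
    (2 * massSum m₁ m₂ ψ * Real.cosh ψ ^ 2 * (m₁ + m₂) ^ 2) * hε

/-- The right-hand side is the derivative of the potential in `ψ`, so the potential enters the
derivative of the energy as a second copy of `R N'`. -/
theorem sqSpeed_mul_deriv_massSum (hm₁ : 0 < m₁) (hm₂ : 0 < m₂) {ψ : ℝ} (hψ : 0 < ψ) :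
    sqSpeed m₁ m₂ ψ * (4 * m₁ * m₂ * (Real.sinh ψ * Real.cosh ψ) / massSum m₁ m₂ ψ) =
      m₁ * m₂ / Real.sinh ψ ^ 2 := by
  have hN := massSum_pos hm₁ hm₂ ψ
  have h2 := Real.sinh_pos_iff.mpr hψ
  have h3 := Real.cosh_pos ψ
  unfold sqSpeed
  field_simp

theorem hasDerivAt_complex_mk {f g : ℝ → ℝ} {f' g' t : ℝ} (hf : HasDerivAt f f' t)
    (hg : HasDerivAt g g' t) : HasDerivAt (fun s => (⟨f s, g s⟩ : ℂ)) ⟨f', g'⟩ t := by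
  have h := hf.ofReal_comp.add (hg.ofReal_comp.mul_const Complex.I)
  simp only [Complex.mk_eq_add_mul_I]
  exact h

/-- The derivative of `momentum` in the direction `(a, b)`. -/
def momentumDeriv (m₁ m₂ θ ψ a b : ℝ) : ℂ :=
  ⟨b * (4 * m₁ * m₂ * (Real.sinh ψ * Real.cosh ψ) / massSum m₁ m₂ ψ) * Real.cos θ -
      a * ((m₁ + m₂ + massSum m₁ m₂ ψ) * Real.sin θ),
    -(b * (4 * m₁ * m₂ * (Real.sinh ψ * Real.cosh ψ) / massSum m₁ m₂ ψ) * Real.sin θ) +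
      a * ((m₁ + m₂ - massSum m₁ m₂ ψ) * Real.cos θ)⟩

theorem hasDerivAt_momentum (hm₁ : 0 < m₁) (hm₂ : 0 < m₂) {θ ψ : ℝ → ℝ} {a b t : ℝ}
    (hθ : HasDerivAt θ a t) (hψ : HasDerivAt ψ b t) :
    HasDerivAt (fun s => momentum m₁ m₂ (θ s) (ψ s)) (momentumDeriv m₁ m₂ (θ t) (ψ t) a b) t := by
  have hN := (hasDerivAt_massSum hm₁ hm₂ (ψ t)).comp t hψ
  refine (hasDerivAt_complex_mk ((hN.const_add (m₁ + m₂)).mul hθ.cos)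
    ((hN.const_sub (m₁ + m₂)).mul hθ.sin)).congr_deriv ?_
  apply Complex.ext <;> simp only [momentumDeriv, Function.comp_apply] <;> ring

/-- Both components are governed by the single complex number `velocity`: the real and imaginary
parts of `√R w` carry the factors `√R (M + N)` and `√R (M - N)`, whose logarithmic derivatives are
`(logSum ∓ logDiff)/2`. The energy involves the same quantities with weights `cos² θ` and `sin² θ`.
-/
theorem hasDerivAt_diagram (hm₁ : 0 < m₁) (hm₂ : 0 < m₂) {θ ψ : ℝ → ℝ} {a b t : ℝ}
    (hθ : HasDerivAt θ a t) (hψ : HasDerivAt ψ b t) (hpos : 0 < ψ t) :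
    HasDerivAt (fun s => diagram m₁ m₂ (θ s, ψ s)) (diagramDeriv m₁ m₂ (θ t) (ψ t) a b) t := by
  have hN := (hasDerivAt_massSum hm₁ hm₂ (ψ t)).comp t hψ
  have hκ := (hasDerivAt_sqSpeed hm₁ hm₂ hpos).comp t hψ
  have hw := hasDerivAt_momentum hm₁ hm₂ hθ hψ
  have hc := (hasDerivAt_coth hpos).comp t hψ
  have h1 := ((hκ.mul (hN.add ((hθ.const_mul 2).cos.const_mul (m₁ + m₂)))).sub
    (hc.const_mul (m₁ * m₂)))
  have h2 := (hκ.ofReal_comp.mul (hw.pow 2)).neg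
  have i1 := logDeriv_identity hm₁ hm₂ hpos (show (1 : ℝ) ^ 2 = 1 by norm_num)
  have i2 := logDeriv_identity hm₁ hm₂ hpos (show (-1 : ℝ) ^ 2 = 1 by norm_num)
  have i3 := sqSpeed_mul_deriv_massSum hm₁ hm₂ hpos
  refine (h1.prodMk h2).congr_deriv (Prod.ext ?_ ?_)
  · simp only [diagramDeriv, velocity, Function.comp_apply, Pi.add_apply]
    rw [Real.sin_two_mul, Real.cos_two_mul']
    have hone := Real.sin_sq_add_cos_sq (θ t)
    generalize massSum m₁ m₂ (ψ t) = N at *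
    generalize sqSpeed m₁ m₂ (ψ t) = κ at *
    generalize 4 * m₁ * m₂ * (Real.sinh (ψ t) * Real.cosh (ψ t)) / N ^ 2 -
        Real.sinh (ψ t) / Real.cosh (ψ t) - 3 * (Real.cosh (ψ t) / Real.sinh (ψ t)) = l at *
    linear_combination (κ * b * Real.cos (θ t) ^ 2) * i1 + (κ * b * Real.sin (θ t) ^ 2) * i2 -
      b * i3 - (κ * b * l * N + 2 * κ * b * (4 * m₁ * m₂ *
        (Real.sinh (ψ t) * Real.cosh (ψ t)) / N)) * hone
  · simp only [diagramDeriv, Function.comp_apply, Pi.pow_apply]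
    have key : 2 * velocity m₁ m₂ (θ t) (ψ t) a b =
        ((4 * m₁ * m₂ * (Real.sinh (ψ t) * Real.cosh (ψ t)) / massSum m₁ m₂ (ψ t) ^ 2 -
          Real.sinh (ψ t) / Real.cosh (ψ t) - 3 * (Real.cosh (ψ t) / Real.sinh (ψ t)) : ℝ) : ℂ) *
          b * momentum m₁ m₂ (θ t) (ψ t) + 2 * momentumDeriv m₁ m₂ (θ t) (ψ t) a b := by
      apply Complex.ext <;> simp only [Complex.add_re, Complex.add_im, Complex.mul_re,
        Complex.mul_im, Complex.ofReal_re, Complex.ofReal_im, Complex.re_ofNat, Complex.im_ofNat,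
        velocity, momentum, momentumDeriv]
      · linear_combination (-b * Real.cos (θ t)) * i1
      · linear_combination (b * Real.sin (θ t)) * i2
    rw [Complex.ofReal_mul, Complex.ofReal_mul]
    linear_combination (sqSpeed m₁ m₂ (ψ t) * momentum m₁ m₂ (θ t) (ψ t)) * key

/-! #### Singular points -/

theorem diagramDeriv_eq_zero_iff (hm₁ : 0 < m₁) (hm₂ : 0 < m₂) (θ : ℝ) {ψ : ℝ} (hψ : 0 < ψ)
    (a b : ℝ) : (diagramDeriv m₁ m₂ θ ψ a b).2 = 0 ↔ velocity m₁ m₂ θ ψ a b = 0 := by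
  have h1 := momentum_ne_zero hm₁ hm₂ θ hψ
  have h2 : (sqSpeed m₁ m₂ ψ : ℂ) ≠ 0 := by exact_mod_cast (sqSpeed_pos hm₁ hm₂ hψ).ne'
  simp [diagramDeriv, h1, h2]

theorem diagramDeriv_fst_eq_zero {θ ψ a b : ℝ} (h : velocity m₁ m₂ θ ψ a b = 0) :
    diagramDeriv m₁ m₂ θ ψ a b = 0 := by
  simp [diagramDeriv, h]

/-- The Jacobian determinant of the Casimir, up to a nonvanishing factor. -/
def jacobian (m₁ m₂ θ ψ : ℝ) : ℝ := (logSum m₁ m₂ ψ - logDiff m₁ m₂ ψ * Real.cos (2 * θ)) / 2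

/-- The factors `m₁ + m₂ ± N` are nonzero and drop out, leaving a homogeneous real `2 × 2` system in
`(a, b)` whose determinant is `jacobian` up to sign. -/
theorem velocity_eq_zero_iff (hm₁ : 0 < m₁) (hm₂ : 0 < m₂) {θ ψ : ℝ} (hψ : 0 < ψ) (a b : ℝ) :
    velocity m₁ m₂ θ ψ a b = 0 ↔
      b * ((logSum m₁ m₂ ψ - logDiff m₁ m₂ ψ) / 2) * Real.cos θ = a * Real.sin θ ∧
      b * ((logSum m₁ m₂ ψ + logDiff m₁ m₂ ψ) / 2) * Real.sin θ = -(a * Real.cos θ) := by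
  have hN := lt_massSum hm₁ hm₂ hψ
  have h1 : m₁ + m₂ + massSum m₁ m₂ ψ ≠ 0 := by linarith
  have h2 : m₁ + m₂ - massSum m₁ m₂ ψ ≠ 0 := by linarith
  rw [Complex.ext_iff]
  simp only [velocity, Complex.zero_re, Complex.zero_im, mul_eq_zero, h1, h2, false_or,
    sub_eq_zero, add_eq_zero_iff_eq_neg]

theorem jacobian_eq (m₁ m₂ θ ψ : ℝ) : jacobian m₁ m₂ θ ψ =
    (logSum m₁ m₂ ψ - logDiff m₁ m₂ ψ) / 2 * Real.cos θ ^ 2 +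
      (logSum m₁ m₂ ψ + logDiff m₁ m₂ ψ) / 2 * Real.sin θ ^ 2 := by
  rw [jacobian, Real.cos_two_mul']
  linear_combination (-logSum m₁ m₂ ψ / 2) * Real.sin_sq_add_cos_sq θ

theorem jacobian_eq_zero_of_velocity (hm₁ : 0 < m₁) (hm₂ : 0 < m₂) {θ ψ a b : ℝ} (hψ : 0 < ψ)
    (h : velocity m₁ m₂ θ ψ a b = 0) (hab : a ≠ 0 ∨ b ≠ 0) : jacobian m₁ m₂ θ ψ = 0 := by
  obtain ⟨h1, h2⟩ := (velocity_eq_zero_iff hm₁ hm₂ hψ a b).mp h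
  -- A pure change of phase is never in the kernel: for `b = 0` the system reads `a sin θ = a cos θ
  -- = 0`. Hence a kernel vector can be normalised to `b = 1`.
  have hb : b ≠ 0 := by
    rintro rfl
    have : a = 0 := by
      linear_combination (-a) * Real.sin_sq_add_cos_sq θ - Real.sin θ * h1 + Real.cos θ * h2
    simp [this] at hab
  refine (mul_eq_zero.mp (?_ : b * jacobian m₁ m₂ θ ψ = 0)).resolve_left hb
  rw [jacobian_eq]
  linear_combination Real.cos θ * h1 + Real.sin θ * h2

/-- The `θ`-component of the kernel direction whose `ψ`-component is one. -/
def kernelDir (m₁ m₂ θ ψ : ℝ) : ℝ := -(logDiff m₁ m₂ ψ * (Real.sin θ * Real.cos θ))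

theorem velocity_kernelDir (hm₁ : 0 < m₁) (hm₂ : 0 < m₂) {θ ψ : ℝ} (hψ : 0 < ψ)
    (h : jacobian m₁ m₂ θ ψ = 0) : velocity m₁ m₂ θ ψ (kernelDir m₁ m₂ θ ψ) 1 = 0 := by
  rw [velocity_eq_zero_iff hm₁ hm₂ hψ, kernelDir]
  rw [jacobian_eq] at h
  have hone := Real.sin_sq_add_cos_sq θ
  constructor
  · linear_combination Real.cos θ * h - ((logSum m₁ m₂ ψ - logDiff m₁ m₂ ψ) / 2 *
      Real.cos θ) * hone
  · linear_combination Real.sin θ * h - ((logSum m₁ m₂ ψ + logDiff m₁ m₂ ψ) / 2 *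
      Real.sin θ) * hone

/-- Substituting `Z = e^ψ N` and `1 + tanh ψ = e^ψ / cosh ψ` makes `e^ψ` a common factor; the rest
is `jacobian` with its denominators cleared. -/
theorem Gam_eq (hm₁ : 0 < m₁) (hm₂ : 0 < m₂) (θ : ℝ) {ψ : ℝ} (hψ : 0 < ψ) :
    Gam m₁ m₂ θ ψ = -(Real.exp ψ * massSum m₁ m₂ ψ ^ 2 * Real.sinh ψ / Real.cosh ψ) *
      jacobian m₁ m₂ θ ψ := by
  have hN := massSum_pos hm₁ hm₂ ψ
  have h2 := Real.sinh_pos_iff.mpr hψ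
  have h3 := Real.cosh_pos ψ
  have hN2 := sq_massSum hm₁ hm₂ ψ
  have hc := Real.cosh_sq ψ
  have he : Real.exp ψ = Real.cosh ψ + Real.sinh ψ := (Real.cosh_add_sinh ψ).symm
  have hZ : Zfun m₁ m₂ ψ = Real.exp ψ * massSum m₁ m₂ ψ := by
    rw [Zfun, Real.sqrt_eq_iff_mul_self_eq (by positivity) (by positivity)]
    have h2e : Real.exp (2 * ψ) = Real.exp ψ ^ 2 := by rw [← Real.exp_nat_mul]; norm_num
    rw [h2e, he]
    linear_combination (-(Real.cosh ψ + Real.sinh ψ) ^ 2) * hN2 + m₁ * m₂ *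
      ((Real.cosh ψ + Real.sinh ψ) ^ 2 - 1 + 2 * Real.sinh ψ * (Real.cosh ψ + Real.sinh ψ)) * hc
  have h1t : 1 + Real.tanh ψ = Real.exp ψ / Real.cosh ψ := by
    rw [Real.tanh_eq_sinh_div_cosh, he]; field_simp
  rw [Gam, hZ, h1t, jacobian, logSum, logDiff, Real.cosh_two_mul]
  field_simp
  rw [hN2, hc]
  ring

theorem Gam_eq_zero_iff (hm₁ : 0 < m₁) (hm₂ : 0 < m₂) (θ : ℝ) {ψ : ℝ} (hψ : 0 < ψ) :
    Gam m₁ m₂ θ ψ = 0 ↔ jacobian m₁ m₂ θ ψ = 0 := by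
  have hN := massSum_pos hm₁ hm₂ ψ
  have h2 := Real.sinh_pos_iff.mpr hψ
  have h3 := Real.cosh_pos ψ
  rw [Gam_eq hm₁ hm₂ θ hψ, mul_eq_zero, or_iff_right (by rw [neg_eq_zero]; positivity)]

/-! #### Smoothness -/

theorem contDiff_massSum (hm₁ : 0 < m₁) (hm₂ : 0 < m₂) : ContDiff ℝ ∞ (massSum m₁ m₂) := by
  unfold massSum
  refine ContDiff.sqrt (by fun_prop) fun ψ => ?_
  exact (Real.sqrt_pos.mp (massSum_pos hm₁ hm₂ ψ)).ne'

theorem contDiffAt_sqSpeed (hm₁ : 0 < m₁) (hm₂ : 0 < m₂) {ψ : ℝ} (hψ : 0 < ψ) :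
    ContDiffAt ℝ ∞ (sqSpeed m₁ m₂) ψ := by
  have h2 := Real.sinh_pos_iff.mpr hψ
  have h3 := Real.cosh_pos ψ
  exact (contDiff_massSum hm₁ hm₂).contDiffAt.div (by fun_prop) (by positivity)

theorem contDiff_momentum (hm₁ : 0 < m₁) (hm₂ : 0 < m₂) :
    ContDiff ℝ ∞ fun a : ℝ × ℝ => momentum m₁ m₂ a.1 a.2 := by
  have hN : ContDiff ℝ ∞ fun a : ℝ × ℝ => massSum m₁ m₂ a.2 :=
    (contDiff_massSum hm₁ hm₂).comp contDiff_snd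
  simp only [momentum, Complex.mk_eq_add_mul_I]
  have ho : ContDiff ℝ ∞ (fun x : ℝ => (x : ℂ)) := Complex.ofRealCLM.contDiff
  refine (ho.comp ?_).add ((ho.comp ?_).mul contDiff_const)
  · fun_prop
  · fun_prop

theorem contDiffAt_diagram (hm₁ : 0 < m₁) (hm₂ : 0 < m₂) (θ : ℝ) {ψ : ℝ} (hψ : 0 < ψ) :
    ContDiffAt ℝ ∞ (diagram m₁ m₂) (θ, ψ) := by
  have hN : ContDiffAt ℝ ∞ (fun a : ℝ × ℝ => massSum m₁ m₂ a.2) (θ, ψ) :=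
    ((contDiff_massSum hm₁ hm₂).comp contDiff_snd).contDiffAt
  have hκ : ContDiffAt ℝ ∞ (fun a : ℝ × ℝ => sqSpeed m₁ m₂ a.2) (θ, ψ) :=
    (contDiffAt_sqSpeed hm₁ hm₂ hψ).comp (θ, ψ) contDiffAt_snd
  have ho : ContDiff ℝ ∞ (fun x : ℝ => (x : ℂ)) := Complex.ofRealCLM.contDiff
  have hc : ContDiffAt ℝ ∞ (fun a : ℝ × ℝ => Real.cosh a.2 / Real.sinh a.2) (θ, ψ) :=
    ContDiffAt.div (by fun_prop) (by fun_prop) (Real.sinh_pos_iff.mpr hψ).ne'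
  have hw := (contDiff_momentum hm₁ hm₂).contDiffAt (x := (θ, ψ))
  refine ContDiffAt.prodMk ?_ ?_
  · fun_prop
  · exact ((ho.contDiffAt.comp (θ, ψ) hκ).mul (hw.pow 2)).neg

theorem fderiv_diagram (hm₁ : 0 < m₁) (hm₂ : 0 < m₂) (θ : ℝ) {ψ : ℝ} (hψ : 0 < ψ) (a b : ℝ) :
    fderiv ℝ (diagram m₁ m₂) (θ, ψ) (a, b) = diagramDeriv m₁ m₂ θ ψ a b := by
  have hd := ((contDiffAt_diagram hm₁ hm₂ θ hψ).differentiableAt (by simp)).hasFDerivAt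
  have h1 : HasDerivAt (fun t : ℝ => θ + t * a) a 0 := by
    simpa using ((hasDerivAt_id (0 : ℝ)).mul_const a).const_add θ
  have h2 : HasDerivAt (fun t : ℝ => ψ + t * b) b 0 := by
    simpa using ((hasDerivAt_id (0 : ℝ)).mul_const b).const_add ψ
  have h3 := hd.hasLineDerivAt (a, b)
  have h4 := hasDerivAt_diagram hm₁ hm₂ h1 h2 (by simpa using hψ)
  simp only [zero_mul, add_zero] at h4
  exact HasDerivAt.unique h3 h4

theorem isSingularAt_diagram_iff (hm₁ : 0 < m₁) (hm₂ : 0 < m₂) (θ : ℝ) {ψ : ℝ} (hψ : 0 < ψ) :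
    IsSingularAt (diagram m₁ m₂) (θ, ψ) ↔ jacobian m₁ m₂ θ ψ = 0 := by
  rw [IsSingularAt, injective_iff_map_eq_zero]
  push Not
  constructor
  · rintro ⟨⟨a, b⟩, h, hne⟩
    rw [fderiv_diagram hm₁ hm₂ θ hψ] at h
    refine jacobian_eq_zero_of_velocity hm₁ hm₂ hψ
      ((diagramDeriv_eq_zero_iff hm₁ hm₂ θ hψ a b).mp (congrArg Prod.snd h)) ?_
    by_contra! hc
    exact hne (Prod.ext hc.1 hc.2)
  · intro h
    refine ⟨(kernelDir m₁ m₂ θ ψ, 1), ?_, fun h0 => one_ne_zero (congrArg Prod.snd h0)⟩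
    rw [fderiv_diagram hm₁ hm₂ θ hψ]
    exact diagramDeriv_fst_eq_zero (velocity_kernelDir hm₁ hm₂ hψ h)

/-! #### Transversality of the kernel to the singular curve -/

theorem hasDerivAt_logSum (hm₁ : 0 < m₁) (hm₂ : 0 < m₂) {ψ : ℝ} (hψ : 0 < ψ) :
    HasDerivAt (logSum m₁ m₂)
      (4 * m₁ * m₂ * (Real.cosh ψ ^ 2 + Real.sinh ψ ^ 2) / massSum m₁ m₂ ψ ^ 2 -
        32 * (m₁ * m₂) ^ 2 * (Real.sinh ψ * Real.cosh ψ) ^ 2 / massSum m₁ m₂ ψ ^ 4 +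
        1 / Real.sinh ψ ^ 2 - 1 / Real.cosh ψ ^ 2) ψ := by
  have hN := massSum_pos hm₁ hm₂ ψ
  have h1 := (((Real.hasDerivAt_sinh ψ).mul (Real.hasDerivAt_cosh ψ)).const_mul
    (4 * m₁ * m₂)).div ((hasDerivAt_massSum hm₁ hm₂ ψ).pow 2) (pow_ne_zero 2 hN.ne')
  refine ((h1.sub (hasDerivAt_coth hψ)).sub (hasDerivAt_sinh_div_cosh ψ)).congr_deriv ?_
  have h2 := Real.sinh_pos_iff.mpr hψ
  have h3 := Real.cosh_pos ψ
  simp only [Pi.mul_apply, Pi.pow_apply]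
  field_simp
  push_cast
  ring

theorem hasDerivAt_logDiff (hm₁ : 0 < m₁) (hm₂ : 0 < m₂) {ψ : ℝ} (hψ : 0 < ψ) :
    HasDerivAt (logDiff m₁ m₂)
      (-(2 * (m₁ + m₂) * (1 / (Real.sinh ψ ^ 2 * massSum m₁ m₂ ψ) +
        4 * m₁ * m₂ * Real.cosh ψ ^ 2 / massSum m₁ m₂ ψ ^ 3))) ψ := by
  have hN := massSum_pos hm₁ hm₂ ψ
  refine (((hasDerivAt_coth hψ).const_mul (2 * (m₁ + m₂))).div (hasDerivAt_massSum hm₁ hm₂ ψ)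
    hN.ne').congr_deriv ?_
  have h2 := Real.sinh_pos_iff.mpr hψ
  field_simp
  ring

/-- `logSum / logDiff` is strictly decreasing. -/
theorem wronskian_neg (hm₁ : 0 < m₁) (hm₂ : 0 < m₂) {ψ S L : ℝ} (hψ : 0 < ψ)
    (hS : HasDerivAt (logSum m₁ m₂) S ψ) (hL : HasDerivAt (logDiff m₁ m₂) L ψ) :
    S * logDiff m₁ m₂ ψ - L * logSum m₁ m₂ ψ < 0 := by
  rw [hS.unique (hasDerivAt_logSum hm₁ hm₂ hψ), hL.unique (hasDerivAt_logDiff hm₁ hm₂ hψ)]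
  have hN := massSum_pos hm₁ hm₂ ψ
  have h2 := Real.sinh_pos_iff.mpr hψ
  have h3 := Real.cosh_pos ψ
  have hN2 := sq_massSum hm₁ hm₂ ψ
  have hc := Real.cosh_sq ψ
  have hk := mul_pos hm₁ hm₂
  -- The difference of the two sides is `(m₁ - m₂)²`. The bound lets `2 N⁴` absorb the only negative
  -- term of `key`.
  have hP : 4 * (m₁ * m₂) * Real.cosh ψ ^ 2 ≤ massSum m₁ m₂ ψ ^ 2 := by
    rw [hN2, hc]; nlinarith [sq_nonneg (m₁ - m₂)]
  have key : 0 < 16 * (m₁ * m₂) ^ 2 * Real.sinh ψ ^ 2 * Real.cosh ψ ^ 4 -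
      4 * (m₁ * m₂) * massSum m₁ m₂ ψ ^ 2 * Real.cosh ψ ^ 2 + 2 * (massSum m₁ m₂ ψ ^ 2) ^ 2 := by
    have : 0 < 16 * (m₁ * m₂) ^ 2 * Real.sinh ψ ^ 2 * Real.cosh ψ ^ 4 := by positivity
    nlinarith [pow_pos hN 2, mul_le_mul_of_nonneg_right hP (pow_pos hN 2).le, pow_pos hN 4]
  have e : ∀ X, X = -(2 * (m₁ + m₂) / (Real.sinh ψ * Real.cosh ψ * massSum m₁ m₂ ψ ^ 5) *
      (16 * (m₁ * m₂) ^ 2 * Real.sinh ψ ^ 2 * Real.cosh ψ ^ 4 -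
      4 * (m₁ * m₂) * massSum m₁ m₂ ψ ^ 2 * Real.cosh ψ ^ 2 + 2 * (massSum m₁ m₂ ψ ^ 2) ^ 2)) →
      X < 0 := by
    rintro X rfl
    rw [neg_lt_zero]
    exact mul_pos (by positivity) key
  apply e
  rw [logSum, logDiff]
  field_simp
  rw [hc]
  ring

theorem hasDerivAt_comp_add {g : ℝ → ℝ} {g' ψ : ℝ} (h : HasDerivAt g g' ψ) :
    HasDerivAt (fun t : ℝ => g (ψ + t * 1)) g' 0 := by
  have h2 : HasDerivAt (fun t : ℝ => ψ + t * 1) 1 0 := by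
    simpa using (hasDerivAt_id (0 : ℝ)).const_add ψ
  have h3 : HasDerivAt g g' (ψ + 0 * 1) := by simpa using h
  simpa [Function.comp_def] using h3.comp 0 h2

/-- At a zero of `velocity` the derivatives of the prefactors `m₁ + m₂ ± N` are multiplied by zero,
so only the brackets are differentiated. -/
theorem hasDerivAt_velocity (hm₁ : 0 < m₁) (hm₂ : 0 < m₂) {θ ψ a S L : ℝ} (hψ : 0 < ψ)
    (hS : HasDerivAt (logSum m₁ m₂) S ψ) (hL : HasDerivAt (logDiff m₁ m₂) L ψ)
    (h0 : velocity m₁ m₂ θ ψ a 1 = 0) :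
    HasDerivAt (fun t : ℝ => velocity m₁ m₂ (θ + t * a) (ψ + t * 1) a 1)
      ⟨(m₁ + m₂ + massSum m₁ m₂ ψ) * ((S - L) / 2 * Real.cos θ -
          (logSum m₁ m₂ ψ - logDiff m₁ m₂ ψ) / 2 * (a * Real.sin θ) - a ^ 2 * Real.cos θ),
        (m₁ + m₂ - massSum m₁ m₂ ψ) * ((S + L) / 2 * Real.sin θ +
          (logSum m₁ m₂ ψ + logDiff m₁ m₂ ψ) / 2 * (a * Real.cos θ) - a ^ 2 * Real.sin θ)⟩ 0 := by
  have h1 : HasDerivAt (fun t : ℝ => θ + t * a) a 0 := by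
    simpa using ((hasDerivAt_id (0 : ℝ)).mul_const a).const_add θ
  have h2 : HasDerivAt (fun t : ℝ => ψ + t * 1) 1 0 := by
    simpa using (hasDerivAt_id (0 : ℝ)).const_add ψ
  have hS' := hasDerivAt_comp_add hS
  have hL' := hasDerivAt_comp_add hL
  have hN' := hasDerivAt_comp_add (hasDerivAt_massSum hm₁ hm₂ ψ)
  obtain ⟨v1, v2⟩ := (velocity_eq_zero_iff hm₁ hm₂ hψ a 1).mp h0
  refine (hasDerivAt_complex_mk
    ((hN'.const_add (m₁ + m₂)).mul (((((hS'.sub hL').div_const 2).const_mul 1).mul h1.cos).sub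
      (h1.sin.const_mul a)))
    ((hN'.const_sub (m₁ + m₂)).mul (((((hS'.add hL').div_const 2).const_mul 1).mul h1.sin).add
      (h1.cos.const_mul a)))).congr_deriv ?_
  apply Complex.ext
  · simp only [Pi.mul_apply, Pi.sub_apply, zero_mul, add_zero]
    rw [v1]
    ring
  · simp only [Pi.mul_apply, Pi.add_apply, zero_mul, add_zero]
    rw [v2]
    ring

/-! ### The Lagrange multiplier and the cusps of the diagram. -/

/-- `-e^{iθ}` over `momentum`: the Lagrange multiplier relating energy and Casimir. -/
def multiplier (m₁ m₂ θ ψ : ℝ) : ℂ := -⟨Real.cos θ, Real.sin θ⟩ / momentum m₁ m₂ θ ψ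

theorem diagramDeriv_fst (hm₁ : 0 < m₁) (hm₂ : 0 < m₂) (θ : ℝ) {ψ : ℝ} (hψ : 0 < ψ) (a b : ℝ) :
    (diagramDeriv m₁ m₂ θ ψ a b).1 =
      (multiplier m₁ m₂ θ ψ * (diagramDeriv m₁ m₂ θ ψ a b).2).re := by
  have hw := momentum_ne_zero hm₁ hm₂ θ hψ
  have : multiplier m₁ m₂ θ ψ * (diagramDeriv m₁ m₂ θ ψ a b).2 =
      ((2 * sqSpeed m₁ m₂ ψ : ℝ) : ℂ) * (⟨Real.cos θ, Real.sin θ⟩ * velocity m₁ m₂ θ ψ a b) := by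
    simp only [multiplier, diagramDeriv]
    field_simp
    push_cast
    ring
  rw [this, Complex.re_ofReal_mul, Complex.mul_re]
  rfl

/-- In `e^{iθ} (w' - i a w)` the terms in `m₁ + m₂` cancel and those in `N` add up to `N' - 2 i a
N`, with no phase left. -/
theorem hasDerivAt_multiplier (hm₁ : 0 < m₁) (hm₂ : 0 < m₂) {θ ψ a : ℝ} (hψ : 0 < ψ) :
    HasDerivAt (fun t : ℝ => multiplier m₁ m₂ (θ + t * a) (ψ + t * 1))
      (⟨4 * m₁ * m₂ * (Real.sinh ψ * Real.cosh ψ) / massSum m₁ m₂ ψ,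
        -(2 * a * massSum m₁ m₂ ψ)⟩ / momentum m₁ m₂ θ ψ ^ 2) 0 := by
  have h1 : HasDerivAt (fun t : ℝ => θ + t * a) a 0 := by
    simpa using ((hasDerivAt_id (0 : ℝ)).mul_const a).const_add θ
  have h2 : HasDerivAt (fun t : ℝ => ψ + t * 1) 1 0 := by
    simpa using (hasDerivAt_id (0 : ℝ)).const_add ψ
  have hw := hasDerivAt_momentum hm₁ hm₂ h1 h2
  have hw0 := momentum_ne_zero hm₁ hm₂ θ hψ
  refine ((hasDerivAt_complex_mk h1.cos h1.sin).neg.div hw (by simpa using hw0)).congr_deriv ?_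
  simp only [zero_mul, add_zero]
  congr 1
  have hone := Real.sin_sq_add_cos_sq θ
  apply Complex.ext
  · simp [momentum, momentumDeriv]
    linear_combination (4 * m₁ * m₂ * (Real.sinh ψ * Real.cosh ψ) / massSum m₁ m₂ ψ) * hone
  · simp [momentum, momentumDeriv]
    linear_combination (-(2 * a * massSum m₁ m₂ ψ)) * hone

theorem contDiff_line (θ ψ a : ℝ) :
    ContDiff ℝ ∞ fun t : ℝ => ((θ + t * a, ψ + t * 1) : ℝ × ℝ) := by
  fun_prop

theorem contDiff_momentum_line (hm₁ : 0 < m₁) (hm₂ : 0 < m₂) (θ ψ a : ℝ) :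
    ContDiff ℝ ∞ fun t : ℝ => momentum m₁ m₂ (θ + t * a) (ψ + t * 1) := by
  have h := ContDiff.comp (g := fun b : ℝ × ℝ => momentum m₁ m₂ b.1 b.2)
    (contDiff_momentum hm₁ hm₂) (contDiff_line θ ψ a)
  exact h

theorem contDiffAt_multiplier (hm₁ : 0 < m₁) (hm₂ : 0 < m₂) {θ ψ : ℝ} (a : ℝ) (hψ : 0 < ψ) :
    ContDiffAt ℝ ∞ (fun t : ℝ => multiplier m₁ m₂ (θ + t * a) (ψ + t * 1)) 0 := by
  have hw := contDiff_momentum_line hm₁ hm₂ θ ψ a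
  have ho : ContDiff ℝ ∞ (fun x : ℝ => (x : ℂ)) := Complex.ofRealCLM.contDiff
  have hc : ContDiff ℝ ∞ fun t : ℝ => Real.cos (θ + t * a) := by fun_prop
  have hs : ContDiff ℝ ∞ fun t : ℝ => Real.sin (θ + t * a) := by fun_prop
  have he : ContDiff ℝ ∞ fun t : ℝ =>
      -(((Real.cos (θ + t * a) : ℝ) : ℂ) + ((Real.sin (θ + t * a) : ℝ) : ℂ) * Complex.I) :=
    ContDiff.neg (ContDiff.add (ho.comp hc) (ContDiff.mul (ho.comp hs) contDiff_const))
  have hw0 : momentum m₁ m₂ (θ + 0 * a) (ψ + 0 * 1) ≠ 0 := by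
    simpa using momentum_ne_zero hm₁ hm₂ θ hψ
  have heq : (fun t : ℝ => multiplier m₁ m₂ (θ + t * a) (ψ + t * 1)) = fun t : ℝ =>
      -(((Real.cos (θ + t * a) : ℝ) : ℂ) + ((Real.sin (θ + t * a) : ℝ) : ℂ) * Complex.I) *
        (momentum m₁ m₂ (θ + t * a) (ψ + t * 1))⁻¹ := by
    funext t
    rw [multiplier, div_eq_mul_inv, Complex.mk_eq_add_mul_I]
  rw [heq]
  have hi : ContDiffAt ℝ ∞ (fun t : ℝ => (momentum m₁ m₂ (θ + t * a) (ψ + t * 1))⁻¹) 0 :=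
    ContDiffAt.inv hw.contDiffAt hw0
  exact he.contDiffAt.mul hi

/-- The cusp criterion is applied along the straight line in the kernel direction; its
transversality condition says that this direction crosses the curve `J = 0`. -/
theorem hasCuspAt_diagram (hm₁ : 0 < m₁) (hm₂ : 0 < m₂) {θ ψ : ℝ} (hψ : 0 < ψ)
    (hJ : jacobian m₁ m₂ θ ψ = 0) : HasCuspAt (diagram m₁ m₂) (θ, ψ) := by
  refine ⟨(kernelDir m₁ m₂ θ ψ, 1), fun h0 => one_ne_zero (congrArg Prod.snd h0), ?_⟩
  have hv := velocity_kernelDir hm₁ hm₂ hψ hJ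
  have hadef : kernelDir m₁ m₂ θ ψ = -(logDiff m₁ m₂ ψ * (Real.sin θ * Real.cos θ)) := rfl
  generalize kernelDir m₁ m₂ θ ψ = a at hv hadef
  set f : ℝ → ℝ × ℂ := fun t => diagram m₁ m₂ (θ + t * a, ψ + t * 1) with hfdef
  have hl := contDiff_line θ ψ a
  have hf : ContDiffAt ℝ ∞ f 0 :=
    ContDiffAt.comp (g := diagram m₁ m₂) (f := fun t : ℝ => ((θ + t * a, ψ + t * 1) : ℝ × ℝ))
      (0 : ℝ) (by simpa using contDiffAt_diagram hm₁ hm₂ θ hψ) hl.contDiffAt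
  have hpos : ∀ᶠ t : ℝ in 𝓝 0, 0 < ψ + t * 1 := by
    have : ContinuousAt (fun t : ℝ => ψ + t * 1) 0 := by fun_prop
    exact this.eventually_const_lt (by simpa using hψ)
  have hderiv : ∀ᶠ t : ℝ in 𝓝 0,
      deriv f t = diagramDeriv m₁ m₂ (θ + t * a) (ψ + t * 1) a 1 := by
    filter_upwards [hpos] with t ht
    have h1 : HasDerivAt (fun t : ℝ => θ + t * a) a t := by
      simpa using ((hasDerivAt_id t).mul_const a).const_add θ
    have h2 : HasDerivAt (fun t : ℝ => ψ + t * 1) 1 t := by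
      simpa using (hasDerivAt_id t).const_add ψ
    exact (hasDerivAt_diagram hm₁ hm₂ h1 h2 ht).deriv
  have hd0 : deriv f 0 = 0 := by
    rw [hderiv.self_of_nhds]
    simpa using diagramDeriv_fst_eq_zero hv
  have hS := hasDerivAt_logSum hm₁ hm₂ hψ
  have hL := hasDerivAt_logDiff hm₁ hm₂ hψ
  have hW := wronskian_neg hm₁ hm₂ hψ hS hL
  have hvel := hasDerivAt_velocity hm₁ hm₂ hψ hS hL hv
  revert hW hvel
  generalize 4 * m₁ * m₂ * (Real.cosh ψ ^ 2 + Real.sinh ψ ^ 2) / massSum m₁ m₂ ψ ^ 2 -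
        32 * (m₁ * m₂) ^ 2 * (Real.sinh ψ * Real.cosh ψ) ^ 2 / massSum m₁ m₂ ψ ^ 4 +
        1 / Real.sinh ψ ^ 2 - 1 / Real.cosh ψ ^ 2 = S
  generalize -(2 * (m₁ + m₂) * (1 / (Real.sinh ψ ^ 2 * massSum m₁ m₂ ψ) +
        4 * m₁ * m₂ * Real.cosh ψ ^ 2 / massSum m₁ m₂ ψ ^ 3)) = L
  intro hW hvel
  have hw0 := momentum_ne_zero hm₁ hm₂ θ hψ
  have hκ := sqSpeed_pos hm₁ hm₂ hψ
  have hN := massSum_pos hm₁ hm₂ ψ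
  have hs := Real.sinh_pos_iff.mpr hψ
  have hch := Real.cosh_pos ψ
  have hN2 := sq_massSum hm₁ hm₂ ψ
  have hdL := logDiff_pos hm₁ hm₂ hψ
  have hone := Real.sin_sq_add_cos_sq θ
  set U := (S - L) / 2 * Real.cos θ -
          (logSum m₁ m₂ ψ - logDiff m₁ m₂ ψ) / 2 * (a * Real.sin θ) - a ^ 2 * Real.cos θ with hU
  set V := (S + L) / 2 * Real.sin θ +
          (logSum m₁ m₂ ψ + logDiff m₁ m₂ ψ) / 2 * (a * Real.cos θ) - a ^ 2 * Real.sin θ with hV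
  -- As `velocity` vanishes at the point, only the derivative of that factor of `-2 R w v` survives.
  have hsec : (deriv (deriv f) 0).2 = -(2 * sqSpeed m₁ m₂ ψ * momentum m₁ m₂ θ ψ *
      ⟨(m₁ + m₂ + massSum m₁ m₂ ψ) * U, (m₁ + m₂ - massSum m₁ m₂ ψ) * V⟩) := by
    have h1 : HasDerivAt (fun t : ℝ => θ + t * a) a 0 := by
      simpa using ((hasDerivAt_id (0 : ℝ)).mul_const a).const_add θ
    have h2 : HasDerivAt (fun t : ℝ => ψ + t * 1) 1 0 := by
      simpa using (hasDerivAt_id (0 : ℝ)).const_add ψ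
    have hκ' := ((hasDerivAt_comp_add (hasDerivAt_sqSpeed hm₁ hm₂ hψ)).ofReal_comp).const_mul
      (2 : ℂ)
    have hp := ((hκ'.mul (hasDerivAt_momentum hm₁ hm₂ h1 h2)).mul hvel).neg
    have hdd := hasDerivAt_snd (((contDiffAt_deriv (m := 1) (n := 2) (contDiffAt_infty.mp hf 2) (by norm_num)).differentiableAt (by simp)).hasDerivAt)
    have hq := hdd.unique (hp.congr_of_eventuallyEq (hderiv.mono fun t ht => congrArg Prod.snd ht))
    rw [hq]
    simp [hv]
  -- This quantity is the derivative of `jacobian` along `(a, 1)`. The `ψ`-part is negative by the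
  -- Wronskian inequality once `logSum = logDiff cos 2θ` is used, and the `θ`-part is `-2 a²`.
  have hK : Real.cos θ * U + Real.sin θ * V < 0 := by
    have e1 : Real.cos θ * U + Real.sin θ * V =
        (S - L * Real.cos (2 * θ)) / 2 - 2 * a ^ 2 := by
      rw [hU, hV, Real.cos_two_mul', hadef]
      linear_combination (S / 2 - (logDiff m₁ m₂ ψ * (Real.sin θ * Real.cos θ)) ^ 2) * hone
    have e2 : logDiff m₁ m₂ ψ * (S - L * Real.cos (2 * θ)) < 0 := by
      have : logSum m₁ m₂ ψ = logDiff m₁ m₂ ψ * Real.cos (2 * θ) := by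
        unfold jacobian at hJ; linarith
      rw [this] at hW
      linarith
    have e3 : S - L * Real.cos (2 * θ) < 0 := by
      by_contra! h
      exact absurd e2 (not_lt.mpr (mul_nonneg hdL.le h))
    rw [e1]
    nlinarith [sq_nonneg a]
  have hcusp := exists_cusp_of_tangent (f := f)
    (ν := fun t => multiplier m₁ m₂ (θ + t * a) (ψ + t * 1)) (contDiffAt_infty.mp hf 3)
    (contDiffAt_infty.mp (contDiffAt_multiplier hm₁ hm₂ a hψ) 2) (by
    filter_upwards [hderiv, hpos] with t ht hp
    rw [ht]
    exact diagramDeriv_fst hm₁ hm₂ _ hp _ _) hd0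
  suffices htr : _ by
    obtain ⟨A, B, hAB, ho⟩ := hcusp htr
    refine ⟨A, B, hAB, ?_⟩
    simpa [hfdef] using ho
  · rw [(hasDerivAt_multiplier hm₁ hm₂ hψ).deriv, hsec]
    have e : (⟨4 * m₁ * m₂ * (Real.sinh ψ * Real.cosh ψ) / massSum m₁ m₂ ψ,
        -(2 * a * massSum m₁ m₂ ψ)⟩ : ℂ) / momentum m₁ m₂ θ ψ ^ 2 *
        -(2 * sqSpeed m₁ m₂ ψ * momentum m₁ m₂ θ ψ *
          ⟨(m₁ + m₂ + massSum m₁ m₂ ψ) * U, (m₁ + m₂ - massSum m₁ m₂ ψ) * V⟩) =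
        ((-(2 * sqSpeed m₁ m₂ ψ) : ℝ) : ℂ) *
        (⟨4 * m₁ * m₂ * (Real.sinh ψ * Real.cosh ψ) / massSum m₁ m₂ ψ,
          -(2 * a * massSum m₁ m₂ ψ)⟩ *
        ⟨(m₁ + m₂ + massSum m₁ m₂ ψ) * U, (m₁ + m₂ - massSum m₁ m₂ ψ) * V⟩ /
          momentum m₁ m₂ θ ψ) := by
      field_simp
      push_cast
      ring
    rw [e, Complex.re_ofReal_mul, Complex.div_re]
    have hns := Complex.normSq_pos.mpr hw0
    -- The value of `a` for the kernel direction, rewritten so that the two components of the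
    -- product recombine into `N' (cos θ U + sin θ V) |w|²`.
    have e4 : (2 : ℝ) * a * massSum m₁ m₂ ψ * ((m₁ + m₂) ^ 2 - massSum m₁ m₂ ψ ^ 2) =
        4 * (m₁ + m₂) * massSum m₁ m₂ ψ * (4 * m₁ * m₂ * (Real.sinh ψ * Real.cosh ψ) /
          massSum m₁ m₂ ψ) * (Real.sin θ * Real.cos θ) := by
      rw [hadef, hN2, logDiff]
      field_simp
      ring
    have e5 : (4 * m₁ * m₂ * (Real.sinh ψ * Real.cosh ψ) / massSum m₁ m₂ ψ) *
        (Real.cos θ * U + Real.sin θ * V) * Complex.normSq (momentum m₁ m₂ θ ψ) ≠ 0 := by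
      refine mul_ne_zero (mul_ne_zero ?_ hK.ne) hns.ne'
      positivity
    refine mul_ne_zero (by linarith [hκ] |> ne_of_lt) ?_
    rw [← add_div]
    refine div_ne_zero ?_ hns.ne'
    convert e5 using 1
    simp only [Complex.normSq_apply, momentum, Complex.mul_re, Complex.mul_im]
    linear_combination (Real.cos θ * V - Real.sin θ * U) * e4 -
      (4 * m₁ * m₂ * (Real.sinh ψ * Real.cosh ψ) / massSum m₁ m₂ ψ) *
        (Real.cos θ * U * (m₁ + m₂ + massSum m₁ m₂ ψ) ^ 2 +
          Real.sin θ * V * (m₁ + m₂ - massSum m₁ m₂ ψ) ^ 2) * hone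

/-! ### Normal form of relative equilibria -/

/-- The general Hermitian matrix. -/
def herm (a : ℝ) (b : ℂ) (d : ℝ) : Biquat := !![(a : ℂ), b; star b, (d : ℂ)]

theorem exists_eq_herm {q : Biquat} (hq : q.IsHermitian) : ∃ a b d, q = herm a b d := by
  refine ⟨(q 0 0).re, q 0 1, (q 1 1).re, ?_⟩
  have h0 : ((q 0 0).re : ℂ) = q 0 0 := Complex.conj_eq_iff_re.mp (hq.apply 0 0)
  have h1 : ((q 1 1).re : ℂ) = q 1 1 := Complex.conj_eq_iff_re.mp (hq.apply 1 1)
  have h2 := hq.apply 1 0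
  ext i j
  fin_cases i <;> fin_cases j <;> simp [herm, h0, h1, ← h2]

theorem isHermitian_herm (a : ℝ) (b : ℂ) (d : ℝ) : (herm a b d).IsHermitian := by
  ext i j
  fin_cases i <;> fin_cases j <;> simp [herm]

theorem det_herm (a : ℝ) (b : ℂ) (d : ℝ) :
    (herm a b d).det = ((a * d - Complex.normSq b : ℝ) : ℂ) := by
  rw [Matrix.det_fin_two]
  apply Complex.ext <;> simp [herm, Complex.normSq_apply]
  ring

theorem bil_herm (a : ℝ) (b : ℂ) (d : ℝ) (a' : ℝ) (b' : ℂ) (d' : ℝ) :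
    bil (herm a b d) (herm a' b' d') =
      (((a * d' + d * a') / 2 - (b.re * b'.re + b.im * b'.im) : ℝ) : ℂ) := by
  rw [bil_eq]
  apply Complex.ext <;> simp [herm] <;> ring

theorem trace_herm (a : ℝ) (b : ℂ) (d : ℝ) : (herm a b d).trace = ((a + d : ℝ) : ℂ) := by
  simp [herm, Matrix.trace_fin_two]

/-- The diagonal generator with eigenvalues `± η`. -/
def gen (η : ℂ) : Biquat := !![η, 0; 0, -η]

theorem trace_gen (η : ℂ) : (gen η).trace = 0 := by simp [gen, Matrix.trace_fin_two]

theorem gen_conjTranspose (η : ℂ) : (gen η).conjTranspose = gen (star η) := by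
  ext i j
  fin_cases i <;> fin_cases j <;> simp [gen]

theorem infConj_gen_herm (η : ℂ) (a : ℝ) (b : ℂ) (d : ℝ) :
    infConj (gen η) (herm a b d) =
      herm (2 * η.re * a) (2 * η.im * Complex.I * b) (-(2 * η.re * d)) := by
  rw [infConj, gen_conjTranspose]
  ext i j
  fin_cases i <;> fin_cases j <;> apply Complex.ext <;> simp [gen, herm] <;> ring

theorem smul_herm (c a : ℝ) (b : ℂ) (d : ℝ) : c • herm a b d = herm (c * a) (c * b) (c * d) := by
  ext i j
  fin_cases i <;> fin_cases j <;> simp [herm]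

theorem herm_add (a : ℝ) (b : ℂ) (d : ℝ) (a' : ℝ) (b' : ℂ) (d' : ℝ) :
    herm a b d + herm a' b' d' = herm (a + a') (b + b') (d + d') := by
  ext i j
  fin_cases i <;> fin_cases j <;> simp [herm]

theorem herm_sub (a : ℝ) (b : ℂ) (d : ℝ) (a' : ℝ) (b' : ℂ) (d' : ℝ) :
    herm a b d - herm a' b' d' = herm (a - a') (b - b') (d - d') := by
  ext i j
  fin_cases i <;> fin_cases j <;> simp [herm]

theorem herm_inj {a a' d d' : ℝ} {b b' : ℂ} :
    herm a b d = herm a' b' d' ↔ a = a' ∧ d = d' ∧ b = b' := by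
  constructor
  · intro h
    have h0 := congrFun (congrFun h 0) 0
    have h1 := congrFun (congrFun h 0) 1
    have h2 := congrFun (congrFun h 1) 1
    simp only [herm, Matrix.of_apply, Matrix.cons_val', Matrix.cons_val_zero, Matrix.cons_val_one,
      Matrix.cons_val_fin_one, Complex.ofReal_inj] at h0 h1 h2
    exact ⟨h0, h2, h1⟩
  · rintro ⟨rfl, rfl, rfl⟩; rfl

theorem bil_infConj {ξ : Biquat} (hξ : ξ.trace = 0) (q : Biquat) : bil q (infConj ξ q) = 0 := by
  have h1 := hξ
  rw [Matrix.trace_fin_two] at h1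
  have h2 := congrArg star h1
  simp only [star_add, star_zero] at h2
  rw [bil_eq]
  simp only [infConj, Matrix.add_apply, Matrix.mul_apply, Fin.sum_univ_two,
    Matrix.conjTranspose_apply]
  linear_combination ((q 0 0 * q 1 1 - q 0 1 * q 1 0) / 2) * (h1 + h2)

/-- The momentum equation for a diagonal generator. -/
theorem momentum_equation_iff {m : ℝ} (hm : m ≠ 0) (f z : ℝ) (η : ℂ) {a d a' d' : ℝ} {b b' : ℂ}
    (hdet : a * d - Complex.normSq b = 1) :
    -f • (herm a' b' d' - z • herm a b d) +
        ((-m • infConj (gen η) (herm a b d)).det.re / m) • herm a b d =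
      infConj (gen η) (-m • infConj (gen η) (herm a b d)) ↔
    m * (4 * Complex.normSq η) * Complex.normSq b * a = f * (z * a - a') ∧
    m * (4 * Complex.normSq η) * Complex.normSq b * d = f * (z * d - d') ∧
    m * (4 * Complex.normSq η) * (a * d) * b = f * (z * b - b') := by
  simp only [infConj_gen_herm, smul_herm, herm_sub, herm_add, herm_inj, det_herm,
    Complex.ofReal_re]
  have hnorm : Complex.normSq (((-m : ℝ) : ℂ) * (2 * η.im * Complex.I * b)) =
      m ^ 2 * (4 * η.im ^ 2) * Complex.normSq b := by
    simp [Complex.normSq_apply]; ring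
  have hd : (-m * (2 * η.re * a) * (-m * -(2 * η.re * d)) - m ^ 2 * (4 * η.im ^ 2) *
      Complex.normSq b) / m = -(m * (4 * η.re ^ 2 * (a * d) + 4 * η.im ^ 2 *
      Complex.normSq b)) := by
    field_simp
    ring
  rw [hnorm, hd]
  have hη : Complex.normSq η = η.re ^ 2 + η.im ^ 2 := by rw [Complex.normSq_apply]; ring
  have hdet' : ((a * d - Complex.normSq b : ℝ) : ℂ) = 1 := by rw [hdet]; simp
  rw [hη]
  -- Through `a d - |b|² = 1` the real and imaginary parts of `η` contribute in the same way, so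
  -- that only `|η|²` remains.
  refine and_congr ?_ (and_congr ?_ ?_)
  · constructor <;> intro h <;> linear_combination -h - 4 * m * η.re ^ 2 * a * hdet
  · constructor <;> intro h <;> linear_combination -h - 4 * m * η.re ^ 2 * d * hdet
  · push_cast at hdet' ⊢
    have hI := Complex.I_sq
    constructor <;> intro h <;>
      linear_combination -h + 4 * m * η.im ^ 2 * b * hdet' + 4 * m * η.im ^ 2 * b * hI

/-- The point at signed distance `ρ` from the axis of the diagonal one-parameter groups. -/
def axisPoint (ρ : ℝ) : Biquat := herm (Real.cosh ρ) (Real.sinh ρ : ℂ) (Real.cosh ρ)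

/-- The state with generator `ξ` and positions `q₁`, `q₂`. -/
def stateOf (m₁ m₂ : ℝ) (ξ q₁ q₂ : Biquat) : State :=
  (q₁, -m₁ • infConj ξ q₁, q₂, -m₂ • infConj ξ q₂)

theorem det_axisPoint (ρ : ℝ) : (axisPoint ρ).det = 1 := by
  rw [axisPoint, det_herm, Complex.normSq_ofReal, ← sq, ← sq, Real.cosh_sq]
  simp

theorem axisPoint_mem_hyp3 (ρ : ℝ) : axisPoint ρ ∈ hyp3 := by
  refine ⟨isHermitian_herm _ _ _, det_axisPoint ρ, ?_⟩
  rw [axisPoint, trace_herm, Complex.ofReal_re]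
  have := Real.cosh_pos ρ
  linarith

theorem bil_axisPoint (ρ₁ ρ₂ : ℝ) :
    bil (axisPoint ρ₁) (axisPoint (-ρ₂)) = (Real.cosh (ρ₁ + ρ₂) : ℂ) := by
  rw [axisPoint, axisPoint, bil_herm, Real.cosh_add]
  simp only [Complex.ofReal_re, Complex.ofReal_im, Real.cosh_neg, Real.sinh_neg]
  congr 1
  ring

theorem stateOf_mem_phaseSpace {ξ : Biquat} (hξ : ξ.trace = 0) {q₁ q₂ : Biquat}
    (h₁ : q₁ ∈ hyp3) (h₂ : q₂ ∈ hyp3) (h : q₁ ≠ q₂) : stateOf m₁ m₂ ξ q₁ q₂ ∈ phaseSpace := by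
  refine ⟨h₁, isHermitian_smul (isHermitian_infConj ξ h₁.1) _, ?_, h₂,
    isHermitian_smul (isHermitian_infConj ξ h₂.1) _, ?_, h⟩
  · exact (bil_smul_right _ _ _).trans (mul_eq_zero_of_right _ (bil_infConj hξ _))
  · exact (bil_smul_right _ _ _).trans (mul_eq_zero_of_right _ (bil_infConj hξ _))

theorem stateOf_mem_phaseSpace_axis (η : ℂ) {ρ₁ ρ₂ : ℝ} (h : 0 < ρ₁ + ρ₂) :
    stateOf m₁ m₂ (gen η) (axisPoint ρ₁) (axisPoint (-ρ₂)) ∈ phaseSpace := by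
  refine stateOf_mem_phaseSpace (trace_gen η) (axisPoint_mem_hyp3 _) (axisPoint_mem_hyp3 _) ?_
  intro he
  have h1 := bil_axisPoint ρ₁ ρ₂
  rw [← he, bil_self, det_axisPoint] at h1
  have h2 : Real.cosh (ρ₁ + ρ₂) = 1 := by exact_mod_cast h1.symm
  have h3 := Real.one_lt_cosh.mpr h.ne'
  linarith

theorem force_cosh (m₁ m₂ : ℝ) {ψ : ℝ} (hψ : 0 < ψ) :
    force m₁ m₂ (Real.cosh ψ) = m₁ * m₂ / Real.sinh ψ ^ 3 := by
  rw [force_eq m₁ m₂ (Real.one_lt_cosh.mpr hψ.ne'), Real.cosh_sq, add_sub_cancel_right,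
    Real.sqrt_sq (Real.sinh_pos_iff.mpr hψ).le]

/-- Velocity relation and momentum equation characterise relative equilibria. -/
theorem hamiltonianField_eq_infAct_iff (hm₁ : m₁ ≠ 0) (hm₂ : m₂ ≠ 0) (ξ : Biquat) (x : State) :
    hamiltonianField m₁ m₂ x = infAct ξ x ↔ x = stateOf m₁ m₂ ξ x.q₁ x.q₂ ∧
      -(force m₁ m₂ (coshSep x)) • (x.q₂ - coshSep x • x.q₁) + (x.p₁.det.re / m₁) • x.q₁ =
        infConj ξ x.p₁ ∧
      -(force m₁ m₂ (coshSep x)) • (x.q₁ - coshSep x • x.q₂) + (x.p₂.det.re / m₂) • x.q₂ =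
        infConj ξ x.p₂ := by
  obtain ⟨q1, p1, q2, p2⟩ := x
  have e : ∀ {m : ℝ} (_ : m ≠ 0) (p q : Biquat), -(1 / m) • p = infConj ξ q ↔
      p = -m • infConj ξ q := by
    intro m hm p q
    constructor
    · intro h
      rw [← h, smul_smul]
      simp [hm]
    · intro h
      rw [h, smul_smul]
      simp [hm]
  simp only [hamiltonianField, infAct_eq, stateOf, Prod.mk.injEq, e hm₁, e hm₂, true_and]
  tauto

/-! ### Distances to the axis as functions of the separation. -/

/-- The distance to the axis of the particle of mass `m₁`, when the other one has mass `m₂`. -/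
def axisDist (m₁ m₂ ψ : ℝ) : ℝ := Real.arsinh (m₂ * Real.sinh (2 * ψ) / massSum m₁ m₂ ψ) / 2

theorem massSum_comm (m₁ m₂ ψ : ℝ) : massSum m₁ m₂ ψ = massSum m₂ m₁ ψ := by
  unfold massSum; congr 1; ring

theorem sqSpeed_comm (m₁ m₂ ψ : ℝ) : sqSpeed m₁ m₂ ψ = sqSpeed m₂ m₁ ψ := by
  unfold sqSpeed; rw [massSum_comm]

theorem sinh_two_mul_axisDist (m₁ m₂ ψ : ℝ) :
    Real.sinh (2 * axisDist m₁ m₂ ψ) = m₂ * Real.sinh (2 * ψ) / massSum m₁ m₂ ψ := by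
  rw [axisDist, mul_div_cancel₀ _ two_ne_zero, Real.sinh_arsinh]

theorem sq_massSum_cosh (hm₁ : 0 < m₁) (hm₂ : 0 < m₂) (ψ : ℝ) :
    massSum m₁ m₂ ψ ^ 2 = m₁ ^ 2 + m₂ ^ 2 + 2 * m₁ * m₂ * Real.cosh (2 * ψ) := by
  rw [sq_massSum hm₁ hm₂, Real.cosh_two_mul, Real.cosh_sq]; ring

theorem cosh_two_mul_axisDist (hm₁ : 0 < m₁) (hm₂ : 0 < m₂) (ψ : ℝ) :
    Real.cosh (2 * axisDist m₁ m₂ ψ) = (m₁ + m₂ * Real.cosh (2 * ψ)) / massSum m₁ m₂ ψ := by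
  have hN := massSum_pos hm₁ hm₂ ψ
  have hN2 := sq_massSum_cosh hm₁ hm₂ ψ
  have hc := Real.cosh_pos (2 * ψ)
  refine (pow_left_inj₀ (Real.cosh_pos _).le (by positivity) two_ne_zero).mp ?_
  rw [Real.cosh_sq, sinh_two_mul_axisDist, div_pow, div_pow, hN2, mul_pow, Real.sinh_sq]
  rw [← hN2]
  field_simp
  rw [hN2]
  ring

/-- In exponential form, `N e^{2ρ₁} = m₁ + m₂ e^{2ψ}` and symmetrically for `ρ₂`. The addition
formula then gives `sinh (2ρ₁ + 2ρ₂) = sinh 2ψ`, and `sinh` is injective. -/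
theorem axisDist_add (hm₁ : 0 < m₁) (hm₂ : 0 < m₂) (ψ : ℝ) :
    axisDist m₁ m₂ ψ + axisDist m₂ m₁ ψ = ψ := by
  have hN := massSum_pos hm₁ hm₂ ψ
  have hN2 := sq_massSum_cosh hm₁ hm₂ ψ
  have h : Real.sinh (2 * axisDist m₁ m₂ ψ + 2 * axisDist m₂ m₁ ψ) = Real.sinh (2 * ψ) := by
    rw [Real.sinh_add, sinh_two_mul_axisDist, sinh_two_mul_axisDist,
      cosh_two_mul_axisDist hm₁ hm₂, cosh_two_mul_axisDist hm₂ hm₁, massSum_comm m₂ m₁]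
    field_simp
    rw [hN2]
    ring
  have := Real.sinh_injective h
  linarith

theorem mul_sinh_axisDist (m₁ m₂ ψ : ℝ) :
    m₁ * Real.sinh (2 * axisDist m₁ m₂ ψ) = m₂ * Real.sinh (2 * axisDist m₂ m₁ ψ) := by
  rw [sinh_two_mul_axisDist, sinh_two_mul_axisDist, massSum_comm m₂ m₁]; ring

theorem massSum_eq_cosh (hm₁ : 0 < m₁) (hm₂ : 0 < m₂) (ψ : ℝ) :
    m₁ * Real.cosh (2 * axisDist m₁ m₂ ψ) + m₂ * Real.cosh (2 * axisDist m₂ m₁ ψ) =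
      massSum m₁ m₂ ψ := by
  have hN := massSum_pos hm₁ hm₂ ψ
  have hN2 := sq_massSum_cosh hm₁ hm₂ ψ
  rw [cosh_two_mul_axisDist hm₁ hm₂, cosh_two_mul_axisDist hm₂ hm₁, massSum_comm m₂ m₁]
  field_simp
  rw [hN2]
  ring

/-- The balance of the gravitational force and the inertia. -/
theorem balance (hm₁ : 0 < m₁) (hm₂ : 0 < m₂) {ψ : ℝ} (hψ : 0 < ψ) :
    m₁ * (4 * sqSpeed m₁ m₂ ψ) * (Real.sinh (axisDist m₁ m₂ ψ) * Real.cosh (axisDist m₁ m₂ ψ)) =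
      force m₁ m₂ (Real.cosh ψ) * Real.sinh ψ := by
  have hN := massSum_pos hm₁ hm₂ ψ
  have h2 := Real.sinh_pos_iff.mpr hψ
  have h3 := Real.cosh_pos ψ
  have h := sinh_two_mul_axisDist m₁ m₂ ψ
  rw [Real.sinh_two_mul, Real.sinh_two_mul] at h
  have h' : Real.sinh (axisDist m₁ m₂ ψ) * Real.cosh (axisDist m₁ m₂ ψ) =
    m₂ * (Real.sinh ψ * Real.cosh ψ) / massSum m₁ m₂ ψ := by
      linear_combination h / 2
  rw [h', force_cosh m₁ m₂ hψ, sqSpeed]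
  field_simp

theorem force_comm (m₁ m₂ z : ℝ) : force m₁ m₂ z = force m₂ m₁ z := by
  unfold force
  congr 1
  funext z
  simp only [potential, mul_comm]

/-- Positions, speeds and separation determine each other. -/
theorem axisDist_unique (hm₁ : 0 < m₁) (hm₂ : 0 < m₂) {ψ R ρ₁ ρ₂ : ℝ} (hψ : 0 < ψ) (hR : 0 < R)
    (hρ : 0 < ρ₁) (hz : Real.cosh (ρ₁ + ρ₂) = Real.cosh ψ)
    (e₁ : m₁ * (4 * R) * (Real.sinh ρ₁ * Real.cosh ρ₁) =
      force m₁ m₂ (Real.cosh ψ) * Real.sinh (ρ₁ + ρ₂))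
    (e₂ : m₂ * (4 * R) * (Real.sinh ρ₂ * Real.cosh ρ₂) =
      force m₁ m₂ (Real.cosh ψ) * Real.sinh (ρ₁ + ρ₂)) :
    ρ₁ = axisDist m₁ m₂ ψ ∧ ρ₂ = axisDist m₂ m₁ ψ ∧ R = sqSpeed m₁ m₂ ψ := by
  have hf : 0 < force m₁ m₂ (Real.cosh ψ) := by
    rw [force_cosh m₁ m₂ hψ]
    have := Real.sinh_pos_iff.mpr hψ
    positivity
  have hs1 := Real.sinh_pos_iff.mpr hρ
  have hpos : 0 < Real.sinh (ρ₁ + ρ₂) := by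
    refine pos_of_mul_pos_right (e₁ ▸ ?_) hf.le
    have := Real.cosh_pos ρ₁
    positivity
  -- The equality of hyperbolic cosines fixes the sum only up to sign; the force balance for the
  -- first particle makes it positive.
  have hsum : ρ₁ + ρ₂ = ψ := by
    have h1 := Real.sinh_pos_iff.mp hpos
    exact Real.cosh_strictMonoOn.injOn (Set.mem_Ici.mpr h1.le) (Set.mem_Ici.mpr hψ.le) hz
  have hS : m₁ * Real.sinh (2 * ρ₁) = m₂ * Real.sinh (2 * ρ₂) := by
    rw [Real.sinh_two_mul, Real.sinh_two_mul]
    have : 4 * R * (m₁ * (Real.sinh ρ₁ * Real.cosh ρ₁) - m₂ * (Real.sinh ρ₂ * Real.cosh ρ₂)) = 0 := by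
      linear_combination e₁ - e₂
    have := (mul_eq_zero.mp this).resolve_left (by positivity)
    linear_combination 2 * this
  have hch : Real.cosh (2 * ψ) = Real.cosh (2 * ρ₁) * Real.cosh (2 * ρ₂) +
      Real.sinh (2 * ρ₁) * Real.sinh (2 * ρ₂) := by
    rw [← Real.cosh_add, ← mul_add, hsum]
  have hsh : Real.sinh (2 * ψ) = Real.sinh (2 * ρ₁) * Real.cosh (2 * ρ₂) +
      Real.cosh (2 * ρ₁) * Real.sinh (2 * ρ₂) := by
    rw [← Real.sinh_add, ← mul_add, hsum]
  have hN := massSum_pos hm₁ hm₂ ψ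
  -- The squares agree because `m₁ sinh 2ρ₁ = m₂ sinh 2ρ₂`. Then `N sinh 2ρ₁ = m₂ sinh 2ψ`, which
  -- determines `ρ₁`.
  have hNe : m₁ * Real.cosh (2 * ρ₁) + m₂ * Real.cosh (2 * ρ₂) = massSum m₁ m₂ ψ := by
    have c1 := Real.cosh_pos (2 * ρ₁)
    have c2 := Real.cosh_pos (2 * ρ₂)
    refine (pow_left_inj₀ (by positivity) hN.le two_ne_zero).mp ?_
    rw [sq_massSum_cosh hm₁ hm₂, hch]
    linear_combination m₁ ^ 2 * Real.cosh_sq (2 * ρ₁) + m₂ ^ 2 * Real.cosh_sq (2 * ρ₂) +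
      (m₁ * Real.sinh (2 * ρ₁) - m₂ * Real.sinh (2 * ρ₂)) * hS
  have r1 : ρ₁ = axisDist m₁ m₂ ψ := by
    have : m₂ * Real.sinh (2 * ψ) / massSum m₁ m₂ ψ = Real.sinh (2 * ρ₁) := by
      rw [div_eq_iff hN.ne', ← hNe, hsh]
      linear_combination (-Real.cosh (2 * ρ₁)) * hS
    rw [axisDist, this, Real.arsinh_sinh]; ring
  have r2 : ρ₂ = axisDist m₂ m₁ ψ := by
    have := axisDist_add hm₁ hm₂ ψ
    linarith
  refine ⟨r1, r2, ?_⟩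
  have hb := balance hm₁ hm₂ hψ
  rw [hsum] at e₁
  rw [← hb, ← r1] at e₁
  have hc1 := Real.cosh_pos ρ₁
  have h0 : m₁ * 4 * (Real.sinh ρ₁ * Real.cosh ρ₁) ≠ 0 := by positivity
  refine mul_left_cancel₀ h0 ?_
  linear_combination e₁

/-! ### The family of normal forms. -/

/-- The eigenvalue of the generator with phase `θ` at separation `ψ`. -/
def eigenvalue (m₁ m₂ θ ψ : ℝ) : ℂ := (√(sqSpeed m₁ m₂ ψ) : ℂ) * Complex.exp (θ * Complex.I)

/-- The relative equilibrium in normal form with phase `θ` and separation `ψ`. -/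
def relEq (m₁ m₂ : ℝ) (a : ℝ × ℝ) : State :=
  stateOf m₁ m₂ (gen (eigenvalue m₁ m₂ a.1 a.2)) (axisPoint (axisDist m₁ m₂ a.2))
    (axisPoint (-axisDist m₂ m₁ a.2))

theorem normSq_exp_mul_I (r θ : ℝ) :
    Complex.normSq ((r : ℂ) * Complex.exp (θ * Complex.I)) = r ^ 2 := by
  rw [Complex.normSq_mul, Complex.normSq_ofReal, Complex.normSq_eq_norm_sq,
    Complex.norm_exp_ofReal_mul_I]
  ring

theorem normSq_eigenvalue (hm₁ : 0 < m₁) (hm₂ : 0 < m₂) (θ : ℝ) {ψ : ℝ} (hψ : 0 < ψ) :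
    Complex.normSq (eigenvalue m₁ m₂ θ ψ) = sqSpeed m₁ m₂ ψ := by
  rw [eigenvalue, normSq_exp_mul_I, Real.sq_sqrt (sqSpeed_pos hm₁ hm₂ hψ).le]

theorem coshSep_relEq (hm₁ : 0 < m₁) (hm₂ : 0 < m₂) (θ ψ : ℝ) :
    coshSep (relEq m₁ m₂ (θ, ψ)) = Real.cosh ψ := by
  have h := bil_axisPoint (axisDist m₁ m₂ ψ) (axisDist m₂ m₁ ψ)
  rw [axisDist_add hm₁ hm₂] at h
  exact (congrArg Complex.re h).trans (Complex.ofReal_re _)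

theorem relEq_mem_phaseSpace (hm₁ : 0 < m₁) (hm₂ : 0 < m₂) (θ : ℝ) {ψ : ℝ} (hψ : 0 < ψ) :
    relEq m₁ m₂ (θ, ψ) ∈ phaseSpace :=
  stateOf_mem_phaseSpace_axis _ (by rwa [axisDist_add hm₁ hm₂])

/-- The momentum equation at a pair of points on opposite sides of the axis. -/
theorem momentum_equation_axisPoint {m f R ρ σ ψ : ℝ} {η : ℂ} (hm : m ≠ 0)
    (hη : Complex.normSq η = R) (h : m * (4 * R) * (Real.sinh ρ * Real.cosh ρ) = f * Real.sinh ψ)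
    (hs : ρ + σ = ψ) :
    -f • (axisPoint (-σ) - Real.cosh ψ • axisPoint ρ) +
        ((-m • infConj (gen η) (axisPoint ρ)).det.re / m) • axisPoint ρ =
      infConj (gen η) (-m • infConj (gen η) (axisPoint ρ)) := by
  have hσ : σ = ψ - ρ := by linarith
  have hc := Real.cosh_sq ρ
  have hC : Real.cosh σ = Real.cosh ψ * Real.cosh ρ - Real.sinh ψ * Real.sinh ρ := by
    rw [hσ, Real.cosh_sub]
  have hS : Real.sinh σ = Real.sinh ψ * Real.cosh ρ - Real.cosh ψ * Real.sinh ρ := by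
    rw [hσ, Real.sinh_sub]
  unfold axisPoint
  have hd : Real.cosh ρ * Real.cosh ρ - Complex.normSq (Real.sinh ρ : ℂ) = 1 := by
    rw [Complex.normSq_ofReal]; linear_combination hc
  rw [momentum_equation_iff hm f _ η hd, hη, Complex.normSq_ofReal, Real.cosh_neg, Real.sinh_neg]
  refine ⟨?_, ?_, ?_⟩
  · rw [hC]; linear_combination Real.sinh ρ * h
  · rw [hC]; linear_combination Real.sinh ρ * h
  · norm_cast
    rw [hS]; linear_combination Real.cosh ρ * h

theorem hamiltonianField_relEq (hm₁ : 0 < m₁) (hm₂ : 0 < m₂) (θ : ℝ) {ψ : ℝ} (hψ : 0 < ψ) :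
    hamiltonianField m₁ m₂ (relEq m₁ m₂ (θ, ψ)) =
      infAct (gen (eigenvalue m₁ m₂ θ ψ)) (relEq m₁ m₂ (θ, ψ)) := by
  rw [hamiltonianField_eq_infAct_iff hm₁.ne' hm₂.ne', coshSep_relEq hm₁ hm₂]
  refine ⟨rfl, ?_, ?_⟩
  · exact momentum_equation_axisPoint hm₁.ne' (normSq_eigenvalue hm₁ hm₂ θ hψ)
      (balance hm₁ hm₂ hψ) (axisDist_add hm₁ hm₂ ψ)
  -- The second particle satisfies the same equation reflected in the axis, so all signed distances,
  -- the separation included, change sign.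
  · have h := momentum_equation_axisPoint (ρ := -axisDist m₂ m₁ ψ) (σ := -axisDist m₁ m₂ ψ)
      (ψ := -ψ) hm₂.ne' (normSq_eigenvalue hm₁ hm₂ θ hψ) (f := force m₁ m₂ (Real.cosh ψ)) (by
        have := balance hm₂ hm₁ hψ
        rw [force_comm, sqSpeed_comm] at this
        rw [Real.sinh_neg, Real.sinh_neg, Real.cosh_neg]
        linear_combination -this) (by linarith [axisDist_add hm₁ hm₂ ψ])
    rw [Real.cosh_neg, neg_neg] at h
    exact h

theorem isRelEquilibrium_relEq (hm₁ : 0 < m₁) (hm₂ : 0 < m₂) (θ : ℝ) {ψ : ℝ} (hψ : 0 < ψ) :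
    IsRelEquilibriumWith m₁ m₂ (relEq m₁ m₂ (θ, ψ)) (gen (eigenvalue m₁ m₂ θ ψ)) θ ψ := by
  refine ⟨(isRelEquilibrium_iff _ _ _ _).mpr ⟨relEq_mem_phaseSpace hm₁ hm₂ θ hψ, trace_gen _,
    hamiltonianField_relEq hm₁ hm₂ θ hψ⟩, ⟨√(sqSpeed m₁ m₂ ψ),
    Real.sqrt_pos.mpr (sqSpeed_pos hm₁ hm₂ hψ), 1, Matrix.det_one, ?_⟩, hψ, ?_⟩
  · rw [inv_one, one_mul, mul_one]; rfl
  · have h := bil_axisPoint (axisDist m₁ m₂ ψ) (axisDist m₂ m₁ ψ)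
    rwa [axisDist_add hm₁ hm₂] at h

/-! #### Energy and Casimir -/

theorem eigenvalue_eq (m₁ m₂ θ ψ : ℝ) : eigenvalue m₁ m₂ θ ψ =
    ⟨√(sqSpeed m₁ m₂ ψ) * Real.cos θ, √(sqSpeed m₁ m₂ ψ) * Real.sin θ⟩ := by
  rw [eigenvalue]
  apply Complex.ext <;> simp [Complex.exp_ofReal_mul_I_re, Complex.exp_ofReal_mul_I_im]

theorem det_momentum_axisPoint (m : ℝ) (η : ℂ) (ρ : ℝ) :
    (-m • infConj (gen η) (axisPoint ρ)).det.re =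
      -(m ^ 2 * (4 * (η.re ^ 2 * Real.cosh ρ ^ 2 + η.im ^ 2 * Real.sinh ρ ^ 2))) := by
  rw [axisPoint, infConj_gen_herm, smul_herm, det_herm, Complex.ofReal_re, Complex.normSq_apply]
  simp only [Complex.mul_re, Complex.mul_im, Complex.ofReal_re, Complex.ofReal_im, Complex.re_ofNat,
    Complex.im_ofNat, Complex.I_re, Complex.I_im]
  ring

/-- A particle at distance `ρ` from the axis has kinetic energy `m R (cosh 2ρ + cos 2θ)`, and `m₁
cosh 2ρ₁ + m₂ cosh 2ρ₂ = N`. -/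
theorem hamiltonian_relEq (hm₁ : 0 < m₁) (hm₂ : 0 < m₂) (θ : ℝ) {ψ : ℝ} (hψ : 0 < ψ) :
    hamiltonian m₁ m₂ (relEq m₁ m₂ (θ, ψ)) = (diagram m₁ m₂ (θ, ψ)).1 := by
  have h1 := det_momentum_axisPoint m₁ (eigenvalue m₁ m₂ θ ψ) (axisDist m₁ m₂ ψ)
  have h2 := det_momentum_axisPoint m₂ (eigenvalue m₁ m₂ θ ψ) (-axisDist m₂ m₁ ψ)
  have hN := massSum_eq_cosh hm₁ hm₂ ψ
  have hV : potential m₁ m₂ (Real.cosh ψ) = -(m₁ * m₂) * (Real.cosh ψ / Real.sinh ψ) := by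
    rw [potential, Real.cosh_sq, add_sub_cancel_right,
      Real.sqrt_sq (Real.sinh_pos_iff.mpr hψ).le]
  have hr := Real.sq_sqrt (sqSpeed_pos hm₁ hm₂ hψ).le
  rw [hamiltonian, coshSep_relEq hm₁ hm₂, hV]
  simp only [relEq, stateOf, State.p₁, State.p₂, h1, h2, diagram]
  rw [← hN, eigenvalue_eq]
  simp only [mul_pow, hr, Real.cosh_neg, Real.sinh_neg, Real.cosh_two_mul, Real.cos_two_mul']
  have hone := Real.sin_sq_add_cos_sq θ
  have c1 := Real.cosh_sq (axisDist m₁ m₂ ψ)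
  have c2 := Real.cosh_sq (axisDist m₂ m₁ ψ)
  field_simp
  simp only [c1, c2]
  have hs : Real.sin θ ^ 2 = 1 - Real.cos θ ^ 2 := by linarith
  rw [hs]
  ring

theorem momentum_mul_adjugate (m : ℝ) (η : ℂ) (ρ : ℝ) :
    (-m • infConj (gen η) (axisPoint ρ)) * (axisPoint ρ).adjugate =
      !![-((m : ℂ) * η + (m * Real.cosh (2 * ρ) : ℝ) * star η),
          (m * Real.sinh (2 * ρ) : ℝ) * star η;
        -((m * Real.sinh (2 * ρ) : ℝ) * star η),
          (m : ℂ) * η + (m * Real.cosh (2 * ρ) : ℝ) * star η] := by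
  have hc := Real.cosh_sq ρ
  rw [axisPoint, infConj_gen_herm, smul_herm, herm, herm, Matrix.adjugate_fin_two_of,
    Real.cosh_two_mul, Real.sinh_two_mul, Matrix.mul_fin_two]
  generalize Real.cosh ρ = c at hc
  generalize Real.sinh ρ = s at hc
  ext i j
  fin_cases i <;> fin_cases j <;> apply Complex.ext <;> simp [-Complex.ofReal_pow] <;>
    first
    | ring1
    | linear_combination (-m * η.re) * hc
    | linear_combination (m * η.re) * hc
    | linear_combination (-m * η.im) * hc
    | linear_combination (m * η.im) * hc

/-- The off-diagonal entries of the two momenta cancel because `m₁ sinh 2ρ₁ = m₂ sinh 2ρ₂` and the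
particles are on opposite sides. The total momentum is therefore diagonal with entries `∓ √R w`. -/
theorem casimir_relEq (hm₁ : 0 < m₁) (hm₂ : 0 < m₂) (θ : ℝ) {ψ : ℝ} (hψ : 0 < ψ) :
    casimir (relEq m₁ m₂ (θ, ψ)) = (diagram m₁ m₂ (θ, ψ)).2 := by
  have hN := massSum_eq_cosh hm₁ hm₂ ψ
  have hS := mul_sinh_axisDist m₁ m₂ ψ
  have hr := Real.sq_sqrt (sqSpeed_pos hm₁ hm₂ hψ).le
  rw [casimir, totalMomentum]
  simp only [relEq, stateOf, State.q₁, State.p₁, State.q₂, State.p₂, momentum_mul_adjugate,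
    diagram]
  rw [mul_neg, Real.cosh_neg, Real.sinh_neg, mul_neg, ← hS, Matrix.det_fin_two]
  simp only [Matrix.add_apply, Matrix.of_apply, Matrix.cons_val', Matrix.cons_val_zero,
    Matrix.cons_val_one, Matrix.cons_val_fin_one]
  have hw : (m₁ : ℂ) * eigenvalue m₁ m₂ θ ψ + (m₁ * Real.cosh (2 * axisDist m₁ m₂ ψ) : ℝ) *
      star (eigenvalue m₁ m₂ θ ψ) + (m₂ * eigenvalue m₁ m₂ θ ψ +
      (m₂ * Real.cosh (2 * axisDist m₂ m₁ ψ) : ℝ) * star (eigenvalue m₁ m₂ θ ψ)) =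
      (√(sqSpeed m₁ m₂ ψ) : ℂ) * momentum m₁ m₂ θ ψ := by
    rw [eigenvalue_eq, momentum, ← hN]
    apply Complex.ext <;> simp [-Complex.ofReal_cosh] <;> ring
  have hr' : (√(sqSpeed m₁ m₂ ψ) : ℂ) ^ 2 = (sqSpeed m₁ m₂ ψ : ℂ) := by exact_mod_cast hr
  rw [← hr', ← mul_pow, ← hw]
  push_cast
  ring

theorem energyCasimir_relEq (hm₁ : 0 < m₁) (hm₂ : 0 < m₂) (θ : ℝ) {ψ : ℝ} (hψ : 0 < ψ) :
    energyCasimir m₁ m₂ (relEq m₁ m₂ (θ, ψ)) = diagram m₁ m₂ (θ, ψ) :=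
  Prod.ext (hamiltonian_relEq hm₁ hm₂ θ hψ) (casimir_relEq hm₁ hm₂ θ hψ)

/-! #### Classification -/

theorem conj_herm_diag {u v : ℂ} (a : ℝ) (b : ℂ) (d : ℝ) :
    conj !![u, 0; 0, v] (herm a b d) =
      herm (Complex.normSq u * a) (u * star v * b) (Complex.normSq v * d) := by
  ext i j
  fin_cases i <;> fin_cases j <;> apply Complex.ext <;>
    simp [conj, herm, Matrix.mul_apply, Fin.sum_univ_two, Matrix.conjTranspose_apply,
      Complex.normSq_apply] <;> ring

/-- Every Hermitian matrix with positive diagonal and nonzero off-diagonal entries can be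
balanced by a diagonal matrix of determinant one. -/
theorem exists_diag_balance {a d : ℝ} {b : ℂ} (ha : 0 < a) (hd : 0 < d) (hb : b ≠ 0) :
    ∃ u v : ℂ, u * v = 1 ∧ ∃ c s : ℝ, 0 < s ∧
      conj !![u, 0; 0, v] (herm a b d) = herm c (s : ℂ) c := by
  -- With `|u| = s` and `|v| = s⁻¹`, the diagonal entries become `s² a` and `d / s²`, equal when `s⁴
  -- = d / a`; splitting the argument of `b` evenly between `u` and `v` makes the off-diagonal entry
  -- `|b|`.
  set s := √√(d / a) with hs
  have hda : 0 < d / a := div_pos hd ha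
  have hs0 : 0 < s := Real.sqrt_pos.mpr (Real.sqrt_pos.mpr hda)
  have hs4 : s ^ 4 = d / a := by
    rw [show s ^ 4 = (s ^ 2) ^ 2 by ring, hs, Real.sq_sqrt (Real.sqrt_nonneg _),
      Real.sq_sqrt hda.le]
  have hsC : (s : ℂ) ≠ 0 := by exact_mod_cast hs0.ne'
  refine ⟨s * Complex.exp ((-(Complex.arg b) / 2 : ℝ) * Complex.I),
    (s⁻¹ : ℝ) * Complex.exp ((Complex.arg b / 2 : ℝ) * Complex.I), ?_, s ^ 2 * a, ‖b‖,
    norm_pos_iff.mpr hb, ?_⟩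
  · rw [mul_mul_mul_comm, ← Complex.exp_add]
    push_cast
    rw [mul_inv_cancel₀ hsC]
    ring_nf
    simp
  · rw [conj_herm_diag, herm_inj, normSq_exp_mul_I, normSq_exp_mul_I]
    refine ⟨rfl, ?_, ?_⟩
    · rw [eq_div_iff ha.ne'] at hs4
      field_simp
      linear_combination -hs4
    · have h := Complex.norm_mul_exp_arg_mul_I b
      nth_rewrite 3 [← h]
      have hst : star (((s⁻¹ : ℝ) : ℂ) * Complex.exp ((Complex.arg b / 2 : ℝ) * Complex.I)) =
          ((s⁻¹ : ℝ) : ℂ) * Complex.exp ((-(Complex.arg b) / 2 : ℝ) * Complex.I) := by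
        rw [star_mul', Complex.star_def, Complex.conj_ofReal, ← Complex.exp_conj,
          map_mul, Complex.conj_I, Complex.conj_ofReal]
        congr 2
        push_cast
        ring
      rw [hst]
      have he : Complex.exp ((-(Complex.arg b) / 2 : ℝ) * Complex.I) *
          Complex.exp ((-(Complex.arg b) / 2 : ℝ) * Complex.I) *
          Complex.exp (Complex.arg b * Complex.I) = 1 := by
        rw [← Complex.exp_add, ← Complex.exp_add, Complex.exp_eq_one_iff]
        refine ⟨0, ?_⟩
        push_cast
        ring
      have hss : (s : ℂ) * ((s⁻¹ : ℝ) : ℂ) = 1 := by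
        push_cast
        rw [mul_inv_cancel₀ hsC]
      linear_combination ((‖b‖ : ℂ) * (s : ℂ) * ((s⁻¹ : ℝ) : ℂ)) * he + (‖b‖ : ℂ) * hss

/-- The equations of a relative equilibrium in a frame diagonalising the generator. -/
theorem equations_of_gen (hm₁ : m₁ ≠ 0) (hm₂ : m₂ ≠ 0) {η : ℂ} {x : State}
    (hx : x ∈ phaseSpace) (h : hamiltonianField m₁ m₂ x = infAct (gen η) x) :
    ∃ (a₁ d₁ a₂ d₂ : ℝ) (b₁ b₂ : ℂ), x = stateOf m₁ m₂ (gen η) (herm a₁ b₁ d₁) (herm a₂ b₂ d₂) ∧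
      0 < a₁ ∧ 0 < d₁ ∧ 0 < a₂ ∧ 0 < d₂ ∧
      a₁ * d₁ - Complex.normSq b₁ = 1 ∧ a₂ * d₂ - Complex.normSq b₂ = 1 ∧
      (m₁ * (4 * Complex.normSq η) * Complex.normSq b₁ * a₁ =
          force m₁ m₂ (coshSep x) * (coshSep x * a₁ - a₂) ∧
        m₁ * (4 * Complex.normSq η) * Complex.normSq b₁ * d₁ =
          force m₁ m₂ (coshSep x) * (coshSep x * d₁ - d₂) ∧
        m₁ * (4 * Complex.normSq η) * (a₁ * d₁) * b₁ =
          force m₁ m₂ (coshSep x) * (coshSep x * b₁ - b₂)) ∧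
      (m₂ * (4 * Complex.normSq η) * Complex.normSq b₂ * a₂ =
          force m₁ m₂ (coshSep x) * (coshSep x * a₂ - a₁) ∧
        m₂ * (4 * Complex.normSq η) * Complex.normSq b₂ * d₂ =
          force m₁ m₂ (coshSep x) * (coshSep x * d₂ - d₁) ∧
        m₂ * (4 * Complex.normSq η) * (a₂ * d₂) * b₂ =
          force m₁ m₂ (coshSep x) * (coshSep x * b₂ - b₁)) := by
  obtain ⟨e0, e1, e2⟩ := (hamiltonianField_eq_infAct_iff hm₁ hm₂ _ _).mp h
  rw [mem_phaseSpace_iff] at hx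
  obtain ⟨⟨h1, D1, t1⟩, -, -, ⟨h2, D2, t2⟩, -, -, -⟩ := hx
  have pos : ∀ {a d : ℝ} {b : ℂ}, (herm a b d).det = 1 → 0 < (herm a b d).trace.re →
      0 < a ∧ 0 < d ∧ a * d - Complex.normSq b = 1 := by
    intro a d b hD ht
    have hD' := hD
    rw [det_herm] at hD'
    have hD2 : a * d - Complex.normSq b = 1 := by exact_mod_cast hD'
    have ha := (trace_pos_of_isHermitian (isHermitian_herm a b d) hD).mp ht
    have ha' : 0 < a := by simpa [herm] using ha
    refine ⟨ha', pos_of_mul_pos_right ?_ ha'.le, hD2⟩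
    have := Complex.normSq_nonneg b
    linarith
  generalize coshSep x = z at *
  obtain ⟨q1, p1, q2, p2⟩ := x
  simp only [State.q₁, State.p₁, State.q₂, State.p₂] at *
  obtain ⟨a₁, b₁, d₁, rfl⟩ := exists_eq_herm h1
  obtain ⟨a₂, b₂, d₂, rfl⟩ := exists_eq_herm h2
  simp only [stateOf, Prod.mk.injEq, true_and] at e0
  obtain ⟨rfl, rfl⟩ := e0
  obtain ⟨x1, x2, x3⟩ := pos D1 t1
  obtain ⟨y1, y2, y3⟩ := pos D2 t2
  exact ⟨a₁, d₁, a₂, d₂, b₁, b₂, rfl, x1, x2, y1, y2, x3, y3,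
    (momentum_equation_iff hm₁ _ _ _ x3).mp e1, (momentum_equation_iff hm₂ _ _ _ y3).mp e2⟩

theorem axisPoint_arsinh {c s : ℝ} (hc : 0 < c) (h : c * c - Complex.normSq (s : ℂ) = 1) :
    herm c (s : ℂ) c = axisPoint (Real.arsinh s) ∧ c = Real.cosh (Real.arsinh s) := by
  rw [Complex.normSq_ofReal] at h
  have : c = Real.cosh (Real.arsinh s) := by
    rw [Real.cosh_arsinh, eq_comm, Real.sqrt_eq_iff_mul_self_eq (by positivity) hc.le]
    linarith
  refine ⟨?_, this⟩
  rw [axisPoint, Real.sinh_arsinh, ← this]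

/-- Classification of relative equilibria once the first particle is balanced. -/
theorem eq_relEq_of_balanced (hm₁ : 0 < m₁) (hm₂ : 0 < m₂) {θ ψ r c s : ℝ} (hψ : 0 < ψ)
    (hr : 0 < r) (hs : 0 < s) {x : State} (hx : x ∈ phaseSpace) (hz : coshSep x = Real.cosh ψ)
    (h : hamiltonianField m₁ m₂ x = infAct (gen ((r : ℂ) * Complex.exp (θ * Complex.I))) x)
    (hq : x.q₁ = herm c (s : ℂ) c) :
    x = relEq m₁ m₂ (θ, ψ) ∧ (r : ℂ) * Complex.exp (θ * Complex.I) = eigenvalue m₁ m₂ θ ψ := by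
  obtain ⟨a₁, d₁, a₂, d₂, b₁, b₂, hx', ha₁, hd₁, ha₂, hd₂, n₁, n₂, ⟨e1, e2, e3⟩, -, -, e6⟩ :=
    equations_of_gen hm₁.ne' hm₂.ne' hx h
  have hf : 0 < force m₁ m₂ (Real.cosh ψ) := by
    rw [force_cosh m₁ m₂ hψ]
    have := Real.sinh_pos_iff.mpr hψ
    positivity
  have hq' : herm a₁ b₁ d₁ = herm c (s : ℂ) c := by rw [← hq, hx']; rfl
  obtain ⟨rfl, rfl, rfl⟩ := herm_inj.mp hq'
  rw [hz] at e1 e2 e3 e6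
  rw [normSq_exp_mul_I] at e1 e2 e3 e6
  -- The equations for the first particle put the second one on the same geodesic orthogonal to the
  -- axis: its diagonal entries agree and its off-diagonal entry is real.
  have hda : d₂ = a₂ := by
    have : force m₁ m₂ (Real.cosh ψ) * (d₂ - a₂) = 0 := by linear_combination e2 - e1
    linarith [(mul_eq_zero.mp this).resolve_left hf.ne']
  subst hda
  have hb : ((b₂.re : ℝ) : ℂ) = b₂ := by
    have h3 := congrArg Complex.im e3
    norm_cast at h3
    simp [-Complex.ofReal_cosh, hf.ne'] at h3
    apply Complex.ext <;> simp [h3]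
  generalize b₂.re = t at hb
  subst hb
  obtain ⟨q1, c1⟩ := axisPoint_arsinh hd₁ n₁
  obtain ⟨q2, c2⟩ := axisPoint_arsinh hd₂ n₂
  set ρ₁ := Real.arsinh s with hρ₁
  set ρ₂ := Real.arsinh t with hρ₂
  have s1 : Real.sinh ρ₁ = s := Real.sinh_arsinh s
  have s2 : Real.sinh ρ₂ = t := Real.sinh_arsinh t
  have hzz : Real.cosh (ρ₁ + -ρ₂) = Real.cosh ψ := by
    have h5 : coshSep x = d₁ * d₂ - s * t := by
      rw [hx']
      refine (congrArg Complex.re (bil_herm _ _ _ _ _ _)).trans ?_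
      simp only [Complex.ofReal_re, Complex.ofReal_im]
      ring
    rw [← hz, h5, Real.cosh_add, Real.cosh_neg, Real.sinh_neg, s1, s2, ← c1, ← c2]
    ring
  have hsum : Real.sinh (ρ₁ + -ρ₂) = s * d₂ - d₁ * t := by
    rw [Real.sinh_add, Real.cosh_neg, Real.sinh_neg, s1, s2, ← c1, ← c2]; ring
  have hzv : Real.cosh ψ = d₁ * d₂ - s * t := by
    rw [← hzz, Real.cosh_add, Real.cosh_neg, Real.sinh_neg, s1, s2, ← c1, ← c2]; ring
  rw [Complex.normSq_ofReal] at n₁ n₂ e1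
  have e6' : m₂ * (4 * r ^ 2) * (d₂ * d₂) * t =
      force m₁ m₂ (Real.cosh ψ) * (Real.cosh ψ * t - s) := by exact_mod_cast e6
  obtain ⟨r1, r2, r3⟩ := axisDist_unique hm₁ hm₂ (ψ := ψ) (R := r ^ 2) (ρ₁ := ρ₁) (ρ₂ := -ρ₂) hψ
    (by positivity) (Real.arsinh_pos_iff.mpr hs) hzz
    (by
      refine mul_left_cancel₀ hs.ne' ?_
      rw [hsum, s1, ← c1]
      generalize force m₁ m₂ (Real.cosh ψ) = f at e1
      rw [hzv] at e1
      linear_combination e1 + f * d₂ * n₁)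
    (by
      refine mul_left_cancel₀ hd₂.ne' ?_
      rw [hsum, Real.sinh_neg, Real.cosh_neg, s2, ← c2]
      generalize force m₁ m₂ (Real.cosh ψ) = f at e6'
      rw [hzv] at e6'
      linear_combination -e6' - f * s * n₂)
  have hη : (r : ℂ) * Complex.exp (θ * Complex.I) = eigenvalue m₁ m₂ θ ψ := by
    rw [eigenvalue, ← r3, Real.sqrt_sq hr.le]
  refine ⟨?_, hη⟩
  rw [hx', q1, q2, hη, relEq, ← r1, ← r2, neg_neg]

/-- In a relative equilibrium no particle lies on the axis. -/
theorem offAxis (hm₁ : 0 < m₁) (hm₂ : 0 < m₂) {ψ : ℝ} (hψ : 0 < ψ) {η : ℂ} {x : State}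
    (hx : x ∈ phaseSpace) (hz : coshSep x = Real.cosh ψ)
    (h : hamiltonianField m₁ m₂ x = infAct (gen η) x) :
    ∃ (a d : ℝ) (b : ℂ), x.q₁ = herm a b d ∧ 0 < a ∧ 0 < d ∧ b ≠ 0 := by
  obtain ⟨a₁, d₁, a₂, d₂, b₁, b₂, hx', ha₁, hd₁, ha₂, hd₂, n₁, n₂, ⟨e1, -, e3⟩, e4, -, -⟩ :=
    equations_of_gen hm₁.ne' hm₂.ne' hx h
  refine ⟨a₁, d₁, b₁, by rw [hx']; rfl, ha₁, hd₁, ?_⟩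
  rintro rfl
  have hf : 0 < force m₁ m₂ (Real.cosh ψ) := by
    rw [force_cosh m₁ m₂ hψ]
    have := Real.sinh_pos_iff.mpr hψ
    positivity
  have hb : b₂ = 0 := by
    rw [hz] at e3
    have : (force m₁ m₂ (Real.cosh ψ) : ℂ) ≠ 0 := by exact_mod_cast hf.ne'
    simpa [this] using e3
  subst hb
  rw [hz] at e1 e4
  -- With both particles on the axis, `a₂ = z a₁` and `a₁ = z a₂`, which is impossible for positive
  -- entries and `z > 1`.
  simp only [map_zero, mul_zero, zero_mul, zero_eq_mul, hf.ne', false_or, sub_eq_zero] at e1 e4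
  have h1 := Real.one_lt_cosh.mpr hψ.ne'
  nlinarith

/-- Every relative equilibrium is conjugate to the normal form. -/
theorem exists_act_relEq (hm₁ : 0 < m₁) (hm₂ : 0 < m₂) {x : State} {ξ : Biquat} {θ ψ : ℝ}
    (hx : IsRelEquilibriumWith m₁ m₂ x ξ θ ψ) :
    ∃ g : Biquat, g.det = 1 ∧ x = act g (relEq m₁ m₂ (θ, ψ)) ∧
      ξ = g * gen (eigenvalue m₁ m₂ θ ψ) * g.adjugate := by
  obtain ⟨hre, ⟨r, hr, g, hg, hξ⟩, hψ, hz⟩ := hx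
  obtain ⟨hx, -, hf⟩ := (isRelEquilibrium_iff _ _ _ _).mp hre
  have hginv : g⁻¹ = g.adjugate := by rw [Matrix.inv_def, hg]; simp
  have hga : g * g.adjugate = 1 := by rw [Matrix.mul_adjugate, hg, one_smul]
  have hag : g.adjugate * g = 1 := by rw [Matrix.adjugate_mul, hg, one_smul]
  have hdet : g.adjugate.det = 1 := by rw [Matrix.det_adjugate, hg]; simp
  rw [hginv] at hξ
  change ξ = g * gen _ * g.adjugate at hξ
  set η := (r : ℂ) * Complex.exp (θ * Complex.I) with hη
  have hz' : coshSep x = Real.cosh ψ := (congrArg Complex.re hz).trans (Complex.ofReal_re _)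
  have hy := act_mem_phaseSpace hdet hx
  have hyz : coshSep (act g.adjugate x) = Real.cosh ψ := by rw [coshSep_act hdet, hz']
  have hyf : hamiltonianField m₁ m₂ (act g.adjugate x) = infAct (gen η) (act g.adjugate x) := by
    rw [hamiltonianField_act _ _ hdet, hf, ← infAct_act hga]
    congr 1
    rw [hξ]
    calc g.adjugate * (g * gen η * g.adjugate) * g
        = (g.adjugate * g) * gen η * (g.adjugate * g) := by simp only [mul_assoc]
      _ = gen η := by rw [hag, one_mul, mul_one]
  -- Once the generator is diagonal, its centraliser is still available: a diagonal `k` brings the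
  -- first particle to the standard position without changing the generator.
  obtain ⟨a, d, b, hq, ha, hd, hb⟩ := offAxis hm₁ hm₂ hψ hy hyz hyf
  obtain ⟨u, v, huv, c, s, hs, hbal⟩ := exists_diag_balance ha hd hb
  set k : Biquat := !![u, 0; 0, v] with hk
  have hkdet : k.det = 1 := by rw [hk, Matrix.det_fin_two_of]; simpa using huv
  have hka : k * k.adjugate = 1 := by rw [Matrix.mul_adjugate, hkdet, one_smul]
  have hak : k.adjugate * k = 1 := by rw [Matrix.adjugate_mul, hkdet, one_smul]
  have hcomm : k * gen η = gen η * k := by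
    rw [hk, gen, Matrix.mul_fin_two, Matrix.mul_fin_two]
    ext i j
    fin_cases i <;> fin_cases j <;> simp [mul_comm]
  have hcomm' : k * gen η * k.adjugate = gen η := by rw [hcomm, mul_assoc, hka, mul_one]
  have hcomm'' : k.adjugate * gen η * k = gen η := by
    rw [mul_assoc, ← hcomm, ← mul_assoc, hak, one_mul]
  obtain ⟨hfin, hηe⟩ := eq_relEq_of_balanced hm₁ hm₂ (θ := θ) (ψ := ψ) (r := r) (c := c) (s := s)
    (x := act k (act g.adjugate x)) hψ hr hs (act_mem_phaseSpace hkdet hy)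
    (by rw [coshSep_act hkdet, hyz])
    (by
      rw [hamiltonianField_act _ _ hkdet, hyf, ← infAct_act hak, hcomm'])
    (by rw [← hbal, ← hq]; rfl)
  refine ⟨g * k.adjugate, ?_, ?_, ?_⟩
  · rw [Matrix.det_mul, hg, Matrix.det_adjugate, hkdet]; simp
  · rw [← hfin, act_act, act_act]
    have : g * k.adjugate * (k * g.adjugate) = 1 := by
      rw [mul_assoc, ← mul_assoc k.adjugate, hak, one_mul, hga]
    rw [mul_assoc (g * k.adjugate), this, act_one]
  · rw [← hηe, ← hη, hξ, Matrix.adjugate_mul_distrib]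
    have hadj : k.adjugate.adjugate = k := by
      rw [Matrix.adjugate_adjugate _ (by simp), hkdet]; simp
    rw [hadj]
    calc g * gen η * g.adjugate = g * (k.adjugate * gen η * k) * g.adjugate := by rw [hcomm'']
      _ = _ := by simp only [mul_assoc]

/-! ### The family of relative equilibria -/

theorem gen_eq_smul (η : ℂ) : gen η = η • !![1, 0; 0, -1] := by
  ext i j
  fin_cases i <;> fin_cases j <;> simp [gen]

theorem hasDerivAt_gen {f : ℝ → ℂ} {f' : ℂ} {t : ℝ} (hf : HasDerivAt f f' t) :
    HasDerivAt (fun s => gen (f s)) (gen f') t := by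
  simp only [gen_eq_smul]
  exact hf.smul_const _

theorem axisPoint_eq (ρ : ℝ) :
    axisPoint ρ = Real.cosh ρ • (1 : Biquat) + Real.sinh ρ • !![0, 1; 1, 0] := by
  ext i j
  fin_cases i <;> fin_cases j <;> simp [axisPoint, herm, -Complex.ofReal_sinh, -Complex.ofReal_cosh]

theorem differentiable_axisPoint : Differentiable ℝ axisPoint := by
  rw [funext axisPoint_eq]
  exact (Real.differentiable_cosh.smul_const _).add (Real.differentiable_sinh.smul_const _)

theorem differentiable_axisDist (hm₁ : 0 < m₁) (hm₂ : 0 < m₂) :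
    Differentiable ℝ (axisDist m₁ m₂) := by
  intro ψ
  have hN := (hasDerivAt_massSum hm₁ hm₂ ψ).differentiableAt
  have hN0 := (massSum_pos hm₁ hm₂ ψ).ne'
  unfold axisDist
  refine DifferentiableAt.div_const (DifferentiableAt.arsinh ?_) _
  refine DifferentiableAt.div ?_ hN hN0
  fun_prop

theorem hasDerivAt_stateOf {ξ q₁ q₂ : ℝ → Biquat} {ξ' q₁' q₂' : Biquat} {t : ℝ}
    (hξ : HasDerivAt ξ ξ' t) (h₁ : HasDerivAt q₁ q₁' t) (h₂ : HasDerivAt q₂ q₂' t) :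
    HasDerivAt (fun s => stateOf m₁ m₂ (ξ s) (q₁ s) (q₂ s))
      (q₁', -m₁ • (infConj ξ' (q₁ t) + infConj (ξ t) q₁'),
        q₂', -m₂ • (infConj ξ' (q₂ t) + infConj (ξ t) q₂')) t :=
  h₁.prodMk <| ((hasDerivAt_infConj hξ h₁).const_smul (-m₁)).prodMk <|
    h₂.prodMk ((hasDerivAt_infConj hξ h₂).const_smul (-m₂))

theorem hasDerivAt_line (c a : ℝ) : HasDerivAt (fun t : ℝ => c + t * a) a 0 := by
  simpa using ((hasDerivAt_id (0 : ℝ)).mul_const a).const_add c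

/-- Only existence matters: the properties of these velocities come from differentiating identities
that hold along the family. -/
theorem exists_hasDerivAt_relEq (hm₁ : 0 < m₁) (hm₂ : 0 < m₂) (θ : ℝ) {ψ : ℝ} (hψ : 0 < ψ)
    (a b : ℝ) : ∃ (v : State) (η' : ℂ),
      HasDerivAt (fun t : ℝ => relEq m₁ m₂ (θ + t * a, ψ + t * b)) v 0 ∧
      HasDerivAt (fun t : ℝ => eigenvalue m₁ m₂ (θ + t * a) (ψ + t * b)) η' 0 := by
  have h1 := hasDerivAt_line θ a
  have h2 := hasDerivAt_line ψ b
  have hκ : DifferentiableAt ℝ (fun t : ℝ => sqSpeed m₁ m₂ (ψ + t * b)) 0 :=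
    DifferentiableAt.comp (0 : ℝ) (g := sqSpeed m₁ m₂)
      (by simpa using (hasDerivAt_sqSpeed hm₁ hm₂ hψ).differentiableAt) h2.differentiableAt
  have hr := (hκ.sqrt (by simpa using (sqSpeed_pos hm₁ hm₂ hψ).ne')).hasDerivAt.ofReal_comp
  have he := ((h1.ofReal_comp.mul_const Complex.I).cexp)
  have hη := hr.mul he
  have d1 := ((differentiable_axisPoint.comp (differentiable_axisDist hm₁ hm₂))
    (ψ + 0 * b)).hasDerivAt.scomp (0 : ℝ) h2
  have d2 := ((differentiable_axisPoint.comp (differentiable_axisDist hm₂ hm₁).neg)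
    (ψ + 0 * b)).hasDerivAt.scomp (0 : ℝ) h2
  exact ⟨_, _, hasDerivAt_stateOf (hasDerivAt_gen hη) d1 d2, hη⟩

/-- The positions depend on `ψ` alone, so changing the phase moves only the momenta. -/
theorem hasDerivAt_relEq_phase (m₁ m₂ θ ψ a : ℝ) :
    HasDerivAt (fun t : ℝ => relEq m₁ m₂ (θ + t * a, ψ))
      (0, -m₁ • infConj (gen (a * Complex.I * eigenvalue m₁ m₂ θ ψ))
          (axisPoint (axisDist m₁ m₂ ψ)),
        0, -m₂ • infConj (gen (a * Complex.I * eigenvalue m₁ m₂ θ ψ))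
          (axisPoint (-axisDist m₂ m₁ ψ))) 0 := by
  have h1 := hasDerivAt_line θ a
  have he := ((h1.ofReal_comp.mul_const Complex.I).cexp).const_mul (√(sqSpeed m₁ m₂ ψ) : ℂ)
  have h := hasDerivAt_stateOf (m₁ := m₁) (m₂ := m₂) (hasDerivAt_gen he)
    (hasDerivAt_const (0 : ℝ) (axisPoint (axisDist m₁ m₂ ψ)))
    (hasDerivAt_const (0 : ℝ) (axisPoint (-axisDist m₂ m₁ ψ)))
  refine h.congr_deriv ?_
  have e0 : ∀ ξ : Biquat, infConj ξ 0 = 0 := fun ξ => by simp [infConj]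
  simp only [e0, add_zero]
  have e : (√(sqSpeed m₁ m₂ ψ) : ℂ) * (Complex.exp (((θ + 0 * a : ℝ) : ℂ) * Complex.I) *
      ((a : ℂ) * Complex.I)) = a * Complex.I * eigenvalue m₁ m₂ θ ψ := by
    rw [eigenvalue, zero_mul, add_zero]; ring
  rw [e]

/-- Velocities of the family solve the linearised equations. -/
theorem linearisation_of_hasDerivAt (hm₁ : 0 < m₁) (hm₂ : 0 < m₂) {θ ψ a b : ℝ} (hψ : 0 < ψ)
    {v : State} {η' : ℂ}
    (hv : HasDerivAt (fun t : ℝ => relEq m₁ m₂ (θ + t * a, ψ + t * b)) v 0)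
    (hη : HasDerivAt (fun t : ℝ => eigenvalue m₁ m₂ (θ + t * a) (ψ + t * b)) η' 0) :
    v ∈ phaseTangent (relEq m₁ m₂ (θ, ψ)) ∧
    linearisation m₁ m₂ (relEq m₁ m₂ (θ, ψ)) (gen (eigenvalue m₁ m₂ θ ψ)) v =
      infAct (gen η') (relEq m₁ m₂ (θ, ψ)) ∧
    coshSepDeriv (relEq m₁ m₂ (θ, ψ)) v = b * Real.sinh ψ ∧
    fderiv ℝ casimir (relEq m₁ m₂ (θ, ψ)) v = (diagramDeriv m₁ m₂ θ ψ a b).2 := by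
  have h2 := hasDerivAt_line ψ b
  have hpos : ∀ᶠ t : ℝ in 𝓝 0, 0 < ψ + t * b :=
    h2.continuousAt.eventually_const_lt (by simpa using hψ)
  have hz : 1 < coshSep (relEq m₁ m₂ (θ + 0 * a, ψ + 0 * b)) := by
    rw [coshSep_relEq hm₁ hm₂]
    simpa using Real.one_lt_cosh.mpr (by simpa using hψ.ne')
  have e0 : relEq m₁ m₂ (θ + 0 * a, ψ + 0 * b) = relEq m₁ m₂ (θ, ψ) := by simp
  have e1 : eigenvalue m₁ m₂ (θ + 0 * a) (ψ + 0 * b) = eigenvalue m₁ m₂ θ ψ := by simp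
  refine ⟨?_, ?_, ?_, ?_⟩
  · have := mem_phaseTangent_of_hasDerivAt hv
      (hpos.mono fun t ht => relEq_mem_phaseSpace hm₁ hm₂ (θ + t * a) ht)
    rwa [e0] at this
  -- Differentiating `X_H = ξ_P` along the family: the part where the state varies belongs to the
  -- linearisation, and the varying generator leaves `infAct (gen η')`.
  · have h3 := hasDerivAt_hamiltonianField m₁ m₂ hv hz
    have h4 := hasDerivAt_infAct (hasDerivAt_gen hη) hv
    have h5 := h3.unique (h4.congr_of_eventuallyEq
      (hpos.mono fun t ht => hamiltonianField_relEq hm₁ hm₂ (θ + t * a) ht))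
    rw [e0, e1] at h5
    rw [e0] at hz
    rw [linearisation_apply m₁ m₂ hz, h5, add_sub_cancel_right]
  · have h3 := hasDerivAt_coshSep hv
    simp only [coshSep_relEq hm₁ hm₂] at h3
    have h4 := h3.unique h2.cosh
    rw [e0] at h4
    rw [h4]
    simp [mul_comm]
  · have h3 : HasDerivAt (fun t : ℝ => casimir (relEq m₁ m₂ (θ + t * a, ψ + t * b)))
        (fderiv ℝ casimir (relEq m₁ m₂ (θ + 0 * a, ψ + 0 * b)) v) 0 :=
      (differentiable_casimir _).hasFDerivAt.comp_hasDerivAt (0 : ℝ) hv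
    have h4 := hasDerivAt_snd (hasDerivAt_diagram hm₁ hm₂ (hasDerivAt_line θ a) h2
      (by simpa using hψ))
    have h5 := h3.unique (h4.congr_of_eventuallyEq
      (hpos.mono fun t ht => casimir_relEq hm₁ hm₂ (θ + t * a) ht))
    rw [e0] at h5
    simpa using h5

/-- The velocity of the family in the kernel direction is the null vector. It preserves the Casimir
to first order but changes the separation, so it is not tangent to the orbit. -/
theorem isDegenerate_relEq_of_jacobian (hm₁ : 0 < m₁) (hm₂ : 0 < m₂) {θ ψ : ℝ} (hψ : 0 < ψ)
    (h : jacobian m₁ m₂ θ ψ = 0) :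
    IsDegenerate m₁ m₂ (relEq m₁ m₂ (θ, ψ)) (gen (eigenvalue m₁ m₂ θ ψ)) := by
  obtain ⟨v, η', hv, hη⟩ := exists_hasDerivAt_relEq hm₁ hm₂ θ hψ (kernelDir m₁ m₂ θ ψ) 1
  obtain ⟨h1, h2, h3, h4⟩ := linearisation_of_hasDerivAt hm₁ hm₂ hψ hv hη
  refine ⟨v, ⟨h1, ?_⟩, ?_, gen η', trace_gen _, h2⟩
  · rw [h4, diagramDeriv_fst_eq_zero (velocity_kernelDir hm₁ hm₂ hψ h)]
    rfl
  · rintro ⟨χ, hχ, rfl⟩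
    rw [coshSepDeriv_infAct hχ] at h3
    have := Real.sinh_pos_iff.mpr hψ
    linarith

/-! ### Rigidity of the linearised equations -/

theorem neg_herm (a : ℝ) (b : ℂ) (d : ℝ) : -herm a b d = herm (-a) (-b) (-d) := by
  ext i j
  fin_cases i <;> fin_cases j <;> simp [herm]

/-- The linearised momentum equation at a point of the axis, at constant separation. -/
theorem linearised_momentum_equation {m : ℝ} (hm : m ≠ 0) {f f' z c s A D A' D' : ℝ} {η ζ B B' : ℂ}
    (q' : Biquat) (hc : c ^ 2 = s ^ 2 + 1) (ht : c * (A + D) = 2 * s * B.re)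
    (h : momentumFieldDeriv m f f' z 0 (herm c s c) (-m • infConj (gen η) (herm c s c)) q'
          (herm A B D) (-m • (infConj (gen η) (herm A B D) + infConj (gen ζ) (herm c s c)))
          (herm A' B' D') -
        infConj (gen η) (-m • (infConj (gen η) (herm A B D) + infConj (gen ζ) (herm c s c))) =
      infConj (gen ζ) (-m • infConj (gen η) (herm c s c))) :
    m * (4 * Complex.normSq η * s ^ 2 * A + 8 * (η.re * ζ.re + η.im * ζ.im) * c * s ^ 2 +
        8 * Complex.normSq η * c * s * B.re) = f * (z * A - A') ∧
    m * (4 * Complex.normSq η * s ^ 2 * D + 8 * (η.re * ζ.re + η.im * ζ.im) * c * s ^ 2 +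
        8 * Complex.normSq η * c * s * B.re) = f * (z * D - D') ∧
    m * (4 * Complex.normSq η * c ^ 2 * B.re + 8 * (η.re * ζ.re + η.im * ζ.im) * c ^ 2 * s +
        8 * Complex.normSq η * s ^ 2 * B.re) = f * (z * B.re - B'.re) ∧
    m * (4 * Complex.normSq η * c ^ 2 * B.im) = f * (z * B.im - B'.im) := by
  have hη : Complex.normSq η = η.re ^ 2 + η.im ^ 2 := by rw [Complex.normSq_apply]; ring
  simp only [momentumFieldDeriv, mul_zero, neg_zero, zero_smul, sub_zero, zero_sub,
    infConj_gen_herm, smul_herm, neg_herm, herm_sub, herm_add, herm_inj, det_herm, bil_herm,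
    Complex.ofReal_re, Complex.normSq_apply] at h
  obtain ⟨h1, h2, h3⟩ := h
  have h4 := congrArg Complex.im h3
  replace h3 := congrArg Complex.re h3
  simp [-Complex.ofReal_div] at h1 h2 h3 h4
  field_simp at h1 h2 h3 h4
  rw [hη]
  refine ⟨?_, ?_, ?_, ?_⟩
  · linear_combination -h1 - 4 * m * c * η.re ^ 2 * ht -
      (4 * m * η.re ^ 2 * A + 8 * m * c * η.re * ζ.re) * hc
  · linear_combination -h2 - 4 * m * c * η.re ^ 2 * ht -
      (4 * m * η.re ^ 2 * D + 8 * m * c * η.re * ζ.re) * hc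
  · linear_combination -h3 - 4 * m * s * η.re ^ 2 * ht +
      (4 * m * η.im ^ 2 * B.re + 8 * m * η.im * ζ.im * s) * hc
  · linear_combination -h4 + 4 * m * η.im ^ 2 * B.im * hc

/-- Tangency makes both displacements radial, and constant separation makes their signed sizes equal
to one `u`. The balance `m R s c = ± f σ` then linearises for each particle to `R u (s² + c²) + dR c
s = 0`. Since `s` has opposite signs at the two particles, these two equations are independent. -/
theorem linearised_equations_rigid {R dR f z σ s₁ c₁ s₂ c₂ A₁ B₁ A₂ D₂ B₂ B₂' : ℝ}
    (hm₁ : 0 < m₁) (hm₂ : 0 < m₂) (hR : 0 < R) (hf : 0 < f) (hσ : 0 < σ)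
    (hs₁ : 0 < s₁) (hs₂ : s₂ < 0) (hc₁ : 0 < c₁) (hc₂ : 0 < c₂)
    (h₁ : c₁ ^ 2 = s₁ ^ 2 + 1) (h₂ : c₂ ^ 2 = s₂ ^ 2 + 1) (hz : z = c₁ * c₂ - s₁ * s₂)
    (hσ' : σ = s₁ * c₂ - s₂ * c₁)
    (b₁ : m₁ * R * (s₁ * c₁) = f * σ) (b₂ : m₂ * R * (s₂ * c₂) = -(f * σ))
    (t₁ : c₁ * (A₁ + A₁) = 2 * s₁ * B₁) (t₂ : c₂ * (A₂ + D₂) = 2 * s₂ * B₂)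
    (hd : A₁ * c₂ - B₁ * s₂ + c₁ * (A₂ + D₂) / 2 - s₁ * B₂ = 0)
    (e₁ : m₁ * (R * s₁ ^ 2 * A₁ + dR * c₁ * s₁ ^ 2 + 2 * R * c₁ * s₁ * B₁) = f * (z * A₁ - A₂))
    (e₁' : m₁ * (R * s₁ ^ 2 * A₁ + dR * c₁ * s₁ ^ 2 + 2 * R * c₁ * s₁ * B₁) = f * (z * A₁ - D₂))
    (e₁'' : m₁ * (R * c₁ ^ 2 * 0) = f * (z * 0 - B₂'))
    (e₂ : m₂ * (R * s₂ ^ 2 * A₂ + dR * c₂ * s₂ ^ 2 + 2 * R * c₂ * s₂ * B₂) = f * (z * A₂ - A₁)) :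
    dR = 0 ∧ A₁ = 0 ∧ B₁ = 0 ∧ A₂ = 0 ∧ D₂ = 0 ∧ B₂ = 0 ∧ B₂' = 0 := by
  have hD : D₂ = A₂ := by
    have := mul_left_cancel₀ hf.ne' (e₁.symm.trans e₁')
    linarith
  have hB' : B₂' = 0 := by
    have : f * B₂' = 0 := by linear_combination e₁''
    exact (mul_eq_zero.mp this).resolve_left hf.ne'
  subst hD
  obtain ⟨u, rfl⟩ : ∃ u, B₁ = c₁ * u := ⟨B₁ / c₁, by field_simp⟩
  obtain ⟨u', rfl⟩ : ∃ u', B₂ = c₂ * u' := ⟨B₂ / c₂, by field_simp⟩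
  have hA₁ : A₁ = s₁ * u := mul_left_cancel₀ hc₁.ne' (by linear_combination t₁ / 2)
  have hA₂ : D₂ = s₂ * u' := mul_left_cancel₀ hc₂.ne' (by linear_combination t₂ / 2)
  subst hA₁ hA₂
  have hu : u' = u := by
    have : σ * (u' - u) = 0 := by rw [hσ']; linear_combination -hd
    linarith [(mul_eq_zero.mp this).resolve_left hσ.ne']
  subst hu
  have g₁ : R * u' * (s₁ ^ 2 + c₁ ^ 2) + dR * (c₁ * s₁) = 0 := by
    have : m₁ * s₁ * (R * u' * (s₁ ^ 2 + c₁ ^ 2) + dR * (c₁ * s₁)) = 0 := by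
      rw [hz] at e₁
      rw [hσ'] at b₁
      linear_combination e₁ - u' * c₁ * b₁ + f * u' * s₂ * h₁
    exact (mul_eq_zero.mp this).resolve_left (by positivity)
  have g₂ : R * u' * (s₂ ^ 2 + c₂ ^ 2) + dR * (c₂ * s₂) = 0 := by
    have : m₂ * s₂ * (R * u' * (s₂ ^ 2 + c₂ ^ 2) + dR * (c₂ * s₂)) = 0 := by
      rw [hz] at e₂
      rw [hσ'] at b₂
      linear_combination e₂ - u' * c₂ * b₂ + f * u' * s₁ * h₂
    exact (mul_eq_zero.mp this).resolve_left (mul_ne_zero hm₂.ne' hs₂.ne)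
  have hdR : dR = 0 := by
    have h3 : dR * (c₁ * s₁ * (s₂ ^ 2 + c₂ ^ 2) + c₂ * (-s₂) * (s₁ ^ 2 + c₁ ^ 2)) = 0 := by
      linear_combination (s₂ ^ 2 + c₂ ^ 2) * g₁ - (s₁ ^ 2 + c₁ ^ 2) * g₂
    have h4 : 0 < -s₂ := by linarith
    exact (mul_eq_zero.mp h3).resolve_right (by positivity)
  have hu : u' = 0 := by
    rw [hdR, zero_mul, add_zero] at g₁
    have := (mul_eq_zero.mp g₁).resolve_right (by positivity)
    exact (mul_eq_zero.mp this).resolve_left hR.ne'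
  subst hu
  simp [hdR, hB']

/-- With the first displacement radial, rigidity leaves both positions fixed and `|η|²` stationary.
The variation `ζ` of the eigenvalue is then orthogonal to `η`, that is a real multiple of `iη`. -/
theorem linearised_solution_of_gauge (hm₁ : 0 < m₁) (hm₂ : 0 < m₂) {θ ψ : ℝ} (hψ : 0 < ψ)
    {A B : ℝ} {p₁ q₂ p₂ : Biquat} {ζ : ℂ}
    (hv : (herm A (B : ℂ) A, p₁, q₂, p₂) ∈ phaseTangent (relEq m₁ m₂ (θ, ψ)))
    (hL : linearisation m₁ m₂ (relEq m₁ m₂ (θ, ψ)) (gen (eigenvalue m₁ m₂ θ ψ))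
      (herm A (B : ℂ) A, p₁, q₂, p₂) = infAct (gen ζ) (relEq m₁ m₂ (θ, ψ)))
    (hd : coshSepDeriv (relEq m₁ m₂ (θ, ψ)) (herm A (B : ℂ) A, p₁, q₂, p₂) = 0) :
    ∃ a : ℝ, ((herm A (B : ℂ) A, p₁, q₂, p₂) : State) =
      (0, -m₁ • infConj (gen (a * Complex.I * eigenvalue m₁ m₂ θ ψ))
          (axisPoint (axisDist m₁ m₂ ψ)),
        0, -m₂ • infConj (gen (a * Complex.I * eigenvalue m₁ m₂ θ ψ))
          (axisPoint (-axisDist m₂ m₁ ψ))) := by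
  have hz : 1 < coshSep (relEq m₁ m₂ (θ, ψ)) := by
    rw [coshSep_relEq hm₁ hm₂]
    exact Real.one_lt_cosh.mpr hψ.ne'
  have b₁ := balance hm₁ hm₂ hψ
  have b₂ := balance hm₂ hm₁ hψ
  rw [force_comm, sqSpeed_comm] at b₂
  have hη := normSq_eigenvalue hm₁ hm₂ θ hψ
  have hR := sqSpeed_pos hm₁ hm₂ hψ
  have hsum := axisDist_add hm₁ hm₂ ψ
  have hσ := Real.sinh_pos_iff.mpr hψ
  have hf : 0 < force m₁ m₂ (Real.cosh ψ) := by
    rw [force_cosh m₁ m₂ hψ]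
    positivity
  have hc₁ := Real.cosh_pos (axisDist m₁ m₂ ψ)
  have hc₂ := Real.cosh_pos (axisDist m₂ m₁ ψ)
  have hs₁ : 0 < Real.sinh (axisDist m₁ m₂ ψ) := by
    refine pos_of_mul_pos_left (pos_of_mul_pos_right (b₁ ▸ mul_pos hf hσ) ?_) hc₁.le
    positivity
  have hs₂ : 0 < Real.sinh (axisDist m₂ m₁ ψ) := by
    refine pos_of_mul_pos_left (pos_of_mul_pos_right (b₂ ▸ mul_pos hf hσ) ?_) hc₂.le
    positivity
  rw [linearisation_apply m₁ m₂ hz] at hL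
  simp only [hamiltonianFieldDeriv, hd, coshSep_relEq hm₁ hm₂] at hL
  rw [mem_phaseTangent_iff] at hv
  obtain ⟨-, -, hq₂, -, t₁, -, t₂, -⟩ := hv
  obtain ⟨A₂, B₂, D₂, rfl⟩ := exists_eq_herm hq₂
  have h₁ := Real.cosh_sq (axisDist m₁ m₂ ψ)
  have h₂ := Real.cosh_sq (axisDist m₂ m₁ ψ)
  have hzz : Real.cosh ψ = Real.cosh (axisDist m₁ m₂ ψ) * Real.cosh (axisDist m₂ m₁ ψ) +
      Real.sinh (axisDist m₁ m₂ ψ) * Real.sinh (axisDist m₂ m₁ ψ) := by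
    rw [← Real.cosh_add, hsum]
  have hss : Real.sinh ψ = Real.sinh (axisDist m₁ m₂ ψ) * Real.cosh (axisDist m₂ m₁ ψ) +
      Real.cosh (axisDist m₁ m₂ ψ) * Real.sinh (axisDist m₂ m₁ ψ) := by
    rw [← Real.sinh_add, hsum]
  simp only [relEq, stateOf, coshSepDeriv, infAct_eq, axisPoint, Real.cosh_neg, Real.sinh_neg,
    State.q₁, State.p₁, State.q₂, State.p₂, Prod.mk_sub_mk, Prod.mk.injEq] at hL t₁ t₂ hd ⊢
  generalize eigenvalue m₁ m₂ θ ψ = η at *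
  generalize Real.cosh (axisDist m₁ m₂ ψ) = c₁ at *
  generalize Real.sinh (axisDist m₁ m₂ ψ) = s₁ at *
  generalize Real.cosh (axisDist m₂ m₁ ψ) = c₂ at *
  generalize Real.sinh (axisDist m₂ m₁ ψ) = s₂ at *
  generalize deriv (force m₁ m₂) (Real.cosh ψ) = f' at *
  generalize force m₁ m₂ (Real.cosh ψ) = f at *
  generalize Real.cosh ψ = z at *
  generalize Real.sinh ψ = σ at *
  generalize sqSpeed m₁ m₂ ψ = R at *
  obtain ⟨l₁, l₂, l₃, l₄⟩ := hL
  have e : ∀ {m : ℝ} (_ : m ≠ 0) {p a b : Biquat}, -(1 / m) • p - a = b → p = -m • (a + b) := by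
    intro m hm p a b h
    rw [← h, add_sub_cancel, smul_smul]
    simp [hm]
  have k₁ := e hm₁.ne' l₁
  have k₂ := e hm₂.ne' l₃
  subst k₁ k₂
  rw [bil_herm] at t₁ t₂
  rw [bil_herm, bil_herm] at hd
  norm_cast at t₁ t₂ hd
  obtain ⟨e₁, e₁', -, e₁''⟩ := linearised_momentum_equation hm₁.ne' _ h₁
    (by rw [Complex.ofReal_re]; linarith) l₂
  obtain ⟨e₂, -⟩ := linearised_momentum_equation hm₂.ne' _ (by rw [neg_sq]; exact h₂)
    (by linarith) l₄
  rw [Complex.ofReal_re, hη] at e₁ e₁'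
  rw [Complex.ofReal_im, hη] at e₁''
  rw [hη] at e₂
  obtain ⟨g, rfl, rfl, rfl, rfl, g₁, g₂⟩ := linearised_equations_rigid (R := 4 * R)
    (dR := 8 * (η.re * ζ.re + η.im * ζ.im)) (s₂ := -s₂) (z := z) (A₁ := A) (B₁ := B) (A₂ := A₂)
    (D₂ := D₂) (B₂ := B₂.re) (B₂' := B₂.im) hm₁ hm₂ (by linarith)
    hf hσ hs₁ (neg_lt_zero.mpr hs₂) hc₁ hc₂ h₁ (by rw [neg_sq]; exact h₂)
    (by linarith) (by linarith) b₁ (by linarith) (by linarith) (by linarith) (by linarith)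
    (by linear_combination e₁) (by linear_combination e₁') (by linear_combination e₁'')
    (by linear_combination e₂)
  have hB₂ : B₂ = 0 := Complex.ext g₁ g₂
  subst hB₂
  have h0 : herm 0 0 0 = 0 := by
    ext i j
    fin_cases i <;> fin_cases j <;> simp [herm]
  have h0' : infConj (gen η) 0 = 0 := by simp [infConj]
  have hn : η.re ^ 2 + η.im ^ 2 = R := by rw [← hη, Complex.normSq_apply]; ring
  -- The coefficient is `Im(η̄ ζ)/|η|²`; the real part of `η̄ ζ` vanishes by `g`.
  have hζ : ζ = ((ζ.im * η.re - ζ.re * η.im) / R : ℝ) * Complex.I * η := by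
    apply Complex.ext
    · simp only [Complex.mul_re, Complex.mul_im, Complex.ofReal_re, Complex.ofReal_im,
        Complex.I_re, Complex.I_im]
      field_simp
      linear_combination -ζ.re * hn + η.re * g / 8
    · simp only [Complex.mul_re, Complex.mul_im, Complex.ofReal_re, Complex.ofReal_im,
        Complex.I_re, Complex.I_im]
      field_simp
      linear_combination -ζ.im * hn + η.im * g / 8
  refine ⟨(ζ.im * η.re - ζ.re * η.im) / R, ?_⟩
  rw [← hζ, Complex.ofReal_zero, h0, h0', zero_add, zero_add]
  exact ⟨rfl, rfl, rfl, rfl⟩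

theorem coshSepDeriv_sub (x v w : State) :
    coshSepDeriv x (v - w) = coshSepDeriv x v - coshSepDeriv x w := by
  rw [coshSepDeriv, coshSepDeriv, coshSepDeriv, ← Complex.sub_re]
  refine (congrArg Complex.re
    (congrArg₂ (· + ·) (bil_sub_left _ _ _) (bil_sub_right _ _ _))).trans ?_
  congr 1
  ring

/-- At constant separation the linearised equations only admit rotations of the phase, up to the
symmetry. -/
theorem linearised_solution (hm₁ : 0 < m₁) (hm₂ : 0 < m₂) {θ ψ : ℝ} (hψ : 0 < ψ)
    {v : State} {ζ : Biquat} (hv : v ∈ phaseTangent (relEq m₁ m₂ (θ, ψ))) (hζ : ζ.trace = 0)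
    (hL : linearisation m₁ m₂ (relEq m₁ m₂ (θ, ψ)) (gen (eigenvalue m₁ m₂ θ ψ)) v =
      infAct ζ (relEq m₁ m₂ (θ, ψ)))
    (hd : coshSepDeriv (relEq m₁ m₂ (θ, ψ)) v = 0) :
    ∃ (χ : Biquat) (a : ℝ), χ.trace = 0 ∧ v - infAct χ (relEq m₁ m₂ (θ, ψ)) =
      (0, -m₁ • infConj (gen (a * Complex.I * eigenvalue m₁ m₂ θ ψ))
          (axisPoint (axisDist m₁ m₂ ψ)),
        0, -m₂ • infConj (gen (a * Complex.I * eigenvalue m₁ m₂ θ ψ))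
          (axisPoint (-axisDist m₂ m₁ ψ))) := by
  have hz : 1 < coshSep (relEq m₁ m₂ (θ, ψ)) := by
    rw [coshSep_relEq hm₁ hm₂]
    exact Real.one_lt_cosh.mpr hψ.ne'
  have hη : eigenvalue m₁ m₂ θ ψ ≠ 0 := by
    rw [← Complex.normSq_pos, normSq_eigenvalue hm₁ hm₂ θ hψ]
    exact sqSpeed_pos hm₁ hm₂ hψ
  have hs : Real.sinh (axisDist m₁ m₂ ψ) ≠ 0 := by
    intro h
    have h1 := balance hm₁ hm₂ hψ
    have hσ := Real.sinh_pos_iff.mpr hψ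
    rw [h, force_cosh m₁ m₂ hψ] at h1
    have : 0 < m₁ * m₂ / Real.sinh ψ ^ 3 * Real.sinh ψ := by positivity
    linarith
  have hc := (Real.cosh_pos (axisDist m₁ m₂ ψ)).ne'
  -- The commutator with `diag(η, -η)` multiplies the off-diagonal entries by `∓ 2η ≠ 0`, so a gauge
  -- change makes `ζ` diagonal.
  obtain ⟨w₁, w₂, hχ₁⟩ : ∃ y w : ℂ, ζ - (!![0, y; w, 0] * gen (eigenvalue m₁ m₂ θ ψ) -
      gen (eigenvalue m₁ m₂ θ ψ) * !![0, y; w, 0]) = gen (ζ 0 0) := by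
    refine ⟨-ζ 0 1 / (2 * eigenvalue m₁ m₂ θ ψ), ζ 1 0 / (2 * eigenvalue m₁ m₂ θ ψ), ?_⟩
    rw [Matrix.trace_fin_two] at hζ
    ext i j
    fin_cases i <;> fin_cases j <;> simp [gen]
    · field_simp; ring
    · field_simp; ring
    · linear_combination hζ
  set χ₁ : Biquat := !![0, w₁; w₂, 0] with hχ₁_def
  have tχ₁ : χ₁.trace = 0 := by simp [hχ₁_def, Matrix.trace_fin_two]
  have hx := hamiltonianField_relEq hm₁ hm₂ θ hψ
  have hps := relEq_mem_phaseSpace hm₁ hm₂ θ hψ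
  have hv₁ := sub_mem_phaseTangent hv (infAct_mem_phaseTangent tχ₁ hps)
  obtain ⟨A, B, D, hABD⟩ := exists_eq_herm hv₁.1
  -- The remaining gauge freedom commutes with the generator: translation along the axis removes the
  -- difference of the diagonal entries, and rotation about it removes `Im B`. The latter needs the
  -- particle off the axis.
  obtain ⟨χ₀, hr, hi⟩ : ∃ χ₀ : ℂ, 2 * χ₀.re * Real.cosh (axisDist m₁ m₂ ψ) = (A - D) / 2 ∧
      2 * χ₀.im * Real.sinh (axisDist m₁ m₂ ψ) = B.im :=
    ⟨⟨(A - D) / (4 * Real.cosh (axisDist m₁ m₂ ψ)),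
      B.im / (2 * Real.sinh (axisDist m₁ m₂ ψ))⟩, by field_simp; ring, by field_simp⟩
  have tχ : (χ₁ + gen χ₀).trace = 0 := by rw [Matrix.trace_add, tχ₁, trace_gen, add_zero]
  have hq : (v - infAct (χ₁ + gen χ₀) (relEq m₁ m₂ (θ, ψ))).q₁ =
      herm ((A + D) / 2) (B.re : ℂ) ((A + D) / 2) := by
    rw [infAct_add_gen, ← sub_sub]
    refine (congrArg (· - infConj (gen χ₀) (axisPoint (axisDist m₁ m₂ ψ))) hABD).trans ?_
    simp only [axisPoint]
    rw [infConj_gen_herm, herm_sub, herm_inj]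
    refine ⟨by linarith, by linarith, ?_⟩
    apply Complex.ext <;> simp [-Complex.ofReal_sinh, hi]
  have hv₂ := sub_mem_phaseTangent hv (infAct_mem_phaseTangent tχ hps)
  have hcomm : ζ - ((χ₁ + gen χ₀) * gen (eigenvalue m₁ m₂ θ ψ) -
      gen (eigenvalue m₁ m₂ θ ψ) * (χ₁ + gen χ₀)) = gen (ζ 0 0) := by
    rw [← hχ₁, add_mul, mul_add]
    have : gen χ₀ * gen (eigenvalue m₁ m₂ θ ψ) = gen (eigenvalue m₁ m₂ θ ψ) * gen χ₀ := by
      ext i j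
      fin_cases i <;> fin_cases j <;> simp [gen, mul_comm]
    rw [this]
    abel
  have hL₂ : linearisation m₁ m₂ (relEq m₁ m₂ (θ, ψ)) (gen (eigenvalue m₁ m₂ θ ψ))
      (v - infAct (χ₁ + gen χ₀) (relEq m₁ m₂ (θ, ψ))) =
      infAct (gen (ζ 0 0)) (relEq m₁ m₂ (θ, ψ)) := by
    rw [map_sub, hL, linearisation_infAct m₁ m₂ hz hx tχ, ← infAct_sub_gen, hcomm]
  have hd₂ : coshSepDeriv (relEq m₁ m₂ (θ, ψ))
      (v - infAct (χ₁ + gen χ₀) (relEq m₁ m₂ (θ, ψ))) = 0 := by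
    rw [coshSepDeriv_sub, hd, coshSepDeriv_infAct tχ, sub_zero]
  generalize hu : v - infAct (χ₁ + gen χ₀) (relEq m₁ m₂ (θ, ψ)) = u at hq hv₂ hL₂ hd₂
  obtain ⟨u₁, u₂, u₃, u₄⟩ := u
  obtain rfl : u₁ = _ := hq
  obtain ⟨a, ha⟩ := linearised_solution_of_gauge hm₁ hm₂ hψ hv₂ hL₂ hd₂
  exact ⟨_, a, tχ, hu.trans ha⟩

/-! ### Degeneracy -/

/-- A null vector is split into a velocity of the family in a direction `(a, b)` and an orbit
vector. The orbit vector does not affect the Casimir, so `(a, b)` lies in the kernel of its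
differential. -/
theorem jacobian_eq_zero_of_isDegenerate_relEq (hm₁ : 0 < m₁) (hm₂ : 0 < m₂) {θ ψ : ℝ}
    (hψ : 0 < ψ) (h : IsDegenerate m₁ m₂ (relEq m₁ m₂ (θ, ψ)) (gen (eigenvalue m₁ m₂ θ ψ))) :
    jacobian m₁ m₂ θ ψ = 0 := by
  obtain ⟨v, ⟨hv, hcas⟩, hv', ζ, hζ, hL⟩ := h
  have hσ := Real.sinh_pos_iff.mpr hψ
  -- The family moves `cosh ψ` at rate `b sinh ψ`, so this `b` reproduces the change of separation
  -- along `v`.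
  set b := coshSepDeriv (relEq m₁ m₂ (θ, ψ)) v / Real.sinh ψ with hb
  obtain ⟨w, η', hw, hη'⟩ := exists_hasDerivAt_relEq hm₁ hm₂ θ hψ 0 b
  obtain ⟨w1, w2, w3, w4⟩ := linearisation_of_hasDerivAt hm₁ hm₂ hψ hw hη'
  obtain ⟨χ, a, hχ, hu⟩ := linearised_solution hm₁ hm₂ hψ (ζ := ζ - gen η')
    (sub_mem_phaseTangent hv w1)
    (by rw [Matrix.trace_sub, hζ, trace_gen, sub_zero]) (by rw [map_sub, hL, w2, infAct_sub_gen])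
    (by rw [coshSepDeriv_sub, w3, hb]; field_simp; ring)
  obtain ⟨u, μ', hu', hμ'⟩ := exists_hasDerivAt_relEq hm₁ hm₂ θ hψ a 0
  obtain ⟨-, -, -, u4⟩ := linearisation_of_hasDerivAt hm₁ hm₂ hψ hu' hμ'
  have hp := hasDerivAt_relEq_phase m₁ m₂ θ ψ a
  simp only [mul_zero, add_zero] at hu'
  rw [hp.unique hu'] at hu
  have hv_eq : v = w + infAct χ (relEq m₁ m₂ (θ, ψ)) + u := by
    rw [← hu]; abel
  have hdiag : (diagramDeriv m₁ m₂ θ ψ a b).2 = 0 := by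
    rw [hv_eq, map_add, map_add, w4, u4, fderiv_casimir_infAct hχ, add_zero] at hcas
    rw [← hcas, diagramDeriv, diagramDeriv, diagramDeriv]
    have : velocity m₁ m₂ θ ψ a b = velocity m₁ m₂ θ ψ 0 b + velocity m₁ m₂ θ ψ a 0 := by
      rw [velocity, velocity, velocity]
      apply Complex.ext <;> simp only [Complex.add_re, Complex.add_im] <;> ring
    simp only [this]
    ring
  refine jacobian_eq_zero_of_velocity hm₁ hm₂ hψ
    ((diagramDeriv_eq_zero_iff hm₁ hm₂ θ hψ a b).mp hdiag) ?_
  -- For `a = b = 0` both family velocities vanish and `v` would be tangent to the orbit.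
  by_contra! hab
  obtain ⟨ha0, hb0⟩ := hab
  rw [hb0] at hw
  rw [ha0] at hu'
  simp only [mul_zero, add_zero] at hw hu'
  have e1 := hw.unique (hasDerivAt_const _ _)
  have e2 := hu'.unique (hasDerivAt_const _ _)
  rw [e1, e2, zero_add, add_zero] at hv_eq
  exact hv' ⟨χ, hχ, hv_eq⟩

theorem isDegenerate_relEq_iff (hm₁ : 0 < m₁) (hm₂ : 0 < m₂) {θ ψ : ℝ} (hψ : 0 < ψ) :
    IsDegenerate m₁ m₂ (relEq m₁ m₂ (θ, ψ)) (gen (eigenvalue m₁ m₂ θ ψ)) ↔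
      jacobian m₁ m₂ θ ψ = 0 :=
  ⟨jacobian_eq_zero_of_isDegenerate_relEq hm₁ hm₂ hψ, isDegenerate_relEq_of_jacobian hm₁ hm₂ hψ⟩

/-! ### Invariance of degeneracy under conjugation. -/

theorem act_mem_phaseTangent {g : Biquat} (hg : g.det = 1) {x v : State}
    (hv : v ∈ phaseTangent x) : act g v ∈ phaseTangent (act g x) := by
  obtain ⟨a1, a2, a3, a4, a5, a6, a7, a8⟩ := hv
  refine ⟨isHermitian_conj g a1, isHermitian_conj g a2, isHermitian_conj g a3,
    isHermitian_conj g a4, ?_, ?_, ?_, ?_⟩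
  · exact (bil_conj hg _ _).trans a5
  · exact (congrArg₂ (· + ·) (bil_conj hg _ _) (bil_conj hg _ _)).trans a6
  · exact (bil_conj hg _ _).trans a7
  · exact (congrArg₂ (· + ·) (bil_conj hg _ _) (bil_conj hg _ _)).trans a8

theorem act_mem_orbitTangent {g h : Biquat} (hg : h * g = 1) {x v : State}
    (hv : v ∈ orbitTangent x) : act g v ∈ orbitTangent (act g x) := by
  obtain ⟨ζ, hζ, rfl⟩ := hv
  refine ⟨g * ζ * h, ?_, (infAct_act hg ζ x).symm⟩
  rw [Matrix.trace_mul_comm, ← mul_assoc, hg, one_mul, hζ]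

theorem hasDerivAt_act (g : Biquat) {γ : ℝ → State} {v : State} {t : ℝ}
    (hγ : HasDerivAt γ v t) : HasDerivAt (fun s => act g (γ s)) (act g v) t := by
  have h : ∀ {f : ℝ → Biquat} {f' : Biquat}, HasDerivAt f f' t →
      HasDerivAt (fun s => conj g (f s)) (conj g f') t :=
    fun hf => (hf.const_mul g).mul_const g.conjTranspose
  exact (h (hasDerivAt_q₁ hγ)).prodMk <| (h (hasDerivAt_p₁ hγ)).prodMk <|
    (h (hasDerivAt_q₂ hγ)).prodMk (h (hasDerivAt_p₂ hγ))

theorem hasDerivAt_segment (x v : State) : HasDerivAt (fun t : ℝ => x + t • v) v 0 := by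
  have h := ((hasDerivAt_id (0 : ℝ)).smul_const v).const_add x
  rwa [one_smul] at h

theorem fderiv_casimir_act {g : Biquat} (hg : g.det = 1) (x v : State) :
    fderiv ℝ casimir (act g x) (act g v) = fderiv ℝ casimir x v := by
  have h := hasDerivAt_segment x v
  have h1 := (differentiable_casimir _).hasFDerivAt.comp_hasDerivAt (0 : ℝ) (hasDerivAt_act g h)
  have h2 := (differentiable_casimir _).hasFDerivAt.comp_hasDerivAt (0 : ℝ) h
  simp only [Function.comp_def, casimir_act hg, zero_smul, add_zero] at h1 h2
  exact h1.unique h2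

theorem linearisation_act (m₁ m₂ : ℝ) {g h : Biquat} (hg : g.det = 1) (hhg : h * g = 1)
    {x : State} (hz : 1 < coshSep x) (ξ : Biquat) (v : State) :
    linearisation m₁ m₂ (act g x) (g * ξ * h) (act g v) = act g (linearisation m₁ m₂ x ξ v) := by
  have hs := hasDerivAt_segment x v
  have h1 := hasDerivAt_hamiltonianField m₁ m₂ (hasDerivAt_act g hs)
    (by simpa [coshSep_act hg] using hz)
  have h2 := hasDerivAt_act g (hasDerivAt_hamiltonianField m₁ m₂ hs (by simpa using hz))
  simp only [hamiltonianField_act m₁ m₂ hg, zero_smul, add_zero] at h1 h2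
  rw [linearisation_apply m₁ m₂ (by rwa [coshSep_act hg]), linearisation_apply m₁ m₂ hz, act_sub,
    h1.unique h2, infAct_act hhg]

theorem IsDegenerate.act {g h : Biquat} (hg : g.det = 1) (hhg : h * g = 1) {x : State}
    (hz : 1 < coshSep x) {ξ : Biquat} (hx : IsDegenerate m₁ m₂ x ξ) :
    IsDegenerate m₁ m₂ (act g x) (g * ξ * h) := by
  obtain ⟨v, ⟨h1, h2⟩, h3, h4⟩ := hx
  refine ⟨HypTwoBody.act g v, ⟨act_mem_phaseTangent hg h1, ?_⟩, fun h5 => h3 ?_, ?_⟩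
  · rw [fderiv_casimir_act hg, h2]
  · have h6 := act_mem_orbitTangent (mul_eq_one_comm.mp hhg) h5
    rwa [act_act, act_act, hhg, act_one, act_one] at h6
  · rw [linearisation_act m₁ m₂ hg hhg hz]
    exact act_mem_orbitTangent hhg h4

theorem isDegenerate_act_iff {g : Biquat} (hg : g.det = 1) {x : State} (hz : 1 < coshSep x)
    (ξ : Biquat) :
    IsDegenerate m₁ m₂ (act g x) (g * ξ * g.adjugate) ↔ IsDegenerate m₁ m₂ x ξ := by
  have h1 : g.adjugate * g = 1 := by rw [Matrix.adjugate_mul, hg, one_smul]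
  have h2 := mul_eq_one_comm.mp h1
  refine ⟨fun h => ?_, fun h => h.act hg h1 hz⟩
  have h3 := h.act (g := g.adjugate) (h := g) (by rw [Matrix.det_adjugate, hg, one_pow]) h2
    (by rwa [coshSep_act hg])
  rwa [act_act, h1, act_one, mul_assoc, mul_assoc (g * ξ), h1, mul_one, ← mul_assoc,
    h1, one_mul] at h3

end HypTwoBody

end

/-! ### The energy-Casimir diagram and its cusps. -/

theorem mainTheorem3 (m₁ m₂ : ℝ) (hm₁ : 0 < m₁) (hm₂ : 0 < m₂) :
    ∃ D : ℝ × ℝ → ℝ × ℂ,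
      ContDiffOn ℝ ∞ D (Set.univ ×ˢ Set.Ioi 0) ∧
      ∀ θ ψ : ℝ, 0 < ψ →
        (∃ x ξ, HypTwoBody.IsRelEquilibriumWith m₁ m₂ x ξ θ ψ) ∧
        (∀ x ξ, HypTwoBody.IsRelEquilibriumWith m₁ m₂ x ξ θ ψ →
          (HypTwoBody.IsDegenerate m₁ m₂ x ξ ↔ HypTwoBody.Gam m₁ m₂ θ ψ = 0) ∧
          HypTwoBody.energyCasimir m₁ m₂ x = D (θ, ψ)) ∧
        (HypTwoBody.IsSingularAt D (θ, ψ) ↔ HypTwoBody.Gam m₁ m₂ θ ψ = 0) ∧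
        (HypTwoBody.IsSingularAt D (θ, ψ) → HypTwoBody.HasCuspAt D (θ, ψ)) := by
  refine ⟨HypTwoBody.diagram m₁ m₂, ?_, fun θ ψ hψ =>
    ⟨⟨_, _, HypTwoBody.isRelEquilibrium_relEq hm₁ hm₂ θ hψ⟩, ?_, ?_, ?_⟩⟩
  · rintro ⟨θ, ψ⟩ ⟨-, hψ⟩
    exact (HypTwoBody.contDiffAt_diagram hm₁ hm₂ θ hψ).contDiffWithinAt
  · intro x ξ hx
    obtain ⟨g, hg, rfl, rfl⟩ := HypTwoBody.exists_act_relEq hm₁ hm₂ hx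
    constructor
    · rw [HypTwoBody.isDegenerate_act_iff hg, HypTwoBody.isDegenerate_relEq_iff hm₁ hm₂ hψ,
        HypTwoBody.Gam_eq_zero_iff hm₁ hm₂ θ hψ]
      rw [HypTwoBody.coshSep_relEq hm₁ hm₂]
      exact Real.one_lt_cosh.mpr hψ.ne'
    · rw [HypTwoBody.energyCasimir_act m₁ m₂ hg, HypTwoBody.energyCasimir_relEq hm₁ hm₂ θ hψ]
  · rw [HypTwoBody.isSingularAt_diagram_iff hm₁ hm₂ θ hψ, HypTwoBody.Gam_eq_zero_iff hm₁ hm₂ θ hψ]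
  · rw [HypTwoBody.isSingularAt_diagram_iff hm₁ hm₂ θ hψ]
    exact HypTwoBody.hasCuspAt_diagram hm₁ hm₂ hψ
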